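/- Let $F_4=\langle a,b,c,d\rangle$ be the free group of rank $4$. Let $\partial F_4$ be its boundary (the right-infinite reduced words), and let $\overline F_4=F_4\cup\partial F_4$ carry the compact topology generated by the singletons $\{g\}$, $g\in F_4$, and the cylinders $C_w$ (all finite or infinite reduced words with prefix $w$). An automorphism $\phi$ of $F_4$ extends to a homeomorphism $\overline\phi$ of $\overline F_4$, equal to $\phi$ on $F_4$ and to the boundary homeomorphism $\partial\phi$ on $\partial F_4$. Write $\omega_\phi(x)=\lim_{n\to+\infty}\overline\phi^{\,n}(x)$ when the limit exists. * A point $X\in\partial F_4$ is a parabolic fixed point of $\phi$ if there is $Y\in\partial F_4$, $Y\ne X$, with $\lim_{n\to\pm\infty}\partial\phi^n(Y)=X$; in that case $\phi$ has a parabolic orbit. * $\phi$ is rotationless if every periodic point of $\overline\phi$ is fixed. * $X\in\partial F_4$ is a limit point of $\phi$ if $X=\omega_{\phi}(x)$ for some $x\in\overline F_4$ with $\overline\phi(x)\ne x$, or $X=\omega_{\phi^{-1}}(x)$ for some such $x$. * $X,Y\in\partial F_4$ are isogloss if $X=gY$ for some $g\in F_4$ with $\phi(g)=g$. * The dynamics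 graph $\Gamma_\phi$ is the oriented graph whose vertices are the isoglossy classes of limit points, with an edge from $x_1$ to $x_2$ if there are representatives $X_1$ of $x_1$ and $X_2$ of $x_2$ and a point $X\in\partial F_4$, not fixed by $\partial\phi$, with $\omega_{\phi^{-1}}(X)=X_1$ and $\omega_\phi(X)=X_2$. For every integer $k\ge1$ let $\phi_k$ be the automorphism of $F_4$ given by $a\mapsto a$, $b\mapsto ba$, $c\mapsto ca^{k+1}$, $d\mapsto dc$, and put $$X_k^+=d\,c\,c\,a^{k+1}c\,a^{2(k+1)}c\,a^{3(k+1)}\cdots,\qquad X_k^-=d\,a^{k+1}c^{-1}a^{2(k+1)}c^{-1}a^{3(k+1)}c^{-1}\cdots .$$ **Theorem.** 1. For every $k\ge1$, $\phi_k$ has a parabolic orbit. More precisely, $ba^{-\infty}$ is a parabolic fixed point of $\phi_k$, and $\lim_{n\to+\infty}\phi_k^n(bd^{-1})=\lim_{n\to-\infty}\phi_k^n(bd^{-1})=ba^{-\infty}$ in $\overline F_4$. 2. For every $k\ge1$, $\phi_k$ is rotationless. Its dynamics graph $\Gamma_{\phi_k}$ has exactly eight vertices, the pairwise distinct isoglossy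 classes of $ba^{-\infty}$, $ba^{+\infty}$, $X_k^-$, $X_k^+$, $a^{+\infty}$, $a^{-\infty}$, $ca^{-\infty}$, $ca^{+\infty}$, and exactly the following seven oriented edges: $$ba^{-\infty}\xrightarrow{bd^{-1}}ba^{-\infty},\quad ba^{-\infty}\xrightarrow{b}ba^{+\infty},\quad ba^{+\infty}\xrightarrow{bc^{-1}}ba^{-\infty},\quad X_k^-\xrightarrow{d}X_k^+,$$ $$a^{+\infty}\xrightarrow{b^{-1}}a^{-\infty},\quad ca^{-\infty}\xrightarrow{d^{-1}}a^{-\infty},\quad ca^{-\infty}\xrightarrow{c}ca^{+\infty}.$$ In particular $\Gamma_{\phi_k}$ has three connected components. The label $g$ on an edge from $P$ to $Q$ means that $\omega_{\phi_k^{-1}}(g)=P$ and $\omega_{\phi_k}(g)=Q$ in $\overline F_4$. 3. For all integers $k,k',p,p'\ge1$, the automorphisms $\phi_k^p$ and $\phi_{k'}^{p'}$ are conjugate in $\mathrm{Aut}(F_4)$ if and only if $k=k'$ and $p=p'$. -/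

import Mathlib

open Filter Topology

namespace FreeGroupDynamics

/-! ## The boundary of a free group and its compactification

Following Mathlib, the letter `(x, true)` stands for the generator `x` and `(x, false)` for its
inverse; `FreeGroup.toWord g` is the reduced word of `g` and `FreeGroup.norm g` its length. -/

/-- The boundary of the free group on `α`: right-infinite reduced words. -/
structure Boundary (α : Type) where
  /-- the letters of the infinite word -/
  seq : ℕ → α × Bool
  reduced : ∀ i, seq (i + 1) ≠ ((seq i).1, !(seq i).2)

/-- The compactification of the free group: the disjoint union of the group and its boundary. -/
inductive Compactification (α : Type) where
  | ofGroup (g : FreeGroup α)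
  | ofBoundary (X : Boundary α)

open Compactification

section Basic

variable {α : Type} [DecidableEq α]

/-- The letter at position `i` of a finite or infinite reduced word (`none` past the end). -/
def Compactification.letter (x : Compactification α) (i : ℕ) : Option (α × Bool) :=
  match x with
  | ofGroup g => g.toWord[i]?
  | ofBoundary X => some (X.seq i)

/-- The group element given by the first `n` letters of `x` (all of `x` if it is shorter). -/
def Compactification.take (x : Compactification α) (n : ℕ) : FreeGroup α :=
  FreeGroup.mk ((List.range n).filterMap x.letter)

/-- The cylinder `C_w`: all finite or infinite reduced words having `w` as a prefix. -/
def cylinder (w : FreeGroup α) : Set (Compactification α) :=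
  {x | ∀ i < w.norm, x.letter i = w.toWord[i]?}

/-- The topology generated by the singletons of group elements and the cylinders. On the boundary
it induces the topology whose basis consists of the cylinders. -/
instance : TopologicalSpace (Compactification α) :=
  TopologicalSpace.generateFrom
    ({s | ∃ g : FreeGroup α, s = {ofGroup g}} ∪ {s | ∃ w : FreeGroup α, s = cylinder w})

@[simp] theorem letter_ofGroup (g : FreeGroup α) (i : ℕ) :
    (ofGroup g).letter i = g.toWord[i]? := rfl

@[simp] theorem letter_ofBoundary (X : Boundary α) (i : ℕ) :
    (ofBoundary X).letter i = some (X.seq i) := rfl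

theorem letter_eq_none {g : FreeGroup α} {i : ℕ} :
    (ofGroup g).letter i = none ↔ g.norm ≤ i := by
  simp [FreeGroup.norm]

theorem compactification_ext {x y : Compactification α} (h : ∀ i, x.letter i = y.letter i) :
    x = y := by
  cases x with
  | ofGroup g =>
    cases y with
    | ofGroup k => rw [FreeGroup.toWord_injective (List.ext_getElem? h)]
    | ofBoundary Y =>
      have := h g.norm
      rw [letter_eq_none.2 le_rfl] at this
      simp at this
  | ofBoundary X =>
    cases y with
    | ofGroup k =>
      have := h k.norm
      rw [letter_eq_none.2 le_rfl] at this
      simp at this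
    | ofBoundary Y =>
      cases X; cases Y
      congr 1
      simp only [letter_ofBoundary, Option.some.injEq] at h
      simp only [Boundary.mk.injEq]
      exact funext h

theorem take_congr {x y : Compactification α} {n : ℕ} (h : ∀ i < n, x.letter i = y.letter i) :
    x.take n = y.take n := by
  unfold Compactification.take
  congr 1
  apply List.filterMap_congr
  intro i hi
  exact h i (List.mem_range.1 hi)

theorem filterMap_range_getElem? {β : Type} (l : List β) (n : ℕ) :
    (List.range n).filterMap (fun i => l[i]?) = l.take n := by
  induction n with
  | zero => simp
  | succ n ih =>
    rw [List.range_succ, List.filterMap_append, ih, List.take_add_one]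
    cases h : l[n]? <;> simp [h]

theorem toWord_take_ofGroup (g : FreeGroup α) (n : ℕ) :
    ((ofGroup g).take n).toWord = g.toWord.take n := by
  have : (List.range n).filterMap (ofGroup g).letter = g.toWord.take n :=
    filterMap_range_getElem? _ _
  rw [Compactification.take, this, FreeGroup.toWord_mk]
  exact (FreeGroup.isReduced_toWord.infix (List.take_prefix _ _).isInfix).reduce_eq

theorem take_ofGroup_of_le {g : FreeGroup α} {n : ℕ} (h : g.norm ≤ n) :
    (ofGroup g).take n = g := by
  apply FreeGroup.toWord_injective
  rw [toWord_take_ofGroup, List.take_of_length_le h]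

theorem toWord_take_ofBoundary (X : Boundary α) (n : ℕ) :
    ((ofBoundary X).take n).toWord = (List.range n).map X.seq := by
  have : (List.range n).filterMap (ofBoundary X).letter = (List.range n).map X.seq := by
    rw [← List.filterMap_eq_map]; rfl
  rw [Compactification.take, this, FreeGroup.toWord_mk]
  apply FreeGroup.IsReduced.reduce_eq
  rw [FreeGroup.IsReduced, List.isChain_iff_getElem]
  intro i hi
  simp only [List.getElem_map, List.getElem_range]
  intro h1
  by_contra h2
  refine X.reduced i (Prod.ext h1.symm ?_)
  revert h2
  cases (X.seq i).2 <;> cases (X.seq (i + 1)).2 <;> simp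

theorem letter_take_of_lt {x : Compactification α} {i n : ℕ} (h : i < n) :
    (ofGroup (x.take n)).letter i = x.letter i := by
  cases x with
  | ofGroup g => simp [toWord_take_ofGroup, h]
  | ofBoundary X => simp [toWord_take_ofBoundary, h]

theorem norm_take_ofBoundary (X : Boundary α) (n : ℕ) : ((ofBoundary X).take n).norm = n := by
  simp [FreeGroup.norm, toWord_take_ofBoundary]

theorem take_succ (x : Compactification α) (n : ℕ) :
    x.take (n + 1) = x.take n * FreeGroup.mk (x.letter n).toList := by
  unfold Compactification.take
  rw [FreeGroup.mul_mk, List.range_succ, List.filterMap_append]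
  cases h : x.letter n <;> simp [h]

/-- A sequence in the compactification converges iff each of its letters is eventually right. -/
theorem tendsto_iff_letter {β : Type} {f : β → Compactification α} {l : Filter β}
    {y : Compactification α} :
    Tendsto f l (𝓝 y) ↔ ∀ i, ∀ᶠ b in l, (f b).letter i = y.letter i := by
  rw [TopologicalSpace.tendsto_nhds_generateFrom_iff]
  constructor
  · intro h i
    cases y with
    | ofGroup g =>
      filter_upwards [h {ofGroup g} (Or.inl ⟨g, rfl⟩) rfl] with b hb
      rw [show f b = ofGroup g from hb]
    | ofBoundary X =>
      have hmem : ofBoundary X ∈ cylinder ((ofBoundary X).take (i + 1)) := by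
        intro j hj
        rw [norm_take_ofBoundary] at hj
        exact (letter_take_of_lt hj).symm
      filter_upwards [h _ (Or.inr ⟨_, rfl⟩) hmem] with b hb
      have := hb i (by rw [norm_take_ofBoundary]; omega)
      rw [this]
      exact letter_take_of_lt (Nat.lt_succ_self i)
  · intro h s hs hy
    have key : ∀ n, ∀ᶠ b in l, ∀ i < n, (f b).letter i = y.letter i := fun n => by
      have := (eventually_all_finite (Set.finite_lt_nat n)).2 fun i _ => h i
      simpa using this
    rcases hs with ⟨g, rfl⟩ | ⟨w, rfl⟩
    · obtain rfl : y = ofGroup g := hy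
      filter_upwards [key (g.norm + 1)] with b hb
      show f b = ofGroup g
      have h1 := hb g.norm (Nat.lt_succ_self _)
      rw [letter_eq_none.2 le_rfl] at h1
      cases hf : f b with
      | ofBoundary X => rw [hf] at h1; simp at h1
      | ofGroup k =>
        rw [hf] at h1 hb
        rw [letter_eq_none] at h1
        rw [← take_ofGroup_of_le h1, ← take_ofGroup_of_le (le_refl g.norm)]
        rw [take_ofGroup_of_le (le_refl g.norm)]
        congr 1
        rw [take_congr (y := ofGroup g) fun i hi => hb i (by omega)]
        exact take_ofGroup_of_le le_rfl
    · filter_upwards [key w.norm] with b hb i hi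
      rw [hb i hi, hy i hi]

/-! ## The homeomorphism induced by an automorphism -/

theorem letter_mul_single (u : FreeGroup α) (a : α × Bool) :
    (∀ i, i + 1 < u.norm → (ofGroup (u * FreeGroup.mk [a])).letter i = (ofGroup u).letter i) ∧
      u.norm ≤ (u * FreeGroup.mk [a]).norm + 1 := by
  rcases List.eq_nil_or_concat u.toWord with hw | ⟨w, b, hw⟩
  · have : u.norm = 0 := by simp [FreeGroup.norm, hw]
    exact ⟨fun i hi => by omega, by omega⟩
  · rw [List.concat_eq_append] at hw
    have hn : u.norm = w.length + 1 := by simp [FreeGroup.norm, hw]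
    have hred : FreeGroup.IsReduced (w ++ [b]) := hw ▸ FreeGroup.isReduced_toWord
    have hu : u = FreeGroup.mk (w ++ [b]) := by rw [← hw, FreeGroup.mk_toWord]
    have hprod : u * FreeGroup.mk [a] = FreeGroup.mk (w ++ [b] ++ [a]) := by
      rw [hu, FreeGroup.mul_mk]
    by_cases hab : b.1 = a.1 → b.2 = a.2
    · have hred2 : FreeGroup.IsReduced (w ++ [b] ++ [a]) := by
        refine hred.append_overlap (L₂ := [b]) ?_ (by simp)
        simpa [FreeGroup.IsReduced] using hab
      have hword : (u * FreeGroup.mk [a]).toWord = w ++ [b] ++ [a] := by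
        rw [hprod, FreeGroup.toWord_mk, hred2.reduce_eq]
      refine ⟨fun i hi => ?_, by simp [FreeGroup.norm, hword, hw]⟩
      simp only [letter_ofGroup, hword, hw]
      rw [List.getElem?_append_left (by simp; omega)]
    · have hword : (u * FreeGroup.mk [a]).toWord = w := by
        have h1 : FreeGroup.mk (w ++ [b] ++ [a]) = FreeGroup.mk w := by
          rw [List.append_assoc]
          obtain ⟨b1, b2⟩ := b
          obtain ⟨a1, a2⟩ := a
          simp only [not_forall] at hab
          obtain ⟨h1, h2⟩ := hab
          have h1 : b1 = a1 := h1
          have h2 : b2 ≠ a2 := h2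
          subst h1
          have : a2 = !b2 := by revert h2; cases a2 <;> cases b2 <;> simp
          subst this
          have := FreeGroup.Red.Step.not (L₁ := w) (L₂ := []) (x := b1) (b := b2)
          have h3 : FreeGroup.mk (w ++ [(b1, b2), (b1, !b2)]) = FreeGroup.mk (w ++ []) :=
            Quot.sound this
          rw [List.append_nil] at h3
          exact h3
        rw [hprod, h1, FreeGroup.toWord_mk]
        exact (hred.infix (List.prefix_append _ _).isInfix).reduce_eq
      refine ⟨fun i hi => ?_, by simp [FreeGroup.norm, hword, hw]⟩
      simp only [letter_ofGroup, hword, hw]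
      rw [List.getElem?_append_left (by omega)]

theorem letter_mul_of_lt (u v : FreeGroup α) (i : ℕ) (h : i + v.norm < u.norm) :
    (ofGroup (u * v)).letter i = (ofGroup u).letter i := by
  have key : ∀ (l : List (α × Bool)) (u : FreeGroup α), i + l.length < u.norm →
      (ofGroup (u * FreeGroup.mk l)).letter i = (ofGroup u).letter i := by
    intro l
    induction l with
    | nil => intro u _; rw [show FreeGroup.mk ([] : List (α × Bool)) = 1 from rfl, mul_one]
    | cons a l ih =>
      intro u hu
      rw [List.length_cons] at hu
      obtain ⟨h1, h2⟩ := letter_mul_single u a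
      rw [show FreeGroup.mk (a :: l) = FreeGroup.mk [a] * FreeGroup.mk l by
        rw [FreeGroup.mul_mk]; rfl, ← mul_assoc, ih _ (by omega), h1 i (by omega)]
  have := key v.toWord u h
  rwa [FreeGroup.mk_toWord] at this

theorem exists_norm_le [Finite α] (f : FreeGroup α →* FreeGroup α) :
    ∃ L : ℕ, ∀ g, (f g).norm ≤ L * g.norm := by
  obtain ⟨L, hL⟩ := (Set.finite_range fun a : α => (f (FreeGroup.of a)).norm).bddAbove
  refine ⟨L, fun g => ?_⟩
  have key : ∀ l : List (α × Bool), (f (FreeGroup.mk l)).norm ≤ L * l.length := by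
    intro l
    induction l with
    | nil =>
      rw [show FreeGroup.mk ([] : List (α × Bool)) = 1 from rfl, map_one]
      simp
    | cons a l ih =>
      rw [show FreeGroup.mk (a :: l) = FreeGroup.mk [a] * FreeGroup.mk l by
        rw [FreeGroup.mul_mk]; rfl, map_mul, List.length_cons, mul_add, mul_one, add_comm]
      refine (FreeGroup.norm_mul_le _ _).trans (add_le_add ?_ ih)
      obtain ⟨x, b⟩ := a
      have hx : (f (FreeGroup.of x)).norm ≤ L := hL ⟨x, rfl⟩
      cases b with
      | true => exact hx
      | false =>
        rw [show FreeGroup.mk [(x, false)] = (FreeGroup.of x)⁻¹ from rfl, map_inv,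
          FreeGroup.norm_inv_eq]
        exact hx
  have := key g.toWord
  rwa [FreeGroup.mk_toWord] at this

/-- Bounded cancellation: for an automorphism `φ`, the `i`-th letter of `φ (x.take n)` is
eventually constant in `n`, uniformly in `x`, and exists for infinite `x`. -/
theorem exists_stable [Finite α] (φ : MulAut (FreeGroup α)) :
    ∃ B : ℕ → ℕ, ∀ i n, B i ≤ n →
      (∀ x : Compactification α,
        (ofGroup (φ (x.take n))).letter i = (ofGroup (φ (x.take (B i)))).letter i) ∧
      ∀ X : Boundary α, i < (φ ((ofBoundary X).take n)).norm := by
  obtain ⟨L, hL⟩ := exists_norm_le φ.toMonoidHom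
  obtain ⟨L', hL'⟩ := exists_norm_le (φ⁻¹ : MulAut (FreeGroup α)).toMonoidHom
  have hbig : ∀ i (g : FreeGroup α), L' * (i + L) + 1 ≤ g.norm → i + L < (φ g).norm := by
    intro i g hg
    have h1 : g.norm ≤ L' * (φ g).norm := by
      have := hL' (φ g)
      have e : (φ⁻¹ : MulAut (FreeGroup α)).toMonoidHom (φ g) = g := φ.symm_apply_apply g
      rwa [e] at this
    by_contra hc
    have := Nat.mul_le_mul_left L' (not_lt.1 hc)
    omega
  refine ⟨fun i => L' * (i + L) + 1, fun i n hn => ⟨fun x => ?_, fun X => ?_⟩⟩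
  · induction n, hn using Nat.le_induction with
    | base => rfl
    | succ n hn ih =>
      rw [← ih]
      cases x with
      | ofBoundary X =>
        rw [take_succ, map_mul]
        apply letter_mul_of_lt
        have h1 := hbig i ((ofBoundary X).take n) (by rw [norm_take_ofBoundary]; exact hn)
        have h2 := hL (FreeGroup.mk ((ofBoundary X).letter n).toList)
        have h3 : (FreeGroup.mk ((ofBoundary X).letter n).toList).norm ≤ 1 := by
          refine FreeGroup.norm_mk_le.trans ?_
          simp
        have h4 := Nat.mul_le_mul_left L h3
        have h5 : (φ (FreeGroup.mk ((ofBoundary X).letter n).toList)).norm ≤ L :=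
          (h2.trans h4).trans (by simp)
        omega
      | ofGroup g =>
        by_cases hg : g.norm ≤ n
        · rw [take_ofGroup_of_le hg, take_ofGroup_of_le (by omega)]
        · rw [take_succ, map_mul]
          apply letter_mul_of_lt
          have h0 : ((ofGroup g).take n).norm = n := by
            rw [FreeGroup.norm, toWord_take_ofGroup, List.length_take]
            exact min_eq_left (by rw [FreeGroup.norm] at hg; omega)
          have h1 := hbig i ((ofGroup g).take n) (by rw [h0]; exact hn)
          have h2 := hL (FreeGroup.mk ((ofGroup g).letter n).toList)
          have h3 : (FreeGroup.mk ((ofGroup g).letter n).toList).norm ≤ 1 := by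
            refine FreeGroup.norm_mk_le.trans ?_
            cases (ofGroup g).letter n <;> simp
          have h4 := Nat.mul_le_mul_left L h3
          have h5 : (φ (FreeGroup.mk ((ofGroup g).letter n).toList)).norm ≤ L :=
            (h2.trans h4).trans (by simp)
          omega
  · have := hbig i ((ofBoundary X).take n) (by rw [norm_take_ofBoundary]; exact hn)
    omega

/-- The images of the prefixes of an infinite word converge to an infinite word. -/
theorem exists_boundaryMap [Finite α] (φ : MulAut (FreeGroup α)) (X : Boundary α) :
    ∃ Y : Boundary α,
      Tendsto (fun n => ofGroup (φ ((ofBoundary X).take n))) atTop (𝓝 (ofBoundary Y)) := by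
  obtain ⟨B, hB⟩ := exists_stable φ
  have hsome : ∀ i, ∃ a, (ofGroup (φ ((ofBoundary X).take (B i)))).letter i = some a := by
    intro i
    have := (hB i (B i) le_rfl).2 X
    exact ⟨_, List.getElem?_eq_getElem this⟩
  choose s hs using hsome
  have hall : ∀ i n, B i ≤ n → (ofGroup (φ ((ofBoundary X).take n))).letter i = some (s i) :=
    fun i n hn => ((hB i n hn).1 _).trans (hs i)
  refine ⟨⟨s, fun i hi => ?_⟩, tendsto_iff_letter.2 fun i => ?_⟩
  · have h1 := hall i (max (B i) (B (i + 1))) (le_max_left _ _)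
    have h2 := hall (i + 1) (max (B i) (B (i + 1))) (le_max_right _ _)
    have hr := FreeGroup.isReduced_toWord
      (x := φ ((ofBoundary X).take (max (B i) (B (i + 1)))))
    rw [FreeGroup.IsReduced, List.isChain_iff_getElem] at hr
    rw [letter_ofGroup, List.getElem?_eq_some_iff] at h1 h2
    obtain ⟨l1, h1⟩ := h1
    obtain ⟨l2, h2⟩ := h2
    have := hr i l2
    rw [h1, h2, hi] at this
    simp at this
  · filter_upwards [eventually_ge_atTop (B i)] with n hn
    exact hall i n hn

/-- The boundary map `∂φ`: the limit of the images of the prefixes of `X`. -/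
noncomputable def boundaryMap [Finite α] (φ : MulAut (FreeGroup α)) (X : Boundary α) :
    Boundary α :=
  Classical.choose (exists_boundaryMap φ X)

/-- The map of the compactification which is `φ` on the group and `∂φ` on the boundary. -/
noncomputable def extendFun [Finite α] (φ : MulAut (FreeGroup α)) :
    Compactification α → Compactification α
  | ofGroup g => ofGroup (φ g)
  | ofBoundary X => ofBoundary (boundaryMap φ X)

theorem exists_letter_extendFun [Finite α] (φ : MulAut (FreeGroup α)) :
    ∃ B : ℕ → ℕ, ∀ i n, B i ≤ n → ∀ x : Compactification α,
      (extendFun φ x).letter i = (ofGroup (φ (x.take n))).letter i := by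
  obtain ⟨B, hB⟩ := exists_stable φ
  refine ⟨B, fun i n hn x => ?_⟩
  cases x with
  | ofGroup g =>
    rw [((hB i n hn).1 _), ← (hB i (max (B i) g.norm) (le_max_left _ _)).1,
      take_ofGroup_of_le (le_max_right _ _)]
    rfl
  | ofBoundary X =>
    have h := tendsto_iff_letter.1 (Classical.choose_spec (exists_boundaryMap φ X)) i
    obtain ⟨m, hm, hm'⟩ := (h.and (eventually_ge_atTop (B i))).exists
    rw [((hB i n hn).1 _), ← (hB i m hm').1]
    exact hm.symm

theorem continuous_extendFun [Finite α] (φ : MulAut (FreeGroup α)) :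
    Continuous (extendFun φ) := by
  obtain ⟨B, hB⟩ := exists_letter_extendFun φ
  rw [continuous_iff_continuousAt]
  intro x
  refine tendsto_iff_letter.2 fun i => ?_
  have h1 := tendsto_iff_letter.1 (tendsto_id (x := 𝓝 x))
  have h2 : ∀ᶠ y in 𝓝 x, ∀ j < B i, y.letter j = x.letter j := by
    have := (eventually_all_finite (Set.finite_lt_nat (B i))).2 fun j _ => h1 j
    simpa using this
  filter_upwards [h2] with y hy
  rw [hB i _ le_rfl, hB i _ le_rfl, take_congr hy]

theorem extendFun_mul [Finite α] (φ ψ : MulAut (FreeGroup α)) (x : Compactification α) :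
    extendFun (φ * ψ) x = extendFun φ (extendFun ψ x) := by
  obtain ⟨B, hB⟩ := exists_letter_extendFun φ
  obtain ⟨C, hC⟩ := exists_letter_extendFun ψ
  obtain ⟨D, hD⟩ := exists_letter_extendFun (φ * ψ)
  refine compactification_ext fun i => ?_
  have hm : ∃ m, D i ≤ m ∧ ∀ j < B i, C j ≤ m := by
    refine ⟨max (D i) ((Finset.range (B i)).sup C), le_max_left _ _, fun j hj => ?_⟩
    exact le_max_of_le_right (Finset.le_sup (Finset.mem_range.2 hj))
  obtain ⟨m, hm1, hm2⟩ := hm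
  rw [hD i m hm1, hB i _ le_rfl,
    take_congr (y := ofGroup (ψ (x.take m))) fun j hj => hC j m (hm2 j hj) x,
    ← hB i _ le_rfl]
  rfl

theorem extendFun_one [Finite α] (x : Compactification α) :
    extendFun (1 : MulAut (FreeGroup α)) x = x := by
  obtain ⟨B, hB⟩ := exists_letter_extendFun (1 : MulAut (FreeGroup α))
  refine compactification_ext fun i => ?_
  rw [hB i (max (B i) (i + 1)) (le_max_left _ _)]
  exact letter_take_of_lt (by omega)

/-- The homeomorphism of the compactification induced by an automorphism `φ`; it is `φ` on the
group and `∂φ` on the boundary, and it depends functorially on `φ`. -/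
noncomputable def extend [Finite α] :
    MulAut (FreeGroup α) →* (Compactification α ≃ₜ Compactification α) where
  toFun φ :=
    { toFun := extendFun φ
      invFun := extendFun φ⁻¹
      left_inv := fun x => by rw [← extendFun_mul, inv_mul_cancel, extendFun_one]
      right_inv := fun x => by rw [← extendFun_mul, mul_inv_cancel, extendFun_one]
      continuous_toFun := continuous_extendFun φ
      continuous_invFun := continuous_extendFun φ⁻¹ }
  map_one' := Homeomorph.ext extendFun_one
  map_mul' φ ψ := Homeomorph.ext (extendFun_mul φ ψ)

/-! ## Parabolic orbits, limit points, isoglossy, the dynamics graph -/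

/-- `ω_φ(x) = y`: the forward orbit of `x` under the extension of `φ` converges to `y`. -/
def IsOmega [Finite α] (φ : MulAut (FreeGroup α)) (x y : Compactification α) : Prop :=
  Tendsto (fun n : ℕ => (extend φ)^[n] x) atTop (𝓝 y)

/-- The two-sided orbit of `x` under the extension of `φ` converges to `y` as the exponent tends
to `+∞` and as it tends to `-∞`. -/
def ConvergesBothWays [Finite α] (φ : MulAut (FreeGroup α)) (x y : Compactification α) : Prop :=
  Tendsto (fun n : ℤ => (extend φ ^ n) x) atTop (𝓝 y) ∧
    Tendsto (fun n : ℤ => (extend φ ^ n) x) atBot (𝓝 y)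

/-- `X` is a parabolic fixed point of `φ`. -/
def IsParabolicFixedPoint [Finite α] (φ : MulAut (FreeGroup α)) (X : Boundary α) : Prop :=
  ∃ Y : Boundary α, X ≠ Y ∧ ConvergesBothWays φ (ofBoundary Y) (ofBoundary X)

/-- `φ` has a parabolic orbit in the boundary. -/
def HasParabolicOrbit [Finite α] (φ : MulAut (FreeGroup α)) : Prop :=
  ∃ X : Boundary α, IsParabolicFixedPoint φ X

/-- `φ` is rotationless: the periodic points of its extension are fixed points. -/
def IsRotationless [Finite α] (φ : MulAut (FreeGroup α)) : Prop :=
  Function.fixedPoints (extend φ) = Function.periodicPts (extend φ)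

/-- `X` is an `ω`-limit point of `φ`: it is `ω_φ(x)` for some `x` which is not itself fixed. -/
def IsOmegaLimitPoint [Finite α] (φ : MulAut (FreeGroup α)) (X : Boundary α) : Prop :=
  ∃ x : Compactification α, extend φ x ≠ x ∧ IsOmega φ x (ofBoundary X)

/-- `X` is a limit point of `φ`: an `ω`-limit point of `φ` or of its inverse. -/
def IsLimitPoint [Finite α] (φ : MulAut (FreeGroup α)) (X : Boundary α) : Prop :=
  IsOmegaLimitPoint φ X ∨ IsOmegaLimitPoint φ⁻¹ X

/-- `X = g Y` for the action of the group on its boundary by left translation: after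
multiplying a prefix of `Y` by `g` and reducing, `X` and `Y` continue with the same letters. -/
def IsTranslate (g : FreeGroup α) (Y X : Boundary α) : Prop :=
  ∃ m n : ℕ, (ofBoundary X).take n = g * (ofBoundary Y).take m ∧
    ∀ i, X.seq (n + i) = Y.seq (m + i)

theorem IsTranslate.shift {g : FreeGroup α} {X Y : Boundary α} {m n : ℕ}
    (h : (ofBoundary X).take n = g * (ofBoundary Y).take m)
    (h' : ∀ i, X.seq (n + i) = Y.seq (m + i)) (j : ℕ) :
    (ofBoundary X).take (n + j) = g * (ofBoundary Y).take (m + j) := by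
  induction j with
  | zero => exact h
  | succ j ih => rw [← add_assoc, ← add_assoc, take_succ, take_succ, ih, mul_assoc,
      letter_ofBoundary, letter_ofBoundary, h']

theorem IsTranslate.trans {g k : FreeGroup α} {X Y Z : Boundary α}
    (h1 : IsTranslate g Y X) (h2 : IsTranslate k Z Y) : IsTranslate (g * k) Z X := by
  obtain ⟨m, n, h, h'⟩ := h1
  obtain ⟨p, q, e, e'⟩ := h2
  refine ⟨p + m, n + q, ?_, fun i => ?_⟩
  · rw [IsTranslate.shift h h', mul_assoc, ← IsTranslate.shift e e', add_comm]
  · rw [add_assoc, h', add_assoc, ← e' (m + i)]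
    congr 1
    omega

/-- Isoglossy with respect to `φ`: `X = g Y` for some `g` fixed by `φ`. -/
def isoglossy [Finite α] (φ : MulAut (FreeGroup α)) : Setoid (Boundary α) where
  r X Y := ∃ g : FreeGroup α, φ g = g ∧ IsTranslate g Y X
  iseqv :=
    { refl := fun X => ⟨1, map_one φ, 0, 0, by simp, fun _ => rfl⟩
      symm := by
        rintro X Y ⟨g, hg, m, n, h, h'⟩
        exact ⟨g⁻¹, by rw [map_inv, hg], n, m, by rw [h, inv_mul_cancel_left],
          fun i => (h' i).symm⟩
      trans := by
        rintro X Y Z ⟨g, hg, h⟩ ⟨k, hk, h'⟩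
        exact ⟨g * k, by rw [map_mul, hg, hk], h.trans h'⟩ }

/-- The isoglossy class of a boundary point. -/
def isoglossyClass [Finite α] (φ : MulAut (FreeGroup α)) (X : Boundary α) :
    Quotient (isoglossy φ) :=
  Quotient.mk (isoglossy φ) X

/-- The vertices of the dynamics graph of `φ`: the isoglossy classes of limit points. -/
def DynamicsVertex [Finite α] (φ : MulAut (FreeGroup α)) : Type :=
  {q : Quotient (isoglossy φ) // ∃ X, IsLimitPoint φ X ∧ isoglossyClass φ X = q}

/-- The dynamics graph of `φ`: there is an oriented edge from `x₁` to `x₂` if some non-fixed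
boundary point `X` flows from a representative of `x₁` (under backward iteration) to a
representative of `x₂` (under forward iteration). -/
def dynamicsGraph [Finite α] (φ : MulAut (FreeGroup α)) : Digraph (DynamicsVertex φ) where
  Adj x₁ x₂ := ∃ X₁ X₂ X : Boundary α,
    isoglossyClass φ X₁ = x₁.1 ∧ isoglossyClass φ X₂ = x₂.1 ∧
      extend φ (ofBoundary X) ≠ ofBoundary X ∧
      IsOmega φ⁻¹ (ofBoundary X) (ofBoundary X₁) ∧ IsOmega φ (ofBoundary X) (ofBoundary X₂)

end Basic

/-! ## The automorphisms `φ_k` of the free group of rank four -/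

/-- The free group on `a, b, c, d`. -/
abbrev F4 : Type := FreeGroup (Fin 4)

/-- the generator `a` -/
def a : F4 := FreeGroup.of 0
/-- the generator `b` -/
def b : F4 := FreeGroup.of 1
/-- the generator `c` -/
def c : F4 := FreeGroup.of 2
/-- the generator `d` -/
def d : F4 := FreeGroup.of 3

/-- `a ↦ a, b ↦ ba, c ↦ ca^{k+1}, d ↦ dc` -/
def phiHom (k : ℕ) : F4 →* F4 := FreeGroup.lift ![a, b * a, c * a ^ (k + 1), d * c]

/-- `a ↦ a, b ↦ ba⁻¹, c ↦ ca^{-(k+1)}, d ↦ da^{k+1}c⁻¹` -/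
def phiInvHom (k : ℕ) : F4 →* F4 :=
  FreeGroup.lift ![a, b * a⁻¹, c * (a ^ (k + 1))⁻¹, d * a ^ (k + 1) * c⁻¹]

/-- The automorphism `φ_k`, given by `a ↦ a, b ↦ ba, c ↦ ca^{k+1}, d ↦ dc`. -/
def phi (k : ℕ) : MulAut F4 :=
  MonoidHom.toMulEquiv (phiHom k) (phiInvHom k)
    (by
      ext i
      fin_cases i <;> simp [phiHom, phiInvHom, a, b, c, d, mul_assoc])
    (by
      ext i
      fin_cases i <;> simp [phiHom, phiInvHom, a, b, c, d, mul_assoc])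

/-- The infinite word `a^{+∞}` (`s = true`) or `a^{-∞}` (`s = false`). -/
def aInf (s : Bool) : Boundary (Fin 4) where
  seq _ := (0, s)
  reduced i := by simp

/-- The infinite word `ba^{+∞}` (`s = true`) or `ba^{-∞}` (`s = false`). -/
def baInf (s : Bool) : Boundary (Fin 4) where
  seq n := if n = 0 then (1, true) else (0, s)
  reduced i := by by_cases h : i = 0 <;> simp [h]

/-- The infinite word `ca^{+∞}` (`s = true`) or `ca^{-∞}` (`s = false`). -/
def caInf (s : Bool) : Boundary (Fin 4) where
  seq n := if n = 0 then (2, true) else (0, s)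
  reduced i := by by_cases h : i = 0 <;> simp [h]

/-- The infinite word `X_k^+ = d c c a^{k+1} c a^{2(k+1)} c a^{3(k+1)} ⋯`: the letter `c` stands
at the positions `1 + ∑_{i < j} (1 + i(k+1))`, `j = 0, 1, 2, …`. -/
def XPlus (k : ℕ) : Boundary (Fin 4) where
  seq n := if n = 0 then (3, true)
    else if ∃ j ∈ Finset.range n, n = 1 + ∑ i ∈ Finset.range j, (1 + i * (k + 1)) then (2, true)
    else (0, true)
  reduced i := by
    intro h
    have := congrArg Prod.snd h
    revert this
    dsimp only
    split_ifs <;> simp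

/-- The infinite word `X_k^- = d a^{k+1} c⁻¹ a^{2(k+1)} c⁻¹ a^{3(k+1)} c⁻¹ ⋯`: the letter `c⁻¹`
stands at the positions `∑_{i ≤ j} ((i+1)(k+1) + 1)`, `j = 0, 1, 2, …`. -/
def XMinus (k : ℕ) : Boundary (Fin 4) where
  seq n := if n = 0 then (3, true)
    else if ∃ j ∈ Finset.range n, n = ∑ i ∈ Finset.range (j + 1), ((i + 1) * (k + 1) + 1)
      then (2, false)
    else (0, true)
  reduced i := by
    intro h
    revert h
    split_ifs <;> simp

/-- The eight vertices of the figure. -/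
inductive FigureVertex where
  | bMinus | bPlus | xMinus | xPlus | aPlus | aMinus | cMinus | cPlus

/-- The boundary point by which a vertex of the figure is named: `ba^{-∞}`, `ba^{+∞}`, `X_k^-`,
`X_k^+`, `a^{+∞}`, `a^{-∞}`, `ca^{-∞}`, `ca^{+∞}`. -/
def FigureVertex.point (k : ℕ) : FigureVertex → Boundary (Fin 4)
  | bMinus => baInf false
  | bPlus => baInf true
  | xMinus => XMinus k
  | xPlus => XPlus k
  | aPlus => aInf true
  | aMinus => aInf false
  | cMinus => caInf false
  | cPlus => caInf true

/-- The seven labelled oriented edges of the figure: `FigureEdge v g w` is an edge from `v` to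
`w` with label `g`. -/
inductive FigureEdge : FigureVertex → F4 → FigureVertex → Prop where
  | loop : FigureEdge .bMinus (b * d⁻¹) .bMinus
  | bUp : FigureEdge .bMinus b .bPlus
  | bDown : FigureEdge .bPlus (b * c⁻¹) .bMinus
  | dEdge : FigureEdge .xMinus d .xPlus
  | aEdge : FigureEdge .aPlus b⁻¹ .aMinus
  | caEdge : FigureEdge .cMinus d⁻¹ .aMinus
  | cEdge : FigureEdge .cMinus c .cPlus

/-- The oriented graph of the figure, without its labels. -/
def figureGraph : Digraph FigureVertex where
  Adj v w := ∃ g, FigureEdge v g w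

end FreeGroupDynamics

open FreeGroupDynamics

/-!
The automorphism `φ_k` fixes `a` and multiplies `b`, `c`, `d` from the right by words in other
generators, so an orbit is understood by following its first letter different from `a^{±1}`.

*First letters.* Write `m = k + 1`. If a finite or infinite word `w` does not start with `a^{±1}`,
its image is `a^i v`, where `v` does not start with `a^{±1}` either, and the pair formed by the
exponent `i` and the first letter of `v` is given by an arrow of a small automaton, `HeadArrow`:
`b`, `c`, `d` reproduce themselves with `i = 0`, `b⁻¹` and `c⁻¹` reproduce themselves with `i = -1`
and `i = -m`, `d⁻¹` becomes `c⁻¹`, and a letter `c` may be cancelled, which leaves `d⁻¹`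
(`phi_headArrow`, by induction on the length for group elements and by continuity in general).
Reversing the arrows describes `φ_k⁻¹` (`phi_inv_headArrow`). Consequently the leading exponent of
`a` along an orbit is eventually affine in the number of iterations; its slope is called the drift
of the point (`HasDrift`, `exists_hasDrift`).

*Limits.* Since `φ_k^n(t) = t a^{ln}` for `t = 1, b, c` and `l = 0, 1, m`, the orbit of `t x`
converges to `t a^{±∞}`, with the sign of `l + κ`, when `x` has drift `κ` and `l + κ ≠ 0`
(`HasDrift.isOmega`). The drifts are `0`, `-1`, `-m` forwards and `0`, `1`, `m` backwards. On the
words starting with `d` the dynamics is of north-south type, from `X_k^-` to `X_k^+`: one iteration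
produces the prefix `dc` unless the word starts with `d a^m c⁻¹`, and only `X_k^-` does so at every
time (`isOmega_XPlus`, `isOmega_XMinus`). The parabolic orbit is that of `b d⁻¹`, as
`d⁻¹` has drift `-m < -1` forwards and `0 < 1` backwards.

*The dynamics graph.* The cases `l + κ = 0` arise from words such as `b a^j b⁻¹ ⋯`, which have a
non-trivial prefix fixed by `φ_k`. Splitting off a maximal fixed prefix changes the limits only
within their isoglossy class, and the first letter of the rest, with the drifts of what follows,
decides on which of the seven edges a non-fixed point lies (`exists_edge`). Rotationlessness
follows: a periodic point which is not fixed would converge to a fixed point. Conversely each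
label, prolonged by `b^∞` or `d^∞`, flows along its edge (`isOmega_of_figureEdge`). The eight
classes are distinct (`point_injective`): the letters occurring infinitely often single out `X_k^±`
and determine the sign of `a^{±∞}` in the six other points `t a^{±∞}`, and an element fixed by
`φ_k` cannot carry `t' a^{±∞}` to `t a^{±∞}` when the exponents `l` differ
(`twist_eq_of_isogloss`).

*Conjugacy.* On the abelianization, `φ_k^p` acts by a unipotent matrix with entries `p`, `mp`, `p`
(`abMatrix_phi_pow`). If an integral matrix conjugates the matrix of `φ_k^p` to that of
`φ_{k'}^{p'}`, enough of its entries vanish to make its first and last diagonal entries `±1`, and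
comparing entries yields `p' ∣ p` and `(k + 1) p² = (k' + 1) p'²` (`conj_entries`).
-/

namespace FreeGroupDynamics
open Compactification

/-! ### Left translation on the compactification -/

theorem mk_singleton_inv {α : Type} (s : α × Bool) :
    (FreeGroup.mk [s])⁻¹ = FreeGroup.mk [(s.1, !s.2)] := by
  rw [FreeGroup.inv_mk]; rfl

section Translation
variable {α : Type} [DecidableEq α]

/-- Limits in the compactification are unique, as each letter of the limit is determined. -/
theorem tendsto_unique {β : Type} {f : β → Compactification α} {l : Filter β} [l.NeBot]
    {x y : Compactification α} (hx : Tendsto f l (𝓝 x)) (hy : Tendsto f l (𝓝 y)) : x = y := by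
  refine compactification_ext fun i => ?_
  obtain ⟨n, h1, h2⟩ := ((tendsto_iff_letter.1 hx i).and (tendsto_iff_letter.1 hy i)).exists
  rw [← h1, h2]

theorem tendsto_take (x : Compactification α) :
    Tendsto (fun n => ofGroup (x.take n)) atTop (𝓝 x) := by
  refine tendsto_iff_letter.2 fun i => ?_
  filter_upwards [eventually_gt_atTop i] with n hn
  exact letter_take_of_lt hn

theorem exists_isTranslate_singleton (s : α × Bool) (Y : Boundary α) :
    ∃ X, IsTranslate (FreeGroup.mk [s]) Y X := by
  by_cases h : Y.seq 0 = (s.1, !s.2)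
  · refine ⟨⟨fun i => Y.seq (i + 1), fun i => Y.reduced (i + 1)⟩, 1, 0, ?_, fun i => ?_⟩
    · rw [take_succ, letter_ofBoundary, h, Option.toList_some, ← mk_singleton_inv]
      simp only [Compactification.take, List.range_zero, List.filterMap_nil,
        FreeGroup.one_eq_mk.symm, one_mul, mul_inv_cancel]
    · simp only; congr 1; omega
  · refine ⟨⟨fun i => Nat.casesOn i s Y.seq, fun i => ?_⟩, 0, 1, ?_, fun i => ?_⟩
    · cases i with
      | zero => exact h
      | succ i => exact Y.reduced i
    · rw [take_succ, letter_ofBoundary]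
      simp [Compactification.take, FreeGroup.one_eq_mk.symm]
    · simp only [Nat.zero_add, Nat.add_comm 1 i]

theorem IsTranslate.refl (Y : Boundary α) : IsTranslate 1 Y Y :=
  ⟨0, 0, by simp, fun _ => rfl⟩

/-- The action of the free group on its boundary by left translation is everywhere defined. -/
theorem exists_isTranslate (g : FreeGroup α) (Y : Boundary α) : ∃ X, IsTranslate g Y X := by
  have key : ∀ l : List (α × Bool), ∃ X, IsTranslate (FreeGroup.mk l) Y X := by
    intro l
    induction l with
    | nil => exact ⟨Y, IsTranslate.refl Y⟩
    | cons s l ih =>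
      obtain ⟨Z, hZ⟩ := ih
      obtain ⟨X, hX⟩ := exists_isTranslate_singleton s Z
      refine ⟨X, ?_⟩
      have := hX.trans hZ
      rwa [FreeGroup.mul_mk] at this
  have := key g.toWord
  rwa [FreeGroup.mk_toWord] at this

theorem IsTranslate.tendsto {g : FreeGroup α} {X Y : Boundary α} (h : IsTranslate g Y X) :
    Tendsto (fun n => ofGroup (g * (ofBoundary Y).take n)) atTop (𝓝 (ofBoundary X)) := by
  obtain ⟨m, n, h, h'⟩ := h
  refine tendsto_iff_letter.2 fun i => ?_
  filter_upwards [eventually_gt_atTop (m + i)] with N hN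
  obtain ⟨j, rfl⟩ := Nat.exists_eq_add_of_le (show m ≤ N by omega)
  rw [← IsTranslate.shift h h']
  exact letter_take_of_lt (by omega)

theorem IsTranslate.unique {g : FreeGroup α} {X X' Y : Boundary α} (h : IsTranslate g Y X)
    (h' : IsTranslate g Y X') : X = X' := by
  have := tendsto_unique h.tendsto h'.tendsto
  rwa [ofBoundary.injEq] at this

/-- Left translation on the compactification: multiplication on the group, and on the boundary the
relation `IsTranslate`, which is a function of the point. -/
noncomputable instance : SMul (FreeGroup α) (Compactification α) where
  smul g x := match x with
    | ofGroup h => ofGroup (g * h)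
    | ofBoundary Y => ofBoundary (Classical.choose (exists_isTranslate g Y))

@[simp] theorem smul_ofGroup (g h : FreeGroup α) : g • ofGroup h = ofGroup (g * h) := rfl

theorem IsTranslate.smul_eq {g : FreeGroup α} {X Y : Boundary α} (h : IsTranslate g Y X) :
    g • ofBoundary Y = ofBoundary X := by
  show ofBoundary (Classical.choose (exists_isTranslate g Y)) = _
  rw [(Classical.choose_spec (exists_isTranslate g Y)).unique h]

theorem isTranslate_iff_smul {g : FreeGroup α} {X Y : Boundary α} :
    IsTranslate g Y X ↔ g • ofBoundary Y = ofBoundary X := by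
  refine ⟨IsTranslate.smul_eq, fun h => ?_⟩
  obtain ⟨Z, hZ⟩ := exists_isTranslate g Y
  rw [hZ.smul_eq, ofBoundary.injEq] at h
  exact h ▸ hZ

noncomputable instance : MulAction (FreeGroup α) (Compactification α) where
  one_smul x := by
    cases x with
    | ofGroup g => simp
    | ofBoundary X => exact (IsTranslate.refl X).smul_eq
  mul_smul g h x := by
    cases x with
    | ofGroup k => simp [mul_assoc]
    | ofBoundary X =>
      obtain ⟨Y, hY⟩ := exists_isTranslate h X
      obtain ⟨Z, hZ⟩ := exists_isTranslate g Y
      rw [hY.smul_eq, hZ.smul_eq, (hZ.trans hY).smul_eq]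

theorem smul_ofBoundary_exists (g : FreeGroup α) (Y : Boundary α) :
    ∃ X, g • ofBoundary Y = ofBoundary X ∧ IsTranslate g Y X := by
  obtain ⟨X, hX⟩ := exists_isTranslate g Y
  exact ⟨X, hX.smul_eq, hX⟩

/-- Left translation is the limit of the translates of the prefixes. -/
theorem tendsto_mul_take (g : FreeGroup α) (x : Compactification α) :
    Tendsto (fun n => ofGroup (g * x.take n)) atTop (𝓝 (g • x)) := by
  cases x with
  | ofGroup h =>
    refine tendsto_const_nhds.congr' ?_
    filter_upwards [eventually_ge_atTop h.norm] with n hn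
    rw [take_ofGroup_of_le hn]
    rfl
  | ofBoundary X =>
    obtain ⟨Y, hY, hY'⟩ := smul_ofBoundary_exists g X
    rw [hY]
    exact hY'.tendsto

theorem norm_take_of_letter_ne_none {x : Compactification α} {n : ℕ} (h : x.letter n ≠ none) :
    (x.take n).norm = n := by
  cases x with
  | ofBoundary X => exact norm_take_ofBoundary X n
  | ofGroup g =>
    rw [ne_eq, letter_eq_none] at h
    rw [FreeGroup.norm, toWord_take_ofGroup, List.length_take]
    exact min_eq_left (by rw [FreeGroup.norm] at h; omega)

/-- The `i`-th letter of a translate depends only on a prefix of bounded length. -/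
theorem letter_smul (g : FreeGroup α) (x : Compactification α) {i n : ℕ}
    (hn : i + g.norm + 2 ≤ n) : (g • x).letter i = (ofGroup (g * x.take n)).letter i := by
  have key : ∀ j, (ofGroup (g * x.take (n + j))).letter i = (ofGroup (g * x.take n)).letter i := by
    intro j
    induction j with
    | zero => rfl
    | succ j ih =>
      rw [← ih, ← add_assoc, take_succ]
      cases h : x.letter (n + j) with
      | none =>
        rw [Option.toList_none, ← FreeGroup.one_eq_mk, mul_one]
      | some s =>
        rw [Option.toList_some, ← mul_assoc]
        apply (letter_mul_single _ s).1
        have h1 := norm_take_of_letter_ne_none (x := x) (n := n + j) (by simp [h])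
        have h2 := FreeGroup.norm_mul_le g⁻¹ (g * x.take (n + j))
        rw [inv_mul_cancel_left, FreeGroup.norm_inv_eq] at h2
        omega
  obtain ⟨N, h1, h2⟩ := ((tendsto_iff_letter.1 (tendsto_mul_take g x) i).and
    (eventually_ge_atTop n)).exists
  obtain ⟨j, rfl⟩ := Nat.exists_eq_add_of_le h2
  rw [← h1, key]

theorem continuous_smul_left (g : FreeGroup α) :
    Continuous (fun x : Compactification α => g • x) := by
  rw [continuous_iff_continuousAt]
  intro x
  refine tendsto_iff_letter.2 fun i => ?_
  have h1 := tendsto_iff_letter.1 (tendsto_id (x := 𝓝 x))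
  have h2 : ∀ᶠ y in 𝓝 x, ∀ j < i + g.norm + 2, y.letter j = x.letter j := by
    have := (eventually_all_finite (Set.finite_lt_nat (i + g.norm + 2))).2 fun j _ => h1 j
    simpa using this
  filter_upwards [h2] with y hy
  rw [letter_smul g y le_rfl, letter_smul g x le_rfl, take_congr hy]

@[simp] theorem extend_ofGroup [Finite α] (φ : MulAut (FreeGroup α)) (g : FreeGroup α) :
    extend φ (ofGroup g) = ofGroup (φ g) := rfl

/-- The extension of an automorphism is equivariant for left translations. -/
theorem extend_smul [Finite α] (φ : MulAut (FreeGroup α)) (g : FreeGroup α)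
    (x : Compactification α) : extend φ (g • x) = φ g • extend φ x := by
  have h1 := ((extend φ).continuous.tendsto _).comp (tendsto_mul_take g x)
  have h2 := ((continuous_smul_left (φ g)).tendsto _).comp
    (((extend φ).continuous.tendsto _).comp (tendsto_take x))
  refine tendsto_unique h1 (h2.congr fun n => ?_)
  simp

/-! ### First letters -/

theorem toWord_mk_singleton_mul {s : α × Bool} {g : FreeGroup α}
    (h : (ofGroup g).letter 0 ≠ some (s.1, !s.2)) :
    (FreeGroup.mk [s] * g).toWord = s :: g.toWord := by
  rw [← FreeGroup.mk_toWord (x := g), FreeGroup.mul_mk, FreeGroup.toWord_mk, FreeGroup.mk_toWord]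
  apply FreeGroup.IsReduced.reduce_eq
  rw [letter_ofGroup] at h
  have hr := FreeGroup.isReduced_toWord (x := g)
  cases hw : g.toWord with
  | nil => simp
  | cons t l =>
    rw [hw] at h hr
    rw [List.singleton_append, FreeGroup.isReduced_cons_cons]
    refine ⟨fun h1 => ?_, hr⟩
    by_contra h2
    apply h
    simp only [List.getElem?_cons_zero, Option.some.injEq]
    refine Prod.ext h1.symm ?_
    revert h2
    cases s.2 <;> cases t.2 <;> simp

/-- The case of `letter_singleton_smul` for group elements. -/
theorem letter_mul_singleton_of_ne {s : α × Bool} {g : FreeGroup α}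
    (h : (ofGroup g).letter 0 ≠ some (s.1, !s.2)) (i : ℕ) :
    (ofGroup (FreeGroup.mk [s] * g)).letter i = if i = 0 then some s else
      (ofGroup g).letter (i - 1) := by
  rw [letter_ofGroup, toWord_mk_singleton_mul h]
  cases i <;> simp

/-- Prepending a letter without cancellation. -/
theorem letter_singleton_smul {s : α × Bool} {x : Compactification α}
    (h : x.letter 0 ≠ some (s.1, !s.2)) (i : ℕ) :
    (FreeGroup.mk [s] • x).letter i = if i = 0 then some s else x.letter (i - 1) := by
  rw [letter_smul _ _ (n := i + (FreeGroup.mk [s]).norm + 2) le_rfl, letter_mul_singleton_of_ne]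
  · by_cases hi : i = 0
    · simp [hi]
    · rw [if_neg hi, if_neg hi]
      exact letter_take_of_lt (by omega)
  · rwa [letter_take_of_lt (by omega)]

theorem letter_zero_singleton_smul {s : α × Bool} {x : Compactification α}
    (h : x.letter 0 ≠ some (s.1, !s.2)) : (FreeGroup.mk [s] • x).letter 0 = some s := by
  rw [letter_singleton_smul h, if_pos rfl]

/-- Finite and infinite words are reduced. -/
theorem letter_succ_ne {x : Compactification α} {i : ℕ} {s : α × Bool} (h : x.letter i = some s) :
    x.letter (i + 1) ≠ some (s.1, !s.2) := by
  cases x with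
  | ofBoundary X =>
    rw [letter_ofBoundary, Option.some.injEq] at h
    rw [letter_ofBoundary, ne_eq, Option.some.injEq, ← h]
    exact X.reduced i
  | ofGroup g =>
    intro h2
    have hr := FreeGroup.isReduced_toWord (x := g)
    rw [FreeGroup.IsReduced, List.isChain_iff_getElem] at hr
    rw [letter_ofGroup, List.getElem?_eq_some_iff] at h h2
    obtain ⟨l1, h⟩ := h
    obtain ⟨l2, h2⟩ := h2
    have := hr i l2
    rw [h, h2] at this
    simp at this

/-- Removing the first letter. -/
theorem letter_inv_singleton_smul {s : α × Bool} {x : Compactification α}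
    (h : x.letter 0 = some s) (i : ℕ) :
    ((FreeGroup.mk [s])⁻¹ • x).letter i = x.letter (i + 1) := by
  have key : ∀ g : FreeGroup α, (ofGroup g).letter 0 = some s → ∀ i,
      (ofGroup ((FreeGroup.mk [s])⁻¹ * g)).letter i = (ofGroup g).letter (i + 1) := by
    intro g hg i
    cases hw : g.toWord with
    | nil => simp [hw] at hg
    | cons t l =>
      obtain rfl : t = s := by simpa [hw] using hg
      have hr : FreeGroup.IsReduced l :=
        (FreeGroup.isReduced_toWord (x := g)).infix
          (by rw [hw]; exact (List.suffix_cons t l).isInfix)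
      have : (FreeGroup.mk [t])⁻¹ * g = FreeGroup.mk l := by
        rw [inv_mul_eq_iff_eq_mul, FreeGroup.mul_mk, ← FreeGroup.mk_toWord (x := g), hw]
        rfl
      rw [this, letter_ofGroup, letter_ofGroup, hw, FreeGroup.toWord_mk, hr.reduce_eq]
      simp
  rw [letter_smul _ _ (n := i + ((FreeGroup.mk [s])⁻¹).norm + 2) le_rfl, key]
  · exact letter_take_of_lt (by
      have : ((FreeGroup.mk [s])⁻¹).norm = 1 := by
        rw [FreeGroup.norm_inv_eq, FreeGroup.norm, FreeGroup.toWord_mk]; rfl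
      omega)
  · rw [letter_take_of_lt (by omega), h]

theorem letter_zero_inv_singleton_smul_ne {s : α × Bool} {x : Compactification α}
    (h : x.letter 0 = some s) :
    ((FreeGroup.mk [s])⁻¹ • x).letter 0 ≠ some (s.1, !s.2) := by
  rw [letter_inv_singleton_smul h]
  exact letter_succ_ne h

/-- Removing the first `N` letters. -/
theorem letter_inv_take_smul {x : Compactification α} {N : ℕ} (h : ∀ i < N, x.letter i ≠ none)
    (i : ℕ) : ((x.take N)⁻¹ • x).letter i = x.letter (N + i) := by
  induction N generalizing i with
  | zero => simp [Compactification.take, ← FreeGroup.one_eq_mk]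
  | succ N ih =>
    have ih := ih fun i hi => h i (by omega)
    obtain ⟨s, hs⟩ := Option.ne_none_iff_exists'.1 (h N (Nat.lt_succ_self N))
    rw [take_succ, hs, Option.toList_some, mul_inv_rev, mul_smul, letter_inv_singleton_smul, ih]
    · congr 1; omega
    · rw [ih, add_zero, hs]

theorem take_add {x : Compactification α} {N : ℕ} (h : ∀ i < N, x.letter i ≠ none) (j : ℕ) :
    x.take (N + j) = x.take N * ((x.take N)⁻¹ • x).take j := by
  induction j with
  | zero => simp [Compactification.take, ← FreeGroup.one_eq_mk]
  | succ j ih => rw [← add_assoc, take_succ, ih, take_succ, letter_inv_take_smul h, mul_assoc]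

/-- If the concatenation of the list `L` and `x` is reduced, it is the translate of `x`. -/
theorem letter_mk_smul {L : List (α × Bool)} {x : Compactification α} (hL : FreeGroup.IsReduced L)
    (h : ∀ s, L.getLast? = some s → x.letter 0 ≠ some (s.1, !s.2)) (i : ℕ) :
    (FreeGroup.mk L • x).letter i = if i < L.length then L[i]? else x.letter (i - L.length) := by
  induction L generalizing i with
  | nil => simp [← FreeGroup.one_eq_mk]
  | cons t l ih =>
    have hl : FreeGroup.IsReduced l := hL.infix (List.suffix_cons t l).isInfix
    have ih := ih hl fun s hs => h s (by
      cases l with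
      | nil => simp at hs
      | cons u l => rwa [List.getLast?_cons_cons])
    rw [show FreeGroup.mk (t :: l) = FreeGroup.mk [t] * FreeGroup.mk l by
      rw [FreeGroup.mul_mk]; rfl, mul_smul, letter_singleton_smul]
    · cases i with
      | zero => simp
      | succ i => simp [ih]
    · rw [ih]
      cases l with
      | nil => simpa using h t
      | cons u l =>
        simp only [List.length_cons, Nat.zero_lt_succ, if_true, List.getElem?_cons_zero, ne_eq,
          Option.some.injEq]
        rw [FreeGroup.isReduced_cons_cons] at hL
        rintro rfl
        simpa using hL.1

/-- If no letter of `u` is cancelled in `u x`, then `u` is a prefix of `u x`. -/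
theorem letter_smul_of_lt {u : FreeGroup α} {x : Compactification α} {s : α × Bool}
    (hu : (ofGroup u⁻¹).letter 0 = some s) (h : x.letter 0 ≠ some s) {i : ℕ} (hi : i < u.norm) :
    (u • x).letter i = (ofGroup u).letter i := by
  have := letter_mk_smul (L := u.toWord) (x := x) FreeGroup.isReduced_toWord (fun t ht => by
    rw [letter_ofGroup, FreeGroup.toWord_inv, FreeGroup.invRev, ← List.head?_eq_getElem?,
      List.head?_reverse, List.getLast?_map, ht] at hu
    simp only [Option.map_some, Option.some.injEq] at hu
    rwa [hu]) i
  rw [FreeGroup.mk_toWord] at this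
  rw [this, if_pos (show i < u.toWord.length from hi)]
  rfl

theorem letter_pow_smul {s : α × Bool} {x : Compactification α}
    (h : x.letter 0 ≠ some (s.1, !s.2)) (n : ℕ) {i : ℕ} (hi : i < n) :
    ((FreeGroup.mk [s]) ^ n • x).letter i = some s := by
  induction n generalizing i with
  | zero => omega
  | succ n ih =>
    rw [pow_succ', mul_smul, letter_singleton_smul]
    · cases i with
      | zero => simp
      | succ i => simpa using ih (i := i) (by omega)
    · rcases Nat.eq_zero_or_pos n with rfl | hn
      · simpa using h
      · rw [ih hn]
        intro h2
        rw [Option.some.injEq] at h2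
        have := congrArg Prod.snd h2
        simp at this

end Translation

/-! ### Leading powers of `a` -/

/-- The first letter of `x` is not `a^{±1}`. -/
def NonA (x : Compactification (Fin 4)) : Prop := ∀ s, x.letter 0 ≠ some (0, s)

theorem letter_zero_of_smul {i : Fin 4} {x : Compactification (Fin 4)}
    (h : x.letter 0 ≠ some (i, false)) : (FreeGroup.of i • x).letter 0 = some (i, true) :=
  letter_zero_singleton_smul (s := (i, true)) h

theorem letter_zero_of_inv_smul {i : Fin 4} {x : Compactification (Fin 4)}
    (h : x.letter 0 ≠ some (i, true)) : ((FreeGroup.of i)⁻¹ • x).letter 0 = some (i, false) := by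
  have := letter_zero_singleton_smul (s := (i, false)) (x := x) (by simpa using h)
  rwa [show FreeGroup.mk [(i, false)] = (FreeGroup.of i)⁻¹ from (mk_singleton_inv (i, true)).symm]
    at this

theorem letter_zero_b_inv_smul {x : Compactification (Fin 4)}
    (h : x.letter 0 ≠ some (1, true)) : (b⁻¹ • x).letter 0 = some (1, false) :=
  letter_zero_of_inv_smul h

theorem letter_zero_c_smul {x : Compactification (Fin 4)}
    (h : x.letter 0 ≠ some (2, false)) : (c • x).letter 0 = some (2, true) :=
  letter_zero_of_smul h

theorem letter_zero_c_inv_smul {x : Compactification (Fin 4)}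
    (h : x.letter 0 ≠ some (2, true)) : (c⁻¹ • x).letter 0 = some (2, false) :=
  letter_zero_of_inv_smul h

theorem letter_zero_d_smul {x : Compactification (Fin 4)}
    (h : x.letter 0 ≠ some (3, false)) : (d • x).letter 0 = some (3, true) :=
  letter_zero_of_smul h

theorem letter_zero_d_inv_smul {x : Compactification (Fin 4)}
    (h : x.letter 0 ≠ some (3, true)) : (d⁻¹ • x).letter 0 = some (3, false) :=
  letter_zero_of_inv_smul h

/-- If `v` does not start with `a^{±1}`, then `a^j` is a prefix of `a^j v`. -/
theorem letter_zpow_smul {v : Compactification (Fin 4)} (hv : NonA v) {j : ℤ} {i : ℕ}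
    (hi : i < j.natAbs) : (a ^ j • v).letter i = some (0, decide (0 < j)) := by
  rcases lt_or_ge 0 j with h | h
  · obtain ⟨n, rfl⟩ := Int.eq_ofNat_of_zero_le h.le
    rw [zpow_natCast]
    simp only [h, decide_true]
    exact letter_pow_smul (s := (0, true)) (hv _) n (by simpa using hi)
  · obtain ⟨n, hn⟩ := Int.eq_ofNat_of_zero_le (show 0 ≤ -j by omega)
    obtain rfl : j = -(n : ℤ) := by omega
    rw [zpow_neg, zpow_natCast, ← inv_pow]
    have : a⁻¹ = FreeGroup.mk [(0, false)] := mk_singleton_inv (0, true)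
    rw [this, letter_pow_smul (s := (0, false)) (hv _) n (by simpa using hi)]
    simp

theorem letter_zero_zpow_smul {v : Compactification (Fin 4)} (hv : NonA v) {j : ℤ} (hj : j ≠ 0) :
    (a ^ j • v).letter 0 = some (0, decide (0 < j)) :=
  letter_zpow_smul hv (by omega)

theorem letter_zero_zpow_smul_iff {v : Compactification (Fin 4)} (hv : NonA v) {j : ℤ}
    {s : Fin 4 × Bool} (hs : s.1 ≠ 0) :
    (a ^ j • v).letter 0 = some s ↔ j = 0 ∧ v.letter 0 = some s := by
  by_cases hj : j = 0
  · simp [hj]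
  · rw [letter_zero_zpow_smul hv hj]
    simp only [Option.some.injEq, hj, false_and, iff_false]
    rintro rfl
    exact hs rfl

theorem nonA_of_letter {x : Compactification (Fin 4)} {s : Fin 4 × Bool}
    (h : x.letter 0 = some s) (hs : s.1 ≠ 0) : NonA x := by
  intro t ht
  rw [h, Option.some.injEq] at ht
  exact hs (by rw [ht])

theorem nonA_of_none {x : Compactification (Fin 4)} (h : x.letter 0 = none) : NonA x := by
  intro t ht
  rw [h] at ht
  cases ht

theorem eq_one_of_letter_zero_eq_none {x : Compactification (Fin 4)} (h : x.letter 0 = none) :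
    x = ofGroup 1 := by
  cases x with
  | ofBoundary X => simp at h
  | ofGroup g =>
    rw [letter_eq_none, Nat.le_zero, FreeGroup.norm_eq_zero] at h
    rw [h]

theorem mk_zero_eq_zpow (s : Bool) : ∃ i : ℤ, FreeGroup.mk [((0 : Fin 4), s)] = a ^ i := by
  cases s with
  | true => exact ⟨1, by rw [zpow_one]; rfl⟩
  | false => exact ⟨-1, by rw [zpow_neg_one]; exact (mk_singleton_inv (0, true)).symm⟩

theorem exists_take_eq_zpow {x : Compactification (Fin 4)} {N : ℕ}
    (h : ∀ i < N, ∃ s, x.letter i = some (0, s)) : ∃ j : ℤ, x.take N = a ^ j := by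
  induction N with
  | zero => exact ⟨0, by simp [Compactification.take, ← FreeGroup.one_eq_mk]⟩
  | succ N ih =>
    obtain ⟨j, hj⟩ := ih fun i hi => h i (by omega)
    obtain ⟨s, hs⟩ := h N (Nat.lt_succ_self N)
    obtain ⟨i, hi⟩ := mk_zero_eq_zpow s
    exact ⟨j + i, by rw [take_succ, hs, Option.toList_some, hj, hi, zpow_add]⟩

/-- Every point is `a^{±∞}` or has a well-defined leading power of `a`, whose removal is a shift of
the letters. -/
theorem exists_eq_zpow_smul (x : Compactification (Fin 4)) :
    (∃ s, x = ofBoundary (aInf s)) ∨ ∃ (j : ℤ) (v : Compactification (Fin 4)),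
      x = a ^ j • v ∧ NonA v ∧ ∃ N, ∀ i, v.letter i = x.letter (N + i) := by
  classical
  by_cases h : ∃ N, ∀ s, x.letter N ≠ some (0, s)
  · right
    have hlt : ∀ i < Nat.find h, ∃ s, x.letter i = some (0, s) := by
      intro i hi
      have := Nat.find_min h hi
      push Not at this
      exact this
    obtain ⟨j, hj⟩ := exists_take_eq_zpow hlt
    have hl := letter_inv_take_smul (x := x) (N := Nat.find h) fun i hi => by
      obtain ⟨s, hs⟩ := hlt i hi
      simp [hs]
    rw [hj] at hl
    refine ⟨j, (a ^ j)⁻¹ • x, by simp, fun s => ?_, Nat.find h, hl⟩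
    rw [hl]
    exact Nat.find_spec h s
  · left
    push Not at h
    choose s hs using h
    have hconst : ∀ i, s i = s 0 := by
      intro i
      induction i with
      | zero => rfl
      | succ i ih =>
        have := letter_succ_ne (hs i)
        rw [hs (i + 1), ih] at this
        revert this
        cases s (i + 1) <;> cases s 0 <;> simp
    exact ⟨s 0, compactification_ext fun i => by rw [hs, hconst]; rfl⟩

/-! ### One step of the dynamics on first letters -/

@[simp] theorem phi_a (k : ℕ) : phi k a = a := by
  show phiHom k a = a
  simp [phiHom, a]

@[simp] theorem phi_b (k : ℕ) : phi k b = b * a := by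
  show phiHom k b = b * a
  simp [phiHom, b]

@[simp] theorem phi_c (k : ℕ) : phi k c = c * a ^ ((k : ℤ) + 1) := by
  show phiHom k c = _
  rw [show ((k : ℤ) + 1) = ((k + 1 : ℕ) : ℤ) by push_cast; rfl, zpow_natCast]
  simp [phiHom, c]

@[simp] theorem phi_d (k : ℕ) : phi k d = d * c := by
  show phiHom k d = d * c
  simp [phiHom, d]

/-- `HeadArrow m s i s'`, for `m = k + 1`: a point with first letter `s ≠ a^{±1}` can be sent by
`φ_k` to `a^i v`, where `v` has the first letter `s'`. The letter `none` stands for the empty word.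
The arrow `cCancel` occurs for instance for `c a^{-m} d⁻¹`, whose image is `d⁻¹`. -/
inductive HeadArrow (m : ℤ) : Option (Fin 4 × Bool) → ℤ → Option (Fin 4 × Bool) → Prop
  | nil : HeadArrow m none 0 none
  | b : HeadArrow m (some (1, true)) 0 (some (1, true))
  | bInv : HeadArrow m (some (1, false)) (-1) (some (1, false))
  | c : HeadArrow m (some (2, true)) 0 (some (2, true))
  | cCancel : HeadArrow m (some (2, true)) 0 (some (3, false))
  | cInv : HeadArrow m (some (2, false)) (-m) (some (2, false))
  | d : HeadArrow m (some (3, true)) 0 (some (3, true))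
  | dInv : HeadArrow m (some (3, false)) 0 (some (2, false))

theorem HeadArrow.nonA {m i : ℤ} {s : Option (Fin 4 × Bool)} {v : Compactification (Fin 4)}
    (h : HeadArrow m s i (v.letter 0)) : NonA v := by
  generalize hs : v.letter 0 = t at h
  cases h
  · exact nonA_of_none hs
  all_goals exact nonA_of_letter hs (by decide)

/-- The rule for first letters, for group elements, by induction on the length. The induction needs
two
more facts, about the cancellation with a letter `c` to the left: the image of a word starting with
`d⁻¹` starts with `c⁻¹ d⁻¹`, whereas for a word starting with `c⁻¹` the letter `d⁻¹` does not come
to the front when `c a^{k+1}` is multiplied from the left. -/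
theorem phi_headArrow_group (k : ℕ) (n : ℕ) : ∀ g : F4, g.norm ≤ n → NonA (ofGroup g) →
    (∃ (i : ℤ) (v : Compactification (Fin 4)), ofGroup (phi k g) = a ^ i • v ∧
      HeadArrow (k + 1) ((ofGroup g).letter 0) i (v.letter 0)) ∧
    ((ofGroup g).letter 0 = some (3, false) →
      (c • ofGroup (phi k g)).letter 0 = some (3, false)) ∧
    ((ofGroup g).letter 0 = some (2, false) →
      (c • a ^ ((k : ℤ) + 1) • ofGroup (phi k g)).letter 0 ≠ some (3, false)) := by
  induction n with
  | zero =>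
    intro g hg _
    have h1 : g = 1 := by rwa [Nat.le_zero, FreeGroup.norm_eq_zero] at hg
    subst h1
    exact ⟨⟨0, ofGroup 1, by simp, HeadArrow.nil⟩, by simp, by simp⟩
  | succ n ih =>
    intro g hg hA
    cases hs : (ofGroup g).letter 0 with
    | none =>
      have := eq_one_of_letter_zero_eq_none hs
      rw [ofGroup.injEq] at this
      subst this
      exact ⟨⟨0, ofGroup 1, by simp, HeadArrow.nil⟩, by simp, by simp⟩
    | some s =>
      -- write `g = s a^j g₂` and apply the induction hypothesis to `g₂`
      obtain ⟨g1, hg1⟩ : ∃ g1, g1 = (FreeGroup.mk [s])⁻¹ * g := ⟨_, rfl⟩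
      have hg1s : g = FreeGroup.mk [s] * g1 := by rw [hg1, mul_inv_cancel_left]
      have hl1 : ∀ i, (ofGroup g1).letter i = (ofGroup g).letter (i + 1) := by
        rw [hg1]; exact letter_inv_singleton_smul hs
      have hne : (ofGroup g1).letter 0 ≠ some (s.1, !s.2) := by
        rw [hl1]; exact letter_succ_ne hs
      obtain ⟨j, g2, hg2, hA2, N, hN⟩ : ∃ (j : ℤ) (g2 : F4), g1 = a ^ j * g2 ∧
          NonA (ofGroup g2) ∧ ∃ N, ∀ i, (ofGroup g2).letter i = (ofGroup g1).letter (N + i) := by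
        rcases exists_eq_zpow_smul (ofGroup g1) with ⟨s, hs⟩ | ⟨j, v, h1, h2, h3⟩
        · cases hs
        · cases v with
          | ofGroup g2 => exact ⟨j, g2, by rwa [smul_ofGroup, ofGroup.injEq] at h1, h2, h3⟩
          | ofBoundary X =>
            obtain ⟨Y, hY, _⟩ := smul_ofBoundary_exists (a ^ j) X
            rw [hY] at h1
            cases h1
      have hn2 : g2.norm ≤ n := by
        rw [← letter_eq_none, hN, hl1, letter_eq_none]
        omega
      obtain ⟨⟨i, v, hv, harr⟩, hd, hc⟩ := ih g2 hn2 hA2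
      have hvA := harr.nonA
      have hφ : ofGroup (phi k g) = phi k (FreeGroup.mk [s]) • a ^ (j + i) • v := by
        rw [hg1s, hg2, map_mul, map_mul, map_zpow, phi_a, zpow_add, mul_smul, ← hv]
        rfl
      have hg1A : ∀ t : Fin 4 × Bool, t.1 ≠ 0 → ((ofGroup g1).letter 0 = some t ↔
          j = 0 ∧ (ofGroup g2).letter 0 = some t) := by
        intro t ht
        rw [hg2]
        exact letter_zero_zpow_smul_iff hA2 ht
      have hvl : ∀ (q : ℤ) (t : Fin 4 × Bool), t.1 ≠ 0 → ((a ^ q • v).letter 0 = some t ↔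
          q = 0 ∧ v.letter 0 = some t) := fun q t ht => letter_zero_zpow_smul_iff hvA ht
      obtain ⟨x, e⟩ := s
      have hx : x ≠ 0 := fun h => hA e (by rw [hs, h])
      replace hne : ¬(j = 0 ∧ (ofGroup g2).letter 0 = some (x, !e)) := fun h =>
        hne ((hg1A (x, !e) hx).2 h)
      have hform : phi k (FreeGroup.mk [(x, e)]) =
          if e then phi k (FreeGroup.of x) else (phi k (FreeGroup.of x))⁻¹ := by
        cases e with
        | true => rfl
        | false => rw [if_neg (by simp), ← map_inv]; congr 1
      rw [hform] at hφ
      have hx' : x = 1 ∨ x = 2 ∨ x = 3 := by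
        clear * - hx; revert x; decide
      clear hform hA hg hs hl1 hN
      rcases hx' with rfl | rfl | rfl <;> cases e
      · -- `b⁻¹`
        have hφ : ofGroup (phi k g) = a ^ (-1 : ℤ) • (b⁻¹ • (a ^ (j + i) • v)) := by
          rw [hφ, if_neg (by simp), show FreeGroup.of (1 : Fin 4) = b from rfl, phi_b,
            mul_inv_rev, mul_smul, zpow_neg_one]
        have h1 : (b⁻¹ • (a ^ (j + i) • v)).letter 0 = some (1, false) := by
          apply letter_zero_of_inv_smul
          rw [ne_eq, hvl _ _ (by decide)]
          rintro ⟨h1, h2⟩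
          rw [h2] at harr
          generalize (ofGroup g2).letter 0 = t at *
          cases harr
          exact hne ⟨by omega, rfl⟩
        exact ⟨⟨_, _, hφ, by rw [h1]; exact HeadArrow.bInv⟩, by simp, by simp⟩
      · -- `b`
        have hφ : ofGroup (phi k g) = a ^ (0 : ℤ) • (b • (a ^ (1 + j + i) • v)) := by
          rw [hφ, if_pos rfl, show FreeGroup.of (1 : Fin 4) = b from rfl, phi_b,
            mul_smul, zpow_zero, one_smul, add_assoc, zpow_add a 1, zpow_one, mul_smul]
        have h1 : (b • (a ^ (1 + j + i) • v)).letter 0 = some (1, true) := by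
          apply letter_zero_of_smul
          rw [ne_eq, hvl _ _ (by decide)]
          rintro ⟨h1, h2⟩
          rw [h2] at harr
          generalize (ofGroup g2).letter 0 = t at *
          cases harr
          exact hne ⟨by omega, rfl⟩
        exact ⟨⟨_, _, hφ, by rw [h1]; exact HeadArrow.b⟩, by simp, by simp⟩
      · -- `c⁻¹`
        have hφ : ofGroup (phi k g) = a ^ (-((k : ℤ) + 1)) • (c⁻¹ • (a ^ (j + i) • v)) := by
          rw [hφ, if_neg (by simp), show FreeGroup.of (2 : Fin 4) = c from rfl, phi_c,
            mul_inv_rev, mul_smul, zpow_neg]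
        have h1 : (c⁻¹ • (a ^ (j + i) • v)).letter 0 = some (2, false) := by
          apply letter_zero_of_inv_smul
          rw [ne_eq, hvl _ _ (by decide)]
          rintro ⟨h1, h2⟩
          rw [h2] at harr
          generalize (ofGroup g2).letter 0 = t at *
          cases harr
          exact hne ⟨by omega, rfl⟩
        refine ⟨⟨_, _, hφ, by rw [h1]; exact HeadArrow.cInv⟩, by simp, fun _ => ?_⟩
        rw [hφ, zpow_neg, smul_inv_smul, smul_inv_smul, ne_eq, hvl _ _ (by decide)]
        rintro ⟨h1, h2⟩
        rw [h2] at harr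
        generalize (ofGroup g2).letter 0 = t at *
        cases harr
        exact hne ⟨by omega, rfl⟩
      · -- `c`
        have hφ : ofGroup (phi k g) = a ^ (0 : ℤ) • (c • (a ^ ((k : ℤ) + 1 + j + i) • v)) := by
          rw [hφ, if_pos rfl, show FreeGroup.of (2 : Fin 4) = c from rfl, phi_c,
            mul_smul, zpow_zero, one_smul, add_assoc _ j, zpow_add a ((k : ℤ) + 1), mul_smul]
        refine ⟨⟨_, _, hφ, ?_⟩, by simp, by simp⟩
        by_cases hcan : (k : ℤ) + 1 + j + i = 0 ∧ v.letter 0 = some (2, false)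
        · have h3 : (c • (a ^ ((k : ℤ) + 1 + j + i) • v)).letter 0 = some (3, false) := by
            obtain ⟨h1, h2⟩ := hcan
            rw [h1, zpow_zero, one_smul]
            rw [h2] at harr
            generalize ht : (ofGroup g2).letter 0 = t at *
            cases harr
            · exact absurd ⟨by omega, rfl⟩ hne
            · have := hd rfl
              rwa [hv, zpow_zero, one_smul] at this
          rw [h3]; exact HeadArrow.cCancel
        · rw [letter_zero_c_smul (by rwa [ne_eq, hvl _ _ (by decide)])]
          exact HeadArrow.c
      · -- `d⁻¹`
        have hφ : ofGroup (phi k g) = c⁻¹ • (d⁻¹ • (a ^ (j + i) • v)) := by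
          rw [hφ, if_neg (by simp), show FreeGroup.of (3 : Fin 4) = d from rfl, phi_d,
            mul_inv_rev, mul_smul]
        have h1 : (d⁻¹ • (a ^ (j + i) • v)).letter 0 = some (3, false) := by
          apply letter_zero_of_inv_smul
          rw [ne_eq, hvl _ _ (by decide)]
          rintro ⟨h1, h2⟩
          rw [h2] at harr
          generalize (ofGroup g2).letter 0 = t at *
          cases harr
          exact hne ⟨by omega, rfl⟩
        refine ⟨⟨0, ofGroup (phi k g), by simp, ?_⟩, fun _ => ?_, by simp⟩
        · rw [hφ, letter_zero_c_inv_smul (by rw [h1]; decide)]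
          exact HeadArrow.dInv
        · rw [hφ, smul_inv_smul, h1]
      · -- `d`
        have hφ : ofGroup (phi k g) = a ^ (0 : ℤ) • (d • (c • (a ^ (j + i) • v))) := by
          rw [hφ, if_pos rfl, show FreeGroup.of (3 : Fin 4) = d from rfl, phi_d,
            mul_smul, zpow_zero, one_smul]
        refine ⟨⟨_, _, hφ, ?_⟩, by simp, by simp⟩
        rw [letter_zero_d_smul]
        · exact HeadArrow.d
        · by_cases hcan : j + i = 0 ∧ v.letter 0 = some (2, false)
          · obtain ⟨h1, h2⟩ := hcan
            rw [h1, zpow_zero, one_smul]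
            rw [h2] at harr
            generalize ht : (ofGroup g2).letter 0 = t at *
            cases harr
            · have := hc rfl
              rwa [hv, smul_smul (a ^ _) (a ^ _), ← zpow_add, add_neg_cancel, zpow_zero,
                one_smul] at this
            · exact absurd ⟨by omega, rfl⟩ hne
          · rw [letter_zero_c_smul (by rwa [ne_eq, hvl _ _ (by decide)])]
            decide

/-- The first letter determines the exponent of the power of `a` which is split off. -/
theorem HeadArrow.shift_unique {m i i' : ℤ} {s t t' : Option (Fin 4 × Bool)}
    (h : HeadArrow m s i t) (h' : HeadArrow m s i' t') : i = i' := by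
  cases h <;> cases h' <;> rfl

/-- The rule for first letters, extended to infinite words by continuity. -/
theorem phi_headArrow (k : ℕ) {w : Compactification (Fin 4)} (hw : NonA w) :
    ∃ (i : ℤ) (v : Compactification (Fin 4)), extend (phi k) w = a ^ i • v ∧
      HeadArrow (k + 1) (w.letter 0) i (v.letter 0) := by
  have hl : ∀ n, (ofGroup (w.take (n + 1))).letter 0 = w.letter 0 :=
    fun n => letter_take_of_lt (Nat.succ_pos n)
  have hg : ∀ n, ∃ (i : ℤ) (v : Compactification (Fin 4)),
      ofGroup (phi k (w.take (n + 1))) = a ^ i • v ∧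
        HeadArrow (k + 1) (w.letter 0) i (v.letter 0) := by
    intro n
    have := (phi_headArrow_group k _ (w.take (n + 1)) le_rfl fun s => by rw [hl]; exact hw s).1
    rwa [hl] at this
  obtain ⟨i, v, hv, harr⟩ := hg 0
  have ht := (((continuous_smul_left (a ^ i)⁻¹).comp (extend (phi k)).continuous).tendsto w).comp
    ((tendsto_take w).comp (tendsto_add_atTop_nat 1))
  obtain ⟨n, hn⟩ := (tendsto_iff_letter.1 ht 0).exists
  obtain ⟨i', v', hv', harr'⟩ := hg n
  obtain rfl := harr.shift_unique harr'
  -- the exponent is the same for all prefixes, so that `a^{-i}` can be split off in the limit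
  refine ⟨i, (a ^ i)⁻¹ • extend (phi k) w, by rw [smul_inv_smul], ?_⟩
  have : (a ^ i)⁻¹ • ofGroup (phi k (w.take (n + 1))) = v' := by rw [hv', inv_smul_smul]
  simp only [Function.comp_apply, extend_ofGroup, this] at hn
  rwa [← hn]

/-! ### Points with a diverging leading power of `a` -/

theorem tendsto_zpow_smul {β : Type} {l : Filter β} {f : β → ℤ} {v : β → Compactification (Fin 4)}
    (hv : ∀ᶠ n in l, NonA (v n)) (hf : Tendsto f l atTop) :
    Tendsto (fun n => a ^ f n • v n) l (𝓝 (ofBoundary (aInf true))) := by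
  refine tendsto_iff_letter.2 fun i => ?_
  filter_upwards [hv, hf.eventually_ge_atTop (i + 1)] with n h1 h2
  rw [letter_zpow_smul h1 (by omega)]
  simp only [show 0 < f n by omega, decide_true]
  rfl

theorem tendsto_zpow_smul_atBot {β : Type} {l : Filter β} {f : β → ℤ}
    {v : β → Compactification (Fin 4)} (hv : ∀ᶠ n in l, NonA (v n)) (hf : Tendsto f l atBot) :
    Tendsto (fun n => a ^ f n • v n) l (𝓝 (ofBoundary (aInf false))) := by
  refine tendsto_iff_letter.2 fun i => ?_
  filter_upwards [hv, hf.eventually_le_atBot (-(i + 1))] with n h1 h2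
  rw [letter_zpow_smul h1 (by omega)]
  simp only [show ¬ 0 < f n by omega, decide_false]
  rfl

theorem nonA_one : NonA (ofGroup 1) := nonA_of_none rfl

theorem extend_aInf {φ : MulAut F4} (hφ : φ a = a) (s : Bool) :
    extend φ (ofBoundary (aInf s)) = ofBoundary (aInf s) := by
  have key : ∃ f : ℕ → ℤ,
      Tendsto (fun n => a ^ f n • ofGroup (1 : F4)) atTop (𝓝 (ofBoundary (aInf s))) := by
    cases s with
    | true => exact ⟨fun n => n, tendsto_zpow_smul (Eventually.of_forall fun _ => nonA_one)
        tendsto_natCast_atTop_atTop⟩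
    | false => exact ⟨fun n => -n, tendsto_zpow_smul_atBot (Eventually.of_forall fun _ => nonA_one)
        (tendsto_neg_atTop_atBot.comp tendsto_natCast_atTop_atTop)⟩
  obtain ⟨f, hf⟩ := key
  have h1 := ((extend φ).continuous.tendsto _).comp hf
  refine tendsto_unique h1 (hf.congr fun n => ?_)
  simp [hφ]

theorem zpow_smul_aInf (j : ℤ) (s : Bool) :
    a ^ j • ofBoundary (aInf s) = ofBoundary (aInf s) := by
  have h : a • ofBoundary (aInf s) = ofBoundary (aInf s) := by
    cases s with
    | true =>
      refine compactification_ext fun i => ?_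
      rw [show a = FreeGroup.mk [((0 : Fin 4), true)] from rfl,
        letter_singleton_smul (by simp [aInf])]
      split_ifs <;> rfl
    | false =>
      rw [eq_comm, ← inv_smul_eq_iff]
      refine compactification_ext fun i => ?_
      rw [show a⁻¹ = FreeGroup.mk [((0 : Fin 4), false)] from mk_singleton_inv (0, true),
        letter_singleton_smul (by simp [aInf])]
      split_ifs <;> rfl
  have h' : a ∈ MulAction.stabilizer F4 (ofBoundary (aInf s)) := h
  exact (MulAction.stabilizer F4 (ofBoundary (aInf s))).zpow_mem h' j

theorem phi_inv_apply_a (k : ℕ) : (phi k)⁻¹ a = a := by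
  rw [MulAut.inv_apply, MulEquiv.symm_apply_eq, phi_a]

theorem extend_inv_apply (φ : MulAut F4) (x : Compactification (Fin 4)) :
    extend φ (extend φ⁻¹ x) = x := by
  rw [map_inv]
  exact (extend φ).apply_symm_apply x

theorem inv_extend_apply (φ : MulAut F4) (x : Compactification (Fin 4)) :
    extend φ⁻¹ (extend φ x) = x := by
  rw [map_inv]
  exact (extend φ).symm_apply_apply x

/-- The rule for the first letters of the inverse: the arrows are reversed. -/
theorem phi_inv_headArrow (k : ℕ) {w : Compactification (Fin 4)} (hw : NonA w) :
    ∃ (i : ℤ) (v : Compactification (Fin 4)), extend (phi k)⁻¹ w = a ^ (-i) • v ∧ NonA v ∧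
      HeadArrow (k + 1) (v.letter 0) i (w.letter 0) := by
  rcases exists_eq_zpow_smul (extend (phi k)⁻¹ w) with ⟨s, hs⟩ | ⟨j, v, h1, h2, -⟩
  · have := congrArg (extend (phi k)) hs
    rw [extend_inv_apply, extend_aInf (phi_a k)] at this
    rw [this] at hw
    exact absurd rfl (hw s)
  · obtain ⟨i, u, hu, harr⟩ := phi_headArrow k h2
    have := congrArg (extend (phi k)) h1
    rw [extend_inv_apply, extend_smul, map_zpow, phi_a, hu, smul_smul, ← zpow_add] at this
    have hji : j + i = 0 := by
      by_contra hne
      apply hw (decide (0 < j + i))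
      rw [this, letter_zero_zpow_smul harr.nonA hne]
    rw [hji, zpow_zero, one_smul] at this
    refine ⟨i, v, ?_, h2, this ▸ harr⟩
    rw [h1]; congr 2; omega

/-! ### Iteration and drift -/

theorem extend_mul_apply (φ ψ : MulAut F4) (x : Compactification (Fin 4)) :
    extend (φ * ψ) x = extend φ (extend ψ x) := by
  rw [map_mul]; rfl

theorem extend_one_apply (x : Compactification (Fin 4)) : extend (1 : MulAut F4) x = x := by
  rw [map_one]; rfl

theorem iterate_extend (ψ : MulAut F4) (n : ℕ) (x : Compactification (Fin 4)) :
    (extend ψ)^[n] x = extend (ψ ^ n) x := by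
  induction n with
  | zero => rw [pow_zero, extend_one_apply]; rfl
  | succ n ih => rw [Function.iterate_succ_apply', ih, pow_succ', extend_mul_apply]

theorem isOmega_iff {ψ : MulAut F4} {x y : Compactification (Fin 4)} :
    IsOmega ψ x y ↔ Tendsto (fun n : ℕ => extend (ψ ^ n) x) atTop (𝓝 y) := by
  unfold IsOmega
  simp only [iterate_extend]

theorem isOmega_of_pow {ψ : MulAut F4} {x y : Compactification (Fin 4)} (r : ℕ)
    (h : IsOmega ψ (extend (ψ ^ r) x) y) : IsOmega ψ x y := by
  rw [isOmega_iff] at h ⊢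
  simp only [← extend_mul_apply, ← pow_add] at h
  exact (tendsto_add_atTop_iff_nat r).1 h

theorem pow_apply_eq_self {ψ : MulAut F4} {g : F4} (h : ψ g = g) (n : ℕ) : (ψ ^ n) g = g := by
  induction n with
  | zero => simp
  | succ n ih => rw [pow_succ, MulAut.mul_apply, h, ih]

theorem IsOmega.smul {ψ : MulAut F4} {x y : Compactification (Fin 4)} {g : F4} (hg : ψ g = g)
    (h : IsOmega ψ x y) : IsOmega ψ (g • x) (g • y) := by
  rw [isOmega_iff] at h ⊢
  refine (((continuous_smul_left g).tendsto _).comp h).congr fun n => ?_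
  rw [extend_smul, pow_apply_eq_self hg]
  rfl

theorem IsOmega.extend_eq {ψ : MulAut F4} {x y : Compactification (Fin 4)} (h : IsOmega ψ x y) :
    extend ψ y = y := by
  rw [isOmega_iff] at h
  have h1 := ((extend ψ).continuous.tendsto _).comp h
  have h2 := h.comp (tendsto_add_atTop_nat 1)
  refine tendsto_unique h1 (h2.congr fun n => ?_)
  simp only [Function.comp_apply, pow_succ', extend_mul_apply]

theorem pow_apply_mul_zpow {ψ : MulAut F4} (ha : ψ a = a) {t : F4} {l : ℤ}
    (ht : ψ t = t * a ^ l) (n : ℕ) : (ψ ^ n) t = t * a ^ (l * n) := by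
  induction n with
  | zero => simp
  | succ n ih =>
    rw [pow_succ', MulAut.mul_apply, ih, map_mul, map_zpow, ht, ha, mul_assoc, ← zpow_add]
    congr 2
    push_cast
    ring

/-- The leading power of `a` in `ψ^n(x)` is eventually `a^{κ n + j}` for some constant `j`. -/
def HasDrift (ψ : MulAut F4) (x : Compactification (Fin 4)) (κ : ℤ) : Prop :=
  ∃ j : ℤ, ∀ᶠ n : ℕ in atTop, ∃ v, NonA v ∧ extend (ψ ^ n) x = a ^ (κ * n + j) • v

theorem HasDrift.of_pow {ψ : MulAut F4} {x : Compactification (Fin 4)} {κ : ℤ} (r : ℕ)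
    (h : HasDrift ψ (extend (ψ ^ r) x) κ) : HasDrift ψ x κ := by
  obtain ⟨j, hj⟩ := h
  refine ⟨j - κ * r, ?_⟩
  obtain ⟨N, hN⟩ := eventually_atTop.1 hj
  refine eventually_atTop.2 ⟨N + r, fun n hn => ?_⟩
  obtain ⟨n, rfl⟩ : ∃ n', n = n' + r := ⟨n - r, by omega⟩
  obtain ⟨v, h1, h2⟩ := hN n (by omega)
  refine ⟨v, h1, ?_⟩
  rw [pow_add, extend_mul_apply, h2]
  congr 2
  push_cast
  ring

theorem HasDrift.zpow_smul {ψ : MulAut F4} (ha : ψ a = a) {x : Compactification (Fin 4)} {κ : ℤ}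
    (h : HasDrift ψ x κ) (i : ℤ) : HasDrift ψ (a ^ i • x) κ := by
  obtain ⟨j, hj⟩ := h
  refine ⟨j + i, ?_⟩
  filter_upwards [hj] with n ⟨v, h1, h2⟩
  refine ⟨v, h1, ?_⟩
  rw [extend_smul, map_zpow, pow_apply_eq_self ha, h2, smul_smul, ← zpow_add]
  congr 2
  ring

theorem tendsto_linear {κ : ℤ} (h : 0 < κ) (j : ℤ) :
    Tendsto (fun n : ℕ => κ * (n : ℤ) + j) atTop atTop :=
  tendsto_atTop_add_const_right _ _
    (tendsto_natCast_atTop_atTop.const_mul_atTop' h)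

/-- If `ψ^n(t) = t a^{ln}` and `x` has drift `κ`, the orbit of `t x` converges to `t a^{±∞}`
according to the sign of `κ + l`. -/
theorem HasDrift.isOmega {ψ : MulAut F4} (ha : ψ a = a) {t : F4} {l : ℤ} (ht : ψ t = t * a ^ l)
    {x : Compactification (Fin 4)} {κ : ℤ} (h : HasDrift ψ x κ) (hne : κ + l ≠ 0) :
    IsOmega ψ (t • x) (t • ofBoundary (aInf (decide (0 < κ + l)))) := by
  classical
  obtain ⟨j, hj⟩ := h
  rw [isOmega_iff]
  have hv : ∃ v : ℕ → Compactification (Fin 4), ∀ᶠ n : ℕ in atTop,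
      NonA (v n) ∧ extend (ψ ^ n) x = a ^ (κ * n + j) • v n := by
    refine ⟨fun n => if h : ∃ v, NonA v ∧ extend (ψ ^ n) x = a ^ (κ * n + j) • v
      then Classical.choose h else ofGroup 1, ?_⟩
    filter_upwards [hj] with n hn
    rw [dif_pos hn]
    exact Classical.choose_spec hn
  obtain ⟨v, hv⟩ := hv
  have hA : ∀ᶠ n : ℕ in atTop, NonA (v n) := hv.mono fun n hn => hn.1
  have key : Tendsto (fun n : ℕ => a ^ ((κ + l) * (n : ℤ) + j) • v n) atTop
      (𝓝 (ofBoundary (aInf (decide (0 < κ + l))))) := by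
    rcases lt_or_gt_of_ne hne with h | h
    · rw [decide_eq_false (by omega)]
      refine tendsto_zpow_smul_atBot hA ?_
      have := tendsto_neg_atTop_atBot.comp (tendsto_linear (κ := -(κ + l)) (by omega) (-j))
      refine this.congr fun n => ?_
      simp only [Function.comp_apply]
      ring
    · rw [decide_eq_true h]
      exact tendsto_zpow_smul hA (tendsto_linear h j)
  refine (((continuous_smul_left t).tendsto _).comp key).congr' ?_
  filter_upwards [hv] with n hn
  rw [extend_smul, pow_apply_mul_zpow ha ht, hn.2, smul_smul, mul_assoc, ← zpow_add]
  show t • _ = _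
  rw [smul_smul]
  congr 3
  ring

theorem HasDrift.isOmega_aInf {ψ : MulAut F4} (ha : ψ a = a)
    {x : Compactification (Fin 4)} {κ : ℤ} (h : HasDrift ψ x κ) (hne : κ ≠ 0) :
    IsOmega ψ x (ofBoundary (aInf (decide (0 < κ)))) := by
  have := h.isOmega ha (t := 1) (l := 0) (by simp) (by simpa using hne)
  simpa using this

/-- A first letter which reappears, after a fixed power of `a`, does so along the whole orbit. -/
theorem orbit_of_invariant_letter {ψ : MulAut F4} (ha : ψ a = a) {s : Option (Fin 4 × Bool)}
    {i : ℤ}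
    (hs : ∀ w : Compactification (Fin 4), w.letter 0 = s →
      ∃ v : Compactification (Fin 4), extend ψ w = a ^ i • v ∧ v.letter 0 = s)
    {w : Compactification (Fin 4)} (hw : w.letter 0 = s) (n : ℕ) :
    ∃ v : Compactification (Fin 4), extend (ψ ^ n) w = a ^ (i * n) • v ∧ v.letter 0 = s := by
  induction n with
  | zero => exact ⟨w, by simp, hw⟩
  | succ n ih =>
    obtain ⟨v, h1, h2⟩ := ih
    obtain ⟨u, h3, h4⟩ := hs v h2
    refine ⟨u, ?_, h4⟩
    rw [pow_succ', extend_mul_apply, h1, extend_smul, map_zpow, ha, h3, smul_smul, ← zpow_add]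
    congr 2
    push_cast
    ring

theorem hasDrift_of_orbit {ψ : MulAut F4} {s : Option (Fin 4 × Bool)} (hsA : ∀ e, s ≠ some (0, e))
    {i : ℤ} {w : Compactification (Fin 4)}
    (h : ∀ n : ℕ, ∃ v : Compactification (Fin 4),
      extend (ψ ^ n) w = a ^ (i * n) • v ∧ v.letter 0 = s) : HasDrift ψ w i := by
  refine ⟨0, Eventually.of_forall fun n => ?_⟩
  obtain ⟨v, h1, h2⟩ := h n
  exact ⟨v, fun e he => hsA e (by rw [← h2, he]), by rw [h1, add_zero]⟩

/-! ### Drift of the points for the automorphisms `φ_k` -/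

section Drift
variable (k : ℕ) {w : Compactification (Fin 4)}

theorem phi_step {s : Option (Fin 4 × Bool)} (hsA : ∀ e, s ≠ some (0, e)) (hw : w.letter 0 = s) :
    ∃ (i : ℤ) (v : Compactification (Fin 4)), extend (phi k) w = a ^ i • v ∧
      HeadArrow (k + 1) s i (v.letter 0) := by
  have := phi_headArrow k (w := w) (fun e he => hsA e (by rw [← hw, he]))
  rwa [hw] at this

theorem phi_inv_step {s : Option (Fin 4 × Bool)} (hsA : ∀ e, s ≠ some (0, e))
    (hw : w.letter 0 = s) :
    ∃ (i : ℤ) (v : Compactification (Fin 4)), extend (phi k)⁻¹ w = a ^ (-i) • v ∧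
      HeadArrow (k + 1) (v.letter 0) i s := by
  obtain ⟨i, v, h1, -, h2⟩ := phi_inv_headArrow k (w := w) (fun e he => hsA e (by rw [← hw, he]))
  exact ⟨i, v, h1, hw ▸ h2⟩

theorem phi_hasDrift_zero {s : Option (Fin 4 × Bool)}
    (hs : s = none ∨ s = some (1, true) ∨ s = some (3, true)) (hw : w.letter 0 = s) :
    HasDrift (phi k) w 0 := by
  have hsA : ∀ e, s ≠ some (0, e) := by rcases hs with rfl | rfl | rfl <;> simp
  refine hasDrift_of_orbit hsA (orbit_of_invariant_letter (phi_a k) (fun u hu => ?_) hw)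
  obtain ⟨i, v, h1, h2⟩ := phi_step k hsA hu
  refine ⟨v, ?_⟩
  generalize v.letter 0 = t at h2
  rcases hs with rfl | rfl | rfl <;> cases h2 <;> exact ⟨h1, rfl⟩

theorem phi_inv_orbit_zero {s : Option (Fin 4 × Bool)}
    (hs : s = none ∨ s = some (1, true) ∨ s = some (2, true) ∨ s = some (3, true))
    (hw : w.letter 0 = s) (n : ℕ) : (extend ((phi k)⁻¹ ^ n) w).letter 0 = s := by
  have hsA : ∀ e, s ≠ some (0, e) := by rcases hs with rfl | rfl | rfl | rfl <;> simp
  obtain ⟨v, h1, h2⟩ := orbit_of_invariant_letter (i := 0) (phi_inv_apply_a k) (fun u hu => by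
    obtain ⟨i, v, h1, h2⟩ := phi_inv_step k hsA hu
    rcases hs with rfl | rfl | rfl | rfl <;> generalize ht : v.letter 0 = t at h2 <;> cases h2 <;>
      exact ⟨v, h1, ht⟩) hw n
  rwa [h1, zero_mul, zpow_zero, one_smul]

theorem phi_inv_hasDrift_zero {s : Option (Fin 4 × Bool)}
    (hs : s = none ∨ s = some (1, true) ∨ s = some (2, true) ∨ s = some (3, true))
    (hw : w.letter 0 = s) : HasDrift (phi k)⁻¹ w 0 :=
  hasDrift_of_orbit (s := s) (by rcases hs with rfl | rfl | rfl | rfl <;> simp)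
    fun n => ⟨_, by rw [zero_mul, zpow_zero, one_smul], phi_inv_orbit_zero k hs hw n⟩

theorem phi_hasDrift_bInv (hw : w.letter 0 = some (1, false)) : HasDrift (phi k) w (-1) := by
  refine hasDrift_of_orbit (by simp) (orbit_of_invariant_letter (phi_a k) (fun u hu => ?_) hw)
  obtain ⟨i, v, h1, h2⟩ := phi_step k (by simp) hu
  refine ⟨v, ?_⟩
  generalize v.letter 0 = t at h2
  cases h2
  exact ⟨h1, rfl⟩

theorem phi_inv_hasDrift_bInv (hw : w.letter 0 = some (1, false)) : HasDrift (phi k)⁻¹ w 1 := by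
  refine hasDrift_of_orbit (by simp)
    (orbit_of_invariant_letter (phi_inv_apply_a k) (fun u hu => ?_) hw)
  obtain ⟨i, v, h1, h2⟩ := phi_inv_step k (by simp) hu
  refine ⟨v, ?_⟩
  generalize v.letter 0 = t at h2
  cases h2
  exact ⟨h1, rfl⟩

theorem phi_orbit_cInv (hw : w.letter 0 = some (2, false)) (n : ℕ) :
    ∃ v : Compactification (Fin 4), extend (phi k ^ n) w = a ^ (-((k : ℤ) + 1) * n) • v ∧
      v.letter 0 = some (2, false) := by
  refine orbit_of_invariant_letter (phi_a k) (fun u hu => ?_) hw n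
  obtain ⟨i, v, h1, h2⟩ := phi_step k (by simp) hu
  refine ⟨v, ?_⟩
  generalize v.letter 0 = t at h2
  cases h2
  exact ⟨h1, rfl⟩

theorem phi_hasDrift_cInv (hw : w.letter 0 = some (2, false)) :
    HasDrift (phi k) w (-((k : ℤ) + 1)) :=
  hasDrift_of_orbit (by simp) (phi_orbit_cInv k hw)

theorem phi_letter_dInv (hw : w.letter 0 = some (3, false)) :
    (extend (phi k) w).letter 0 = some (2, false) := by
  obtain ⟨i, v, h1, h2⟩ := phi_step k (by simp) hw
  generalize ht : v.letter 0 = t at h2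
  cases h2
  rw [h1, zpow_zero, one_smul, ht]

theorem phi_inv_letter_dInv (hw : w.letter 0 = some (3, false)) :
    (extend (phi k)⁻¹ w).letter 0 = some (2, true) := by
  obtain ⟨i, v, h1, h2⟩ := phi_inv_step k (by simp) hw
  generalize ht : v.letter 0 = t at h2
  cases h2
  rw [h1, neg_zero, zpow_zero, one_smul, ht]

theorem phi_hasDrift_dInv (hw : w.letter 0 = some (3, false)) :
    HasDrift (phi k) w (-((k : ℤ) + 1)) :=
  HasDrift.of_pow 1 (phi_hasDrift_cInv k (by rw [pow_one]; exact phi_letter_dInv k hw))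

theorem phi_inv_hasDrift_dInv (hw : w.letter 0 = some (3, false)) : HasDrift (phi k)⁻¹ w 0 :=
  HasDrift.of_pow 1 (phi_inv_hasDrift_zero k (Or.inr (Or.inr (Or.inl rfl)))
    (by rw [pow_one]; exact phi_inv_letter_dInv k hw))

/-- Under forward iteration, a first letter `c` survives until it is cancelled, and then the
first letter is `d⁻¹`. -/
theorem phi_orbit_c (hw : w.letter 0 = some (2, true)) :
    (∀ n : ℕ, (extend (phi k ^ n) w).letter 0 = some (2, true)) ∨
      ∃ r : ℕ, (extend (phi k ^ r) w).letter 0 = some (3, false) := by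
  refine or_iff_not_imp_right.2 fun h n => ?_
  induction n with
  | zero => rwa [pow_zero, extend_one_apply]
  | succ n ih =>
    obtain ⟨i, v, h1, h2⟩ := phi_step k (by simp) ih
    rw [← extend_mul_apply, ← pow_succ'] at h1
    generalize ht : v.letter 0 = t at h2
    cases h2
    · rw [h1, zpow_zero, one_smul, ht]
    · exact absurd ⟨n + 1, by rw [h1, zpow_zero, one_smul, ht]⟩ h

/-- Under backward iteration, a first letter `c⁻¹` survives until it is cancelled, and then the
first letter is `d⁻¹`. -/
theorem phi_inv_orbit_cInv (hw : w.letter 0 = some (2, false)) :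
    (∀ n : ℕ, ∃ v : Compactification (Fin 4),
      extend ((phi k)⁻¹ ^ n) w = a ^ (((k : ℤ) + 1) * n) • v ∧ v.letter 0 = some (2, false)) ∨
    ∃ (r : ℕ) (v : Compactification (Fin 4)),
      extend ((phi k)⁻¹ ^ (r + 1)) w = a ^ (((k : ℤ) + 1) * r) • v ∧
        v.letter 0 = some (3, false) := by
  refine or_iff_not_imp_right.2 fun h n => ?_
  induction n with
  | zero => exact ⟨w, by simp, hw⟩
  | succ n ih =>
    obtain ⟨v, h1, h2⟩ := ih
    obtain ⟨i, u, h3, h4⟩ := phi_inv_step k (by simp) h2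
    have h5 : extend ((phi k)⁻¹ ^ (n + 1)) w = a ^ (((k : ℤ) + 1) * n - i) • u := by
      rw [pow_succ', extend_mul_apply, h1, extend_smul, map_zpow, phi_inv_apply_a, h3, smul_smul,
        ← zpow_add, sub_eq_add_neg]
    generalize ht : u.letter 0 = t at h4
    cases h4
    · exact ⟨u, by rw [h5]; congr 2, ht⟩
    · exact absurd ⟨n, u, by rw [h5, sub_zero], ht⟩ h

theorem phi_inv_drift_cInv (hw : w.letter 0 = some (2, false)) :
    HasDrift (phi k)⁻¹ w (k + 1) ∨ HasDrift (phi k)⁻¹ w 0 := by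
  rcases phi_inv_orbit_cInv k hw with h | ⟨r, v, h1, h2⟩
  · exact Or.inl (hasDrift_of_orbit (by simp) h)
  · refine Or.inr (HasDrift.of_pow (r + 1) ?_)
    rw [h1]
    exact (phi_inv_hasDrift_dInv k h2).zpow_smul (phi_inv_apply_a k) _

/-- The possible pairs of a forward drift `κ` and a backward drift `κ'`, together with the first
letters for which they occur. In the third case the first letter is `c⁻¹`, or it becomes
`d⁻¹` after `r` iterations. -/
theorem exists_hasDrift (hw : NonA w) : ∃ κ κ' : ℤ,
    HasDrift (phi k) w κ ∧ HasDrift (phi k)⁻¹ w κ' ∧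
      ((κ = 0 ∧ κ' = 0) ∨ (κ = -1 ∧ κ' = 1 ∧ w.letter 0 = some (1, false)) ∨
        (κ = -((k : ℤ) + 1) ∧ κ' = 0 ∧ (w.letter 0 = some (2, false) ∨
          ∃ r : ℕ, (extend (phi k ^ r) w).letter 0 = some (3, false))) ∨
        (κ = -((k : ℤ) + 1) ∧ κ' = k + 1 ∧ w.letter 0 = some (2, false))) := by
  obtain ⟨i, v, h1, h2⟩ := phi_headArrow k hw
  clear h1
  generalize hs : w.letter 0 = s at h2 ⊢
  generalize v.letter 0 = t at h2
  have c0 : w.letter 0 = some (2, true) → ∃ κ κ' : ℤ,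
    HasDrift (phi k) w κ ∧ HasDrift (phi k)⁻¹ w κ' ∧
      ((κ = 0 ∧ κ' = 0) ∨ (κ = -((k : ℤ) + 1) ∧ κ' = 0 ∧
          ∃ r : ℕ, (extend (phi k ^ r) w).letter 0 = some (3, false))) := by
    intro hc
    rcases phi_orbit_c k hc with h | ⟨r, h⟩
    · refine ⟨0, 0, hasDrift_of_orbit (s := some (2, true)) (by simp) fun n => ?_,
        phi_inv_hasDrift_zero k (by simp) hc, Or.inl ⟨rfl, rfl⟩⟩
      exact ⟨extend (phi k ^ n) w, by simp, h n⟩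
    · exact ⟨_, 0, HasDrift.of_pow r (phi_hasDrift_dInv k h), phi_inv_hasDrift_zero k (by simp) hc,
        Or.inr ⟨rfl, rfl, r, h⟩⟩
  cases h2
  · exact ⟨0, 0, phi_hasDrift_zero k (by simp) hs, phi_inv_hasDrift_zero k (by simp) hs, by simp⟩
  · exact ⟨0, 0, phi_hasDrift_zero k (by simp) hs, phi_inv_hasDrift_zero k (by simp) hs, by simp⟩
  · exact ⟨_, _, phi_hasDrift_bInv k hs, phi_inv_hasDrift_bInv k hs, by simp⟩
  · obtain ⟨κ, κ', h1, h2, h3⟩ := c0 hs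
    exact ⟨κ, κ', h1, h2, by tauto⟩
  · obtain ⟨κ, κ', h1, h2, h3⟩ := c0 hs
    exact ⟨κ, κ', h1, h2, by tauto⟩
  · rcases phi_inv_drift_cInv k hs with h | h
    · exact ⟨_, _, phi_hasDrift_cInv k hs, h, by simp⟩
    · exact ⟨_, _, phi_hasDrift_cInv k hs, h, by simp⟩
  · exact ⟨0, 0, phi_hasDrift_zero k (by simp) hs, phi_inv_hasDrift_zero k (by simp) hs, by simp⟩
  · exact ⟨_, _, phi_hasDrift_dInv k hs, phi_inv_hasDrift_dInv k hs, Or.inr (Or.inr (Or.inl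
      ⟨rfl, rfl, Or.inr ⟨0, by rwa [pow_zero, extend_one_apply]⟩⟩))⟩

end Drift

/-! ### Points with first letter `d` -/

section InfiniteWords
variable (k : ℕ)

/-- The reduced word `d c c a^{k+1} ⋯ c a^{(n-1)(k+1)}` of `φ_k^n(d)`. -/
def wordPlus (n : ℕ) : List (Fin 4 × Bool) :=
  (3, true) :: (List.range n).flatMap
    fun i => (2, true) :: List.replicate (i * (k + 1)) (0, true)

/-- The reduced word `d a^{k+1} c⁻¹ ⋯ a^{n(k+1)} c⁻¹` of `φ_k^{-n}(d)`. -/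
def wordMinus (n : ℕ) : List (Fin 4 × Bool) :=
  (3, true) :: (List.range n).flatMap
    fun i => List.replicate ((i + 1) * (k + 1)) (0, true) ++ [(2, false)]

theorem wordPlus_succ (n : ℕ) : wordPlus k (n + 1) =
    wordPlus k n ++ (2, true) :: List.replicate (n * (k + 1)) (0, true) := by
  simp [wordPlus, List.range_succ]

theorem wordMinus_succ (n : ℕ) : wordMinus k (n + 1) =
    wordMinus k n ++ (List.replicate ((n + 1) * (k + 1)) (0, true) ++ [(2, false)]) := by
  simp [wordMinus, List.range_succ]

theorem length_wordPlus (n : ℕ) :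
    (wordPlus k n).length = 1 + ∑ i ∈ Finset.range n, (1 + i * (k + 1)) := by
  induction n with
  | zero => rfl
  | succ n ih =>
    rw [wordPlus_succ, Finset.sum_range_succ, List.length_append, ih]
    simp only [List.length_cons, List.length_replicate]
    ring

theorem length_wordMinus (n : ℕ) :
    (wordMinus k n).length = 1 + ∑ i ∈ Finset.range n, ((i + 1) * (k + 1) + 1) := by
  induction n with
  | zero => rfl
  | succ n ih =>
    rw [wordMinus_succ, Finset.sum_range_succ, List.length_append, ih]
    simp only [List.length_append, List.length_cons, List.length_replicate, List.length_nil]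
    ring

theorem le_sum_range_of_pos {f : ℕ → ℕ} (hf : ∀ i, 1 ≤ f i) (n : ℕ) :
    n ≤ ∑ i ∈ Finset.range n, f i := by
  simpa using Finset.card_nsmul_le_sum (Finset.range n) f 1 fun i _ => hf i

theorem sum_range_mono (f : ℕ → ℕ) {m n : ℕ} (h : m ≤ n) :
    ∑ i ∈ Finset.range m, f i ≤ ∑ i ∈ Finset.range n, f i :=
  Finset.sum_le_sum_of_subset (Finset.range_mono h)

theorem getElem?_wordPlus (n : ℕ) {i : ℕ} (hi : i < (wordPlus k n).length) :
    (wordPlus k n)[i]? = some ((XPlus k).seq i) := by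
  induction n generalizing i with
  | zero =>
    obtain rfl : i = 0 := by simpa [wordPlus] using hi
    rfl
  | succ n ih =>
    by_cases h : i < (wordPlus k n).length
    · rw [wordPlus_succ, List.getElem?_append_left h, ih h]
    · obtain ⟨j, rfl⟩ := Nat.exists_eq_add_of_le (not_lt.1 h)
      rw [wordPlus_succ, List.getElem?_append_right (Nat.le_add_right _ _),
        Nat.add_sub_cancel_left]
      rw [length_wordPlus, length_wordPlus, Finset.sum_range_succ] at hi
      rw [length_wordPlus]
      have hn := le_sum_range_of_pos (f := fun i => 1 + i * (k + 1)) (fun i => by omega) n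
      simp only [XPlus]
      rw [if_neg (by omega)]
      cases j with
      | zero =>
        rw [if_pos ⟨n, by rw [Finset.mem_range]; omega, by omega⟩]
        rfl
      | succ j =>
        rw [if_neg]
        · rw [List.getElem?_cons_succ, List.getElem?_replicate, if_pos (by omega)]
        · rintro ⟨j', -, h⟩
          rcases Nat.lt_or_ge n j' with h' | h'
          · have := sum_range_mono (fun i => 1 + i * (k + 1)) h'
            rw [Finset.sum_range_succ] at this
            omega
          · have := sum_range_mono (fun i => 1 + i * (k + 1)) h'
            omega

theorem getElem?_wordMinus (n : ℕ) {i : ℕ} (hi : i < (wordMinus k n).length) :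
    (wordMinus k n)[i]? = some ((XMinus k).seq i) := by
  induction n generalizing i with
  | zero =>
    obtain rfl : i = 0 := by simpa [wordMinus] using hi
    rfl
  | succ n ih =>
    by_cases h : i < (wordMinus k n).length
    · rw [wordMinus_succ, List.getElem?_append_left h, ih h]
    · obtain ⟨j, rfl⟩ := Nat.exists_eq_add_of_le (not_lt.1 h)
      rw [wordMinus_succ, List.getElem?_append_right (Nat.le_add_right _ _),
        Nat.add_sub_cancel_left]
      rw [length_wordMinus, length_wordMinus, Finset.sum_range_succ] at hi
      rw [length_wordMinus]
      have hn := le_sum_range_of_pos (f := fun i => (i + 1) * (k + 1) + 1) (fun i => by omega) n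
      simp only [XMinus]
      rw [if_neg (by omega)]
      by_cases hj : j < (n + 1) * (k + 1)
      · rw [if_neg]
        · rw [List.getElem?_append_left (by simpa using hj), List.getElem?_replicate, if_pos hj]
        · rintro ⟨j', -, h⟩
          rcases Nat.lt_or_ge j' n with h' | h'
          · have := sum_range_mono (fun i => (i + 1) * (k + 1) + 1) (show j' + 1 ≤ n from h')
            omega
          · have := sum_range_mono (fun i => (i + 1) * (k + 1) + 1) (show n + 1 ≤ j' + 1 by omega)
            rw [Finset.sum_range_succ] at this
            omega
      · obtain rfl : j = (n + 1) * (k + 1) := by omega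
        have hs := Finset.sum_range_succ (fun i => (i + 1) * (k + 1) + 1) n
        rw [if_pos ⟨n, by rw [Finset.mem_range]; omega, by omega⟩]
        rw [List.getElem?_append_right (by simp)]
        simp

theorem isReduced_of_sign {L : List (Fin 4 × Bool)} (f : Fin 4 → Bool)
    (h : ∀ p ∈ L, p.2 = f p.1) : FreeGroup.IsReduced L := by
  refine List.Pairwise.isChain (List.pairwise_of_forall_mem_list ?_)
  intro p hp q hq hpq
  rw [h p hp, h q hq, hpq]

theorem sign_wordPlus (n : ℕ) : ∀ p ∈ wordPlus k n, p.2 = true := by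
  intro p hp
  simp only [wordPlus, List.mem_cons, List.mem_flatMap, List.mem_replicate] at hp
  rcases hp with rfl | ⟨_, _, rfl | ⟨_, rfl⟩⟩ <;> rfl

theorem isReduced_wordMinus (n : ℕ) : FreeGroup.IsReduced (wordMinus k n) := by
  refine isReduced_of_sign (fun i => decide (i ≠ 2)) fun p hp => ?_
  simp only [wordMinus, List.mem_cons, List.mem_flatMap, List.mem_append, List.mem_replicate,
    List.not_mem_nil, or_false] at hp
  rcases hp with rfl | ⟨_, _, ⟨_, rfl⟩ | rfl⟩ <;> rfl

theorem phi_inv_apply_b : (phi k)⁻¹ b = b * a ^ (-1 : ℤ) := by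
  rw [MulAut.inv_apply, MulEquiv.symm_apply_eq, map_mul, map_zpow, phi_a, phi_b]
  simp

theorem phi_inv_apply_c : (phi k)⁻¹ c = c * a ^ (-((k : ℤ) + 1)) := by
  rw [MulAut.inv_apply, MulEquiv.symm_apply_eq, map_mul, map_zpow, phi_a, phi_c, zpow_neg,
    mul_inv_cancel_right]

theorem phi_inv_apply_d : (phi k)⁻¹ d = d * a ^ ((k : ℤ) + 1) * c⁻¹ := by
  rw [MulAut.inv_apply, MulEquiv.symm_apply_eq, map_mul, map_mul, map_inv, map_zpow, phi_a, phi_c,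
    phi_d]
  group

theorem phi_pow_apply_c (n : ℕ) : (phi k ^ n) c = c * a ^ (((k : ℤ) + 1) * n) :=
  pow_apply_mul_zpow (phi_a k) (phi_c k) n

theorem phi_inv_pow_apply_c (n : ℕ) : ((phi k)⁻¹ ^ n) c = c * a ^ (-((k : ℤ) + 1) * n) :=
  pow_apply_mul_zpow (phi_inv_apply_a k) (phi_inv_apply_c k) n

theorem mk_replicate_a (n : ℕ) :
    FreeGroup.mk (List.replicate n ((0 : Fin 4), true)) = a ^ (n : ℤ) := by
  rw [zpow_natCast]
  induction n with
  | zero => rfl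
  | succ n ih => rw [pow_succ', ← ih, List.replicate_succ]; rfl

theorem phi_pow_apply_d (n : ℕ) : (phi k ^ n) d = FreeGroup.mk (wordPlus k n) := by
  induction n with
  | zero => rfl
  | succ n ih =>
    rw [pow_succ, MulAut.mul_apply, phi_d, map_mul, ih, phi_pow_apply_c, wordPlus_succ,
      ← FreeGroup.mul_mk]
    congr 1
    rw [show ((k : ℤ) + 1) * n = ((n * (k + 1) : ℕ) : ℤ) by push_cast; ring, ← mk_replicate_a]
    rfl

theorem phi_inv_pow_apply_d (n : ℕ) : ((phi k)⁻¹ ^ n) d = FreeGroup.mk (wordMinus k n) := by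
  induction n with
  | zero => rfl
  | succ n ih =>
    rw [pow_succ, MulAut.mul_apply, phi_inv_apply_d, map_mul, map_mul, map_inv, map_zpow, ih,
      phi_inv_pow_apply_c, pow_apply_eq_self (phi_inv_apply_a k), wordMinus_succ,
      ← FreeGroup.mul_mk, ← FreeGroup.mul_mk, mk_replicate_a,
      show FreeGroup.mk [((2 : Fin 4), false)] = c⁻¹ from (mk_singleton_inv (2, true)).symm,
      mul_inv_rev, ← zpow_neg, mul_assoc, ← mul_assoc (a ^ _), ← zpow_add]
    congr 4
    push_cast
    ring

/-- Along the forward orbit of a point with first letter `c`, the leading power of `a` drops so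
late that it cannot cancel the word of `φ_k^n(d)`. -/
theorem phi_orbit_c_bound {z : Compactification (Fin 4)} (hz : z.letter 0 = some (2, true))
    (n : ℕ) : ∃ (q : ℕ) (v : Compactification (Fin 4)),
      extend (phi k ^ n) z = a ^ (-((k : ℤ) + 1) * q) • v ∧
      ((v.letter 0 = some (2, true) ∧ q = 0) ∨ (v.letter 0 = some (3, false) ∧ q = 0 ∧ 1 ≤ n) ∨
        (v.letter 0 = some (2, false) ∧ q + 2 ≤ n)) := by
  induction n with
  | zero => exact ⟨0, z, by simp, Or.inl ⟨hz, rfl⟩⟩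
  | succ n ih =>
    obtain ⟨q, v, h1, h2⟩ := ih
    have hnext : ∀ s, s ≠ some (0, true) ∧ s ≠ some (0, false) → v.letter 0 = s →
        ∃ (i : ℤ) (u : Compactification (Fin 4)),
        extend (phi k ^ (n + 1)) z = a ^ (-((k : ℤ) + 1) * q + i) • u ∧
        HeadArrow (k + 1) s i (u.letter 0) := by
      intro s hsA hs
      obtain ⟨i, u, h3, h4⟩ := phi_step k (s := s) (by simpa [and_comm] using hsA) hs
      refine ⟨i, u, ?_, h4⟩
      rw [pow_succ', extend_mul_apply, h1, extend_smul, map_zpow, phi_a, h3, smul_smul, ← zpow_add]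
    rcases h2 with ⟨hs, rfl⟩ | ⟨hs, rfl, hn⟩ | ⟨hs, hn⟩
    · obtain ⟨i, u, h3, h4⟩ := hnext _ (by decide) hs
      generalize ht : u.letter 0 = t at h4
      cases h4
      · exact ⟨0, u, by simpa using h3, Or.inl ⟨ht, rfl⟩⟩
      · exact ⟨0, u, by simpa using h3, Or.inr (Or.inl ⟨ht, rfl, by omega⟩)⟩
    · obtain ⟨i, u, h3, h4⟩ := hnext _ (by decide) hs
      generalize ht : u.letter 0 = t at h4
      cases h4
      exact ⟨0, u, by simpa using h3, Or.inr (Or.inr ⟨ht, by omega⟩)⟩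
    · obtain ⟨i, u, h3, h4⟩ := hnext _ (by decide) hs
      generalize ht : u.letter 0 = t at h4
      cases h4
      refine ⟨q + 1, u, ?_, Or.inr (Or.inr ⟨ht, by omega⟩)⟩
      rw [h3]
      congr 2
      push_cast
      ring

/-- If `z` starts with `c`, then `φ_k^n(d z)` agrees with `X_k^+` on its first `n - 1` letters. -/
theorem letter_phi_pow_smul_d {z : Compactification (Fin 4)} (hz : z.letter 0 = some (2, true))
    {n i : ℕ} (hi : i + 1 < n) :
    (extend (phi k ^ n) (d • z)).letter i = (ofBoundary (XPlus k)).letter i := by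
  obtain ⟨n, rfl⟩ : ∃ n', n = n' + 1 := ⟨n - 1, by omega⟩
  obtain ⟨q, v, h1, h2⟩ := phi_orbit_c_bound k hz (n + 1)
  have hpos : 0 < ((k : ℤ) + 1) * (n - q) := by
    have : (q : ℤ) < n := by rcases h2 with h | h | h <;> omega
    exact mul_pos (by omega) (by omega)
  have hA : NonA v := by
    rcases h2 with h | h | h
    · exact nonA_of_letter h.1 (by decide)
    · exact nonA_of_letter h.1 (by decide)
    · exact nonA_of_letter h.1 (by decide)
  have h3 : extend (phi k ^ (n + 1)) (d • z) =
      FreeGroup.mk (wordPlus k n ++ [(2, true)]) • (a ^ (((k : ℤ) + 1) * (n - q)) • v) := by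
    rw [extend_smul, h1, phi_pow_apply_d, wordPlus_succ,
      ← List.singleton_append (x := (2, true)), ← List.append_assoc,
      ← FreeGroup.mul_mk, mk_replicate_a, mul_smul, smul_smul (a ^ _) (a ^ _), ← zpow_add]
    congr 3
    push_cast
    ring
  have hlen : i < (wordPlus k n).length := by
    rw [length_wordPlus]
    have := le_sum_range_of_pos (f := fun i => 1 + i * (k + 1)) (fun i => by omega) n
    omega
  rw [h3, letter_mk_smul, if_pos (by simp; omega), List.getElem?_append_left hlen,
    getElem?_wordPlus k n hlen]
  · rfl
  · refine isReduced_of_sign (fun _ => true) fun p hp => ?_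
    rw [List.mem_append, List.mem_singleton] at hp
    rcases hp with hp | rfl
    · exact sign_wordPlus k n p hp
    · rfl
  · intro s hs
    obtain rfl : (2, true) = s := by simpa using hs
    rw [letter_zero_zpow_smul hA (by omega)]
    simp

/-- Along the backward orbit of a point with first letter `c⁻¹`, the leading power of `a` has a
non-negative exponent, so it cannot cancel the word of `φ_k^{-n}(d)`. -/
theorem phi_inv_orbit_bound {v : Compactification (Fin 4)} (hv : v.letter 0 = some (2, false))
    (n : ℕ) : ∃ (q : ℕ) (u : Compactification (Fin 4)),
      extend ((phi k)⁻¹ ^ n) v = a ^ (((k : ℤ) + 1) * q) • u ∧ NonA u := by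
  have key : ∃ (q : ℕ) (u : Compactification (Fin 4)),
      extend ((phi k)⁻¹ ^ n) v = a ^ (((k : ℤ) + 1) * q) • u ∧
      (u.letter 0 = some (2, false) ∨ u.letter 0 = some (3, false) ∨
        u.letter 0 = some (2, true)) := by
    induction n with
    | zero => exact ⟨0, v, by simp, Or.inl hv⟩
    | succ n ih =>
      obtain ⟨q, v', h1, h2⟩ := ih
      have hnext : ∀ s, s ≠ some (0, true) ∧ s ≠ some (0, false) → v'.letter 0 = s →
          ∃ (i : ℤ) (u : Compactification (Fin 4)),
          extend ((phi k)⁻¹ ^ (n + 1)) v = a ^ (((k : ℤ) + 1) * q - i) • u ∧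
          HeadArrow (k + 1) (u.letter 0) i s := by
        intro s hsA hs
        obtain ⟨i, u, h3, h4⟩ := phi_inv_step k (s := s) (by simpa [and_comm] using hsA) hs
        refine ⟨i, u, ?_, h4⟩
        rw [pow_succ', extend_mul_apply, h1, extend_smul, map_zpow, phi_inv_apply_a, h3, smul_smul,
          ← zpow_add, sub_eq_add_neg]
      rcases h2 with hs | hs | hs
      · obtain ⟨i, u, h3, h4⟩ := hnext _ (by decide) hs
        generalize ht : u.letter 0 = t at h4
        cases h4
        · exact ⟨q + 1, u, by rw [h3]; congr 2, Or.inl ht⟩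
        · exact ⟨q, u, by simpa using h3, Or.inr (Or.inl ht)⟩
      · obtain ⟨i, u, h3, h4⟩ := hnext _ (by decide) hs
        generalize ht : u.letter 0 = t at h4
        cases h4
        exact ⟨q, u, by simpa using h3, Or.inr (Or.inr ht)⟩
      · obtain ⟨i, u, h3, h4⟩ := hnext _ (by decide) hs
        generalize ht : u.letter 0 = t at h4
        cases h4
        exact ⟨q, u, by simpa using h3, Or.inr (Or.inr ht)⟩
  obtain ⟨q, u, h1, h2⟩ := key
  refine ⟨q, u, h1, ?_⟩
  rcases h2 with h | h | h
  · exact nonA_of_letter h (by decide)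
  · exact nonA_of_letter h (by decide)
  · exact nonA_of_letter h (by decide)

/-- If `z` starts with `c⁻¹` and `j > 0`, then `φ_k^{-n}(d a^j z)` agrees with `X_k^-` on its first
`n + 1` letters. -/
theorem letter_phi_inv_pow_smul_d {z : Compactification (Fin 4)} {j : ℤ} (hj : 0 < j)
    (hz : z.letter 0 = some (2, false)) {n i : ℕ} (hi : i ≤ n) :
    (extend ((phi k)⁻¹ ^ n) (d • a ^ j • z)).letter i = (ofBoundary (XMinus k)).letter i := by
  obtain ⟨q, v, h1, hA⟩ := phi_inv_orbit_bound k hz n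
  have hpos : 0 < j + ((k : ℤ) + 1) * q := by positivity
  have hlen : i < (wordMinus k n).length := by
    rw [length_wordMinus]
    have := le_sum_range_of_pos (f := fun i => (i + 1) * (k + 1) + 1) (fun i => by omega) n
    omega
  rw [extend_smul, extend_smul, map_zpow, pow_apply_eq_self (phi_inv_apply_a k), h1, smul_smul,
    smul_smul, mul_assoc, ← zpow_add, mul_smul, phi_inv_pow_apply_d,
    letter_mk_smul (isReduced_wordMinus k n),
    if_pos hlen, getElem?_wordMinus k n hlen]
  · rfl
  · intro s hs
    rw [letter_zero_zpow_smul hA (by omega)]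
    have : s.1 ≠ 0 := by
      cases n with
      | zero =>
        obtain rfl : (3, true) = s := by simpa [wordMinus] using hs
        decide
      | succ n =>
        rw [wordMinus_succ, ← List.append_assoc] at hs
        obtain rfl : (2, false) = s := by simpa using hs
        decide
    intro h
    rw [Option.some.injEq, Prod.mk.injEq] at h
    exact this h.1.symm

theorem exists_eq_d_smul {y : Compactification (Fin 4)} (hy : y.letter 0 = some (3, true)) :
    ∃ z : Compactification (Fin 4), y = d • z ∧ z.letter 0 ≠ some (3, false) :=
  ⟨d⁻¹ • y, by simp, letter_zero_inv_singleton_smul_ne hy⟩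

/-- The image of a point starting with `d` starts with `d c`, unless the point starts with
`d a^{k+1} c⁻¹`. -/
theorem phi_step_d {z : Compactification (Fin 4)} (hz : z.letter 0 ≠ some (3, false)) :
    (∃ u : Compactification (Fin 4),
      extend (phi k) (d • z) = d • u ∧ u.letter 0 = some (2, true)) ∨
    ∃ v : Compactification (Fin 4),
      z = a ^ ((k : ℤ) + 1) • v ∧ v.letter 0 = some (2, false) := by
  have hform : extend (phi k) (d • z) = d • (c • extend (phi k) z) := by
    rw [extend_smul, phi_d, mul_smul]
  by_cases hc : (extend (phi k) z).letter 0 = some (2, false)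
  · right
    rcases exists_eq_zpow_smul z with ⟨s, rfl⟩ | ⟨j, v, rfl, hA, -⟩
    · rw [extend_aInf (phi_a k)] at hc
      cases s <;> exact absurd hc (by simp [aInf])
    · obtain ⟨i, u, h1, h2⟩ := phi_headArrow k hA
      rw [extend_smul, map_zpow, phi_a, h1, smul_smul, ← zpow_add,
        letter_zero_zpow_smul_iff h2.nonA (by decide)] at hc
      rw [ne_eq, letter_zero_zpow_smul_iff hA (by decide)] at hz
      rw [hc.2] at h2
      generalize ht : v.letter 0 = t at h2 hz
      cases h2
      · exact ⟨v, by rw [show j = (k : ℤ) + 1 by omega], ht⟩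
      · exact absurd ⟨by omega, rfl⟩ hz
  · exact Or.inl ⟨_, hform, letter_zero_c_smul hc⟩

theorem isOmega_XPlus_of_c {z : Compactification (Fin 4)} (hz : z.letter 0 = some (2, true)) :
    IsOmega (phi k) (d • z) (ofBoundary (XPlus k)) := by
  rw [isOmega_iff]
  refine tendsto_iff_letter.2 fun i => ?_
  filter_upwards [eventually_gt_atTop (i + 1)] with n hn
  exact letter_phi_pow_smul_d k hz hn

theorem isOmega_XMinus_of_cInv {z : Compactification (Fin 4)}
    (hz : z.letter 0 = some (2, false)) :
    IsOmega (phi k)⁻¹ (d • a ^ ((k : ℤ) + 1) • z) (ofBoundary (XMinus k)) := by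
  rw [isOmega_iff]
  refine tendsto_iff_letter.2 fun i => ?_
  filter_upwards [eventually_ge_atTop i] with n hn
  exact letter_phi_inv_pow_smul_d k (by omega) hz hn

theorem letter_extend_d (n : ℕ) {y : Compactification (Fin 4)}
    (hy : y.letter 0 = some (3, true)) : (extend (phi k ^ n) y).letter 0 = some (3, true) := by
  obtain ⟨v, h1, h2⟩ := orbit_of_invariant_letter (i := 0) (phi_a k) (fun u hu => by
    obtain ⟨i, v, h1, h2⟩ := phi_step k (s := some (3, true)) (by simp) hu
    refine ⟨v, ?_⟩
    generalize v.letter 0 = t at h2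
    cases h2
    exact ⟨h1, rfl⟩) hy n
  rwa [h1, zero_mul, zpow_zero, one_smul]

theorem extend_inv_pow_extend_pow (ψ : MulAut F4) (n : ℕ) (x : Compactification (Fin 4)) :
    extend (ψ⁻¹ ^ n) (extend (ψ ^ n) x) = x := by
  rw [← extend_mul_apply, inv_pow, inv_mul_cancel, extend_one_apply]

theorem extend_pow_extend_inv_pow (ψ : MulAut F4) (n : ℕ) (x : Compactification (Fin 4)) :
    extend (ψ ^ n) (extend (ψ⁻¹ ^ n) x) = x := by
  rw [← extend_mul_apply, inv_pow, mul_inv_cancel, extend_one_apply]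

/-- Among the points with first letter `d`, all but `X_k^-` have a forward orbit converging to
`X_k^+`. -/
theorem isOmega_XPlus {y : Compactification (Fin 4)} (hy : y.letter 0 = some (3, true))
    (hne : y ≠ ofBoundary (XMinus k)) : IsOmega (phi k) y (ofBoundary (XPlus k)) := by
  by_contra hcon
  -- otherwise `φ_k^i(y)` starts with `d a^{k+1} c⁻¹` for all `i`, and applying `φ_k^{-i}` shows
  -- that `y` and `X_k^-` have the same letter at position `i`
  refine hne (compactification_ext fun i => ?_)
  obtain ⟨z, hz, hz'⟩ := exists_eq_d_smul (letter_extend_d k i hy)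
  rcases phi_step_d k hz' with ⟨u, h1, h2⟩ | ⟨v, rfl, h2⟩
  · refine absurd (isOmega_of_pow (i + 1) ?_) hcon
    rw [pow_succ', extend_mul_apply, hz, h1]
    exact isOmega_XPlus_of_c k h2
  · rw [← extend_inv_pow_extend_pow (phi k) i y, hz]
    exact letter_phi_inv_pow_smul_d k (by omega) h2 le_rfl

/-- Among the points with first letter `d`, all but `X_k^+` have a backward orbit converging to
`X_k^-`. -/
theorem isOmega_XMinus {y : Compactification (Fin 4)} (hy : y.letter 0 = some (3, true))
    (hne : y ≠ ofBoundary (XPlus k)) : IsOmega (phi k)⁻¹ y (ofBoundary (XMinus k)) := by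
  by_contra hcon
  -- otherwise no `φ_k^{-n}(y)` starts with `d a^{k+1} c⁻¹`, so that each of them starts with `dc`,
  -- and applying `φ_k^{i+2}` shows that `y` and `X_k^+` have the same letter at position `i`
  refine hne (compactification_ext fun i => ?_)
  obtain ⟨z, hz, hz'⟩ := exists_eq_d_smul (phi_inv_orbit_zero k (by simp) hy (i + 3))
  rcases phi_step_d k hz' with ⟨u, h1, h2⟩ | ⟨v, rfl, h2⟩
  · rw [← hz, pow_succ', extend_mul_apply, extend_inv_apply] at h1
    rw [← extend_pow_extend_inv_pow (phi k) (i + 2) y, h1]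
    exact letter_phi_pow_smul_d k h2 (by omega)
  · refine absurd (isOmega_of_pow (i + 3) ?_) hcon
    rw [hz]
    exact isOmega_XMinus_of_cInv k h2

end InfiniteWords

/-! ### The limits of the orbits which are not fixed -/

section Limits
variable (k : ℕ)

theorem b_smul_aInf (s : Bool) : b • ofBoundary (aInf s) = ofBoundary (baInf s) := by
  refine compactification_ext fun i => ?_
  rw [show b = FreeGroup.mk [((1 : Fin 4), true)] from rfl, letter_singleton_smul (by simp [aInf])]
  by_cases hi : i = 0 <;> simp [hi, aInf, baInf]

theorem c_smul_aInf (s : Bool) : c • ofBoundary (aInf s) = ofBoundary (caInf s) := by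
  refine compactification_ext fun i => ?_
  rw [show c = FreeGroup.mk [((2 : Fin 4), true)] from rfl, letter_singleton_smul (by simp [aInf])]
  by_cases hi : i = 0 <;> simp [hi, aInf, caInf]

variable {x : Compactification (Fin 4)} {κ : ℤ}

theorem isOmega_baInf (h : HasDrift (phi k) x κ) (hne : κ + 1 ≠ 0) :
    IsOmega (phi k) (b • x) (ofBoundary (baInf (decide (0 < κ + 1)))) := by
  rw [← b_smul_aInf]
  exact h.isOmega (phi_a k) (by simp) hne

theorem isOmega_inv_baInf (h : HasDrift (phi k)⁻¹ x κ) (hne : κ + -1 ≠ 0) :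
    IsOmega (phi k)⁻¹ (b • x) (ofBoundary (baInf (decide (0 < κ + -1)))) := by
  rw [← b_smul_aInf]
  exact h.isOmega (phi_inv_apply_a k) (phi_inv_apply_b k) hne

theorem isOmega_caInf (h : HasDrift (phi k) x κ) (hne : κ + (k + 1) ≠ 0) :
    IsOmega (phi k) (c • x) (ofBoundary (caInf (decide (0 < κ + (k + 1))))) := by
  rw [← c_smul_aInf]
  exact h.isOmega (phi_a k) (phi_c k) hne

theorem isOmega_inv_caInf (h : HasDrift (phi k)⁻¹ x κ) (hne : κ + -((k : ℤ) + 1) ≠ 0) :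
    IsOmega (phi k)⁻¹ (c • x) (ofBoundary (caInf (decide (0 < κ + -((k : ℤ) + 1))))) := by
  rw [← c_smul_aInf]
  exact h.isOmega (phi_inv_apply_a k) (phi_inv_apply_c k) hne

theorem exists_eq_d_inv_smul (hx : x.letter 0 = some (3, false)) :
    ∃ t : Compactification (Fin 4), x = d⁻¹ • t ∧ t.letter 0 ≠ some (3, true) := by
  have := letter_zero_inv_singleton_smul_ne hx
  rw [show FreeGroup.mk [((3 : Fin 4), false)] = d⁻¹ from (mk_singleton_inv (3, true)).symm,
    inv_inv] at this
  exact ⟨d • x, by simp, this⟩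

/-- The backward orbit of a point with first letter `d⁻¹` converges to `c a^{-∞}`. -/
theorem isOmega_inv_of_dInv (hx : x.letter 0 = some (3, false)) :
    IsOmega (phi k)⁻¹ x (ofBoundary (caInf false)) := by
  obtain ⟨t, rfl, ht⟩ := exists_eq_d_inv_smul hx
  refine isOmega_of_pow 1 ?_
  have h1 : (extend (phi k)⁻¹ t).letter 0 ≠ some (3, true) := fun h => ht (by
    have := letter_extend_d k 1 h
    rwa [pow_one, extend_inv_apply] at this)
  have h2 : extend ((phi k)⁻¹ ^ 1) (d⁻¹ • t) =
      c • a ^ (-((k : ℤ) + 1)) • d⁻¹ • extend (phi k)⁻¹ t := by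
    rw [pow_one, extend_smul, map_inv, phi_inv_apply_d, smul_smul, smul_smul]
    congr 1
    group
  rw [h2]
  have := isOmega_inv_caInf k ((phi_inv_hasDrift_dInv k (letter_zero_d_inv_smul h1)).zpow_smul
    (phi_inv_apply_a k) (-((k : ℤ) + 1))) (by omega)
  rwa [decide_eq_false (by omega)] at this

/-- The image of a point starting with `d⁻¹` starts with `c⁻¹ d⁻¹`. -/
theorem phi_step_dInv (hx : x.letter 0 = some (3, false)) :
    (c • extend (phi k) x).letter 0 = some (3, false) := by
  obtain ⟨t, rfl, ht⟩ := exists_eq_d_inv_smul hx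
  have h1 : (extend (phi k) t).letter 0 ≠ some (3, true) := fun h => ht (by
    have := phi_inv_orbit_zero k (by simp) h 1
    rwa [pow_one, inv_extend_apply] at this)
  rw [extend_smul, map_inv, phi_d, mul_inv_rev, mul_smul, smul_inv_smul]
  exact letter_zero_d_inv_smul h1

theorem isOmega_of_dInv (hx : x.letter 0 = some (3, false)) :
    IsOmega (phi k) x (ofBoundary (aInf false)) := by
  have := (phi_hasDrift_dInv k hx).isOmega_aInf (phi_a k) (by omega)
  rwa [decide_eq_false (by omega)] at this

theorem isOmega_of_cInv (hx : x.letter 0 = some (2, false)) :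
    IsOmega (phi k) x (ofBoundary (aInf false)) := by
  have := (phi_hasDrift_cInv k hx).isOmega_aInf (phi_a k) (by omega)
  rwa [decide_eq_false (by omega)] at this

theorem isOmega_of_bInv (hx : x.letter 0 = some (1, false)) :
    IsOmega (phi k) x (ofBoundary (aInf false)) :=
  (phi_hasDrift_bInv k hx).isOmega_aInf (phi_a k) (by omega)

theorem isOmega_inv_of_bInv (hx : x.letter 0 = some (1, false)) :
    IsOmega (phi k)⁻¹ x (ofBoundary (aInf true)) :=
  (phi_inv_hasDrift_bInv k hx).isOmega_aInf (phi_inv_apply_a k) (by omega)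

/-! ### Splitting off the fixed prefix -/

/-- A point with arbitrarily long fixed prefixes is fixed. -/
theorem extend_eq_of_frequently_fixed {φ : MulAut F4} {x : Compactification (Fin 4)}
    (h : ∃ᶠ n in atTop, φ (x.take n) = x.take n) : extend φ x = x := by
  have h1 := ((extend φ).continuous.tendsto _).comp (tendsto_take x)
  refine compactification_ext fun i => ?_
  obtain ⟨n, hn, h2, h3⟩ := (h.and_eventually ((tendsto_iff_letter.1 h1 i).and
    (tendsto_iff_letter.1 (tendsto_take x) i))).exists
  rw [← h2, ← h3, Function.comp_apply, extend_ofGroup, hn]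

/-- A point which is not fixed is `g y`, where `g` is fixed by `φ` and `y` has no non-trivial fixed
prefix. -/
theorem exists_maximal_fixed_prefix {φ : MulAut F4} {x : Compactification (Fin 4)}
    (hx : extend φ x ≠ x) : ∃ (g : F4) (y : Compactification (Fin 4)), x = g • y ∧ φ g = g ∧
      ∀ u : F4, u ≠ 1 → φ u = u → ¬ ∀ i < u.norm, y.letter i = (ofGroup u).letter i := by
  by_contra hcon
  push Not at hcon
  -- otherwise fixed prefixes can be prolonged indefinitely
  have key : ∀ n : ℕ, ∃ N, n ≤ N ∧ (∀ i < N, x.letter i ≠ none) ∧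
      φ (x.take N) = x.take N := by
    intro n
    induction n with
    | zero => exact ⟨0, le_rfl, by simp, by simp [Compactification.take, ← FreeGroup.one_eq_mk]⟩
    | succ n ih =>
      obtain ⟨N, h1, h2, h3⟩ := ih
      obtain ⟨u, hu1, hu2, hu3⟩ := hcon (x.take N) ((x.take N)⁻¹ • x) (by simp) h3
      have hpos : 0 < u.norm := by
        rw [Nat.pos_iff_ne_zero, ne_eq, FreeGroup.norm_eq_zero]
        exact hu1
      refine ⟨N + u.norm, by omega, fun i hi => ?_, ?_⟩
      · rcases lt_or_ge i N with h | h
        · exact h2 i h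
        · obtain ⟨j, rfl⟩ := Nat.exists_eq_add_of_le h
          rw [← letter_inv_take_smul h2, hu3 j (by omega), ne_eq, letter_eq_none]
          omega
      · rw [take_add h2, take_congr hu3, take_ofGroup_of_le le_rfl, map_mul, h3, hu2]
  refine hx (extend_eq_of_frequently_fixed (frequently_atTop.2 fun n => ?_))
  obtain ⟨N, h1, -, h3⟩ := key n
  exact ⟨N, h1, h3⟩

/-- For a generator `s ≠ a`, a point `s a^j s⁻¹ ⋯` with `j ≠ 0` has the prefix `s a^j s⁻¹`. -/
theorem letter_conj_prefix {s : Fin 4} (hs : s ≠ 0) {j : ℤ} (hj : j ≠ 0)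
    {v : Compactification (Fin 4)} (hv : v.letter 0 = some (s, false)) {u : F4}
    (hu : u = FreeGroup.of s * a ^ j * (FreeGroup.of s)⁻¹) :
    u ≠ 1 ∧ ∀ i < u.norm, (FreeGroup.of s • a ^ j • v).letter i = (ofGroup u).letter i := by
  have h1 : (ofGroup u⁻¹).letter 0 = some (s, true) := by
    have : ofGroup u⁻¹ = FreeGroup.of s • a ^ (-j) • (FreeGroup.of s)⁻¹ • ofGroup 1 := by
      rw [hu, smul_ofGroup, smul_ofGroup, smul_ofGroup]
      congr 1
      group
    rw [this]
    apply letter_zero_of_smul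
    rw [letter_zero_zpow_smul _ (by omega)]
    · simp [Ne.symm hs]
    · exact nonA_of_letter (letter_zero_of_inv_smul (by simp)) hs
  have h2 : FreeGroup.of s • a ^ j • v = u • FreeGroup.of s • v := by
    rw [hu, mul_smul, mul_smul, inv_smul_smul]
  have h3 : (FreeGroup.of s • v).letter 0 ≠ some (s, true) := by
    have := letter_zero_inv_singleton_smul_ne hv
    rwa [mk_singleton_inv] at this
  refine ⟨?_, fun i hi => ?_⟩
  · rintro rfl
    simp at h1
  · rw [h2]
    exact letter_smul_of_lt h1 h3 hi

theorem phi_conj_b (j : ℤ) : phi k (b * a ^ j * b⁻¹) = b * a ^ j * b⁻¹ := by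
  rw [map_mul, map_mul, map_inv, map_zpow, phi_a, phi_b]
  group

theorem phi_conj_c (j : ℤ) : phi k (c * a ^ j * c⁻¹) = c * a ^ j * c⁻¹ := by
  rw [map_mul, map_mul, map_inv, map_zpow, phi_a, phi_c]
  group

/-- The forward or backward orbit of `x` under `ψ` converges to a point isogloss (for `φ_k`) to the
point named by the vertex `v` of the figure. -/
def LimitClass (ψ : MulAut F4) (x : Compactification (Fin 4)) (v : FigureVertex) : Prop :=
  ∃ g : F4, phi k g = g ∧ IsOmega ψ x (g • ofBoundary (v.point k))

theorem limitClass_of_isOmega {ψ : MulAut F4} {v : FigureVertex}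
    (h : IsOmega ψ x (ofBoundary (v.point k))) : LimitClass k ψ x v :=
  ⟨1, map_one _, by rwa [one_smul]⟩

theorem LimitClass.smul {ψ : MulAut F4} {v : FigureVertex} {k : ℕ} {g : F4}
    (hψ : ψ g = g) (hg : phi k g = g) (h : LimitClass k ψ x v) : LimitClass k ψ (g • x) v := by
  obtain ⟨u, hu, h⟩ := h
  exact ⟨g * u, by rw [map_mul, hg, hu], by rw [mul_smul]; exact h.smul hψ⟩

theorem LimitClass.of_pow {ψ : MulAut F4} {v : FigureVertex} {k : ℕ} (r : ℕ)
    (h : LimitClass k ψ (extend (ψ ^ r) x) v) : LimitClass k ψ x v := by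
  obtain ⟨u, hu, h⟩ := h
  exact ⟨u, hu, isOmega_of_pow r h⟩

theorem phi_inv_eq_self {k : ℕ} {g : F4} (h : phi k g = g) : (phi k)⁻¹ g = g := by
  rw [MulAut.inv_apply, MulEquiv.symm_apply_eq, h]

theorem letter_d_one : (ofGroup d).letter 0 = some (3, true) := rfl

theorem ofGroup_ne_ofBoundary {g : F4} {X : Boundary (Fin 4)} : ofGroup g ≠ ofBoundary X := by
  rintro ⟨⟩

theorem extend_XPlus : extend (phi k) (ofBoundary (XPlus k)) = ofBoundary (XPlus k) :=
  (isOmega_XPlus k letter_d_one ofGroup_ne_ofBoundary).extend_eq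

theorem extend_XMinus : extend (phi k) (ofBoundary (XMinus k)) = ofBoundary (XMinus k) := by
  have := (isOmega_XMinus k letter_d_one ofGroup_ne_ofBoundary).extend_eq
  rw [← this, extend_inv_apply, this]

variable {k}

/-- A point starting with `b` and without non-trivial fixed prefix is `b a^j v` with `v` not
starting with `b⁻¹`, as the elements `b a^j b⁻¹` are fixed. So the forward drift `-1` and the
backward drift `1` of `v` are excluded. -/
theorem exists_edge_b (hk : 1 ≤ k) (hx : extend (phi k) x ≠ x)
    (hl : x.letter 0 = some (1, true))
    (hp : ∀ u : F4, u ≠ 1 → phi k u = u → ¬ ∀ i < u.norm, x.letter i = (ofGroup u).letter i) :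
    ∃ v w, figureGraph.Adj v w ∧ LimitClass k (phi k)⁻¹ x v ∧ LimitClass k (phi k) x w := by
  obtain ⟨z, rfl, hz⟩ : ∃ z : Compactification (Fin 4), x = b • z ∧
      z.letter 0 ≠ some (1, false) :=
    ⟨b⁻¹ • x, by simp, letter_zero_inv_singleton_smul_ne hl⟩
  rcases exists_eq_zpow_smul z with ⟨s, rfl⟩ | ⟨j, v, rfl, hA, -⟩
  · refine absurd ?_ hx
    rw [extend_smul, extend_aInf (phi_a k), phi_b, mul_smul, ← zpow_one a, zpow_smul_aInf]
  rw [ne_eq, letter_zero_zpow_smul_iff hA (by decide)] at hz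
  have hv : v.letter 0 ≠ some (1, false) := by
    intro hv
    obtain ⟨h1, h2⟩ := letter_conj_prefix (s := 1) (by decide) (fun hj => hz ⟨hj, hv⟩) hv rfl
    exact hp _ h1 (phi_conj_b k j) h2
  obtain ⟨κ, κ', h1, h2, h3⟩ := exists_hasDrift k hA
  replace h1 := h1.zpow_smul (phi_a k) j
  replace h2 := h2.zpow_smul (phi_inv_apply_a k) j
  have g1 := isOmega_baInf k h1
  have g2 := isOmega_inv_baInf k h2
  rcases h3 with ⟨rfl, rfl⟩ | ⟨-, -, h⟩ | ⟨rfl, rfl, -⟩ | ⟨rfl, rfl, -⟩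
  · exact ⟨.bMinus, .bPlus, ⟨_, .bUp⟩, limitClass_of_isOmega k (g2 (by omega)),
      limitClass_of_isOmega k (g1 (by omega))⟩
  · exact absurd h hv
  · replace g1 := g1 (by omega)
    rw [decide_eq_false (by omega)] at g1
    exact ⟨.bMinus, .bMinus, ⟨_, .loop⟩, limitClass_of_isOmega k (g2 (by omega)),
      limitClass_of_isOmega k g1⟩
  · replace g1 := g1 (by omega)
    replace g2 := g2 (by omega)
    rw [decide_eq_false (by omega)] at g1
    rw [decide_eq_true (by omega)] at g2
    exact ⟨.bPlus, .bMinus, ⟨_, .bDown⟩, limitClass_of_isOmega k g2, limitClass_of_isOmega k g1⟩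

/-- A point starting with `c` and without non-trivial fixed prefix is `c a^j v` with `v` not
starting with `c⁻¹`, as the elements `c a^j c⁻¹` are fixed. If the forward drift of `v` is
`-(k+1)`, the orbit of `v` reaches a point starting with `d⁻¹`, and the orbit of `c a^j v`
converges to a translate of `a^{-∞}` by a fixed element. -/
theorem exists_edge_c (hk : 1 ≤ k) (hx : extend (phi k) x ≠ x)
    (hl : x.letter 0 = some (2, true))
    (hp : ∀ u : F4, u ≠ 1 → phi k u = u → ¬ ∀ i < u.norm, x.letter i = (ofGroup u).letter i) :
    ∃ v w, figureGraph.Adj v w ∧ LimitClass k (phi k)⁻¹ x v ∧ LimitClass k (phi k) x w := by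
  obtain ⟨z, rfl, hz⟩ : ∃ z : Compactification (Fin 4), x = c • z ∧
      z.letter 0 ≠ some (2, false) :=
    ⟨c⁻¹ • x, by simp, letter_zero_inv_singleton_smul_ne hl⟩
  rcases exists_eq_zpow_smul z with ⟨s, rfl⟩ | ⟨j, v, rfl, hA, -⟩
  · refine absurd ?_ hx
    rw [extend_smul, extend_aInf (phi_a k), phi_c, mul_smul, zpow_smul_aInf]
  rw [ne_eq, letter_zero_zpow_smul_iff hA (by decide)] at hz
  have hv : v.letter 0 ≠ some (2, false) := by
    intro hv
    obtain ⟨h1, h2⟩ := letter_conj_prefix (s := 2) (by decide) (fun hj => hz ⟨hj, hv⟩) hv rfl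
    exact hp _ h1 (phi_conj_c k j) h2
  obtain ⟨κ, κ', h1, h2, h3⟩ := exists_hasDrift k hA
  replace h1 := h1.zpow_smul (phi_a k) j
  replace h2 := h2.zpow_smul (phi_inv_apply_a k) j
  have g1 := isOmega_caInf k h1
  have g2 := isOmega_inv_caInf k h2
  rcases h3 with ⟨rfl, rfl⟩ | ⟨rfl, rfl, h⟩ | ⟨rfl, rfl, h⟩ | ⟨-, -, h⟩
  · replace g1 := g1 (by omega)
    replace g2 := g2 (by omega)
    rw [decide_eq_true (by omega)] at g1
    rw [decide_eq_false (by omega)] at g2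
    exact ⟨.cMinus, .cPlus, ⟨_, .cEdge⟩, limitClass_of_isOmega k g2, limitClass_of_isOmega k g1⟩
  · replace g1 := g1 (by omega)
    replace g2 := g2 (by omega)
    rw [decide_eq_true (by omega)] at g1
    rw [decide_eq_false (by omega)] at g2
    exact ⟨.cMinus, .cPlus, ⟨_, .cEdge⟩, limitClass_of_isOmega k g2, limitClass_of_isOmega k g1⟩
  · replace g2 := g2 (by omega)
    rw [decide_eq_false (by omega)] at g2
    refine ⟨.cMinus, .aMinus, ⟨_, .caEdge⟩, limitClass_of_isOmega k g2, ?_⟩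
    obtain ⟨r, hr⟩ := h.resolve_left hv
    -- after `r + 1` steps the orbit is `c a^i c⁻¹ u` with `u` starting with `d⁻¹`
    refine LimitClass.of_pow (r + 1) ?_
    have h4 : extend (phi k ^ (r + 1)) (c • a ^ j • v) =
        (c * a ^ (((k : ℤ) + 1) * (r + 1 : ℕ) + j) * c⁻¹) •
          c • extend (phi k) (extend (phi k ^ r) v) := by
      rw [extend_smul, extend_smul, map_zpow, pow_apply_eq_self (phi_a k), phi_pow_apply_c,
        ← extend_mul_apply, ← pow_succ', smul_smul, smul_smul, inv_mul_cancel_right, mul_assoc,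
        ← zpow_add]
    rw [h4]
    exact LimitClass.smul (phi_conj_c k _) (phi_conj_c k _)
      (limitClass_of_isOmega k (isOmega_of_dInv k (phi_step_dInv k hr)))
  · exact absurd h hv

theorem exists_edge_cInv (hl : x.letter 0 = some (2, false)) :
    ∃ v w, figureGraph.Adj v w ∧ LimitClass k (phi k)⁻¹ x v ∧ LimitClass k (phi k) x w := by
  rcases phi_inv_orbit_cInv k hl with h | ⟨r, v, h1, h2⟩
  · have := (hasDrift_of_orbit (by simp) h).isOmega_aInf (phi_inv_apply_a k) (by omega)
    rw [decide_eq_true (by omega)] at this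
    exact ⟨.aPlus, .aMinus, ⟨_, .aEdge⟩, limitClass_of_isOmega k this,
      limitClass_of_isOmega k (isOmega_of_cInv k hl)⟩
  · refine ⟨.cMinus, .aMinus, ⟨_, .caEdge⟩, LimitClass.of_pow (r + 1) ?_,
      limitClass_of_isOmega k (isOmega_of_cInv k hl)⟩
    rw [h1]
    exact LimitClass.smul (by rw [map_zpow, phi_inv_apply_a]) (by rw [map_zpow, phi_a])
      (limitClass_of_isOmega k (isOmega_inv_of_dInv k h2))

/-- Every point which is not fixed flows along an edge of the figure, up to isoglossy. -/
theorem exists_edge (hk : 1 ≤ k) (hx : extend (phi k) x ≠ x) :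
    ∃ v w, figureGraph.Adj v w ∧ LimitClass k (phi k)⁻¹ x v ∧ LimitClass k (phi k) x w := by
  obtain ⟨g, y, rfl, hg, hp⟩ := exists_maximal_fixed_prefix hx
  have hy : extend (phi k) y ≠ y := fun h => hx (by rw [extend_smul, hg, h])
  suffices ∃ v w, figureGraph.Adj v w ∧ LimitClass k (phi k)⁻¹ y v ∧
      LimitClass k (phi k) y w by
    obtain ⟨v, w, h1, h2, h3⟩ := this
    exact ⟨v, w, h1, h2.smul (phi_inv_eq_self hg) hg, h3.smul hg hg⟩
  cases hl : y.letter 0 with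
  | none =>
    refine absurd ?_ hy
    rw [eq_one_of_letter_zero_eq_none hl, extend_ofGroup, map_one]
  | some s =>
    obtain ⟨i, e⟩ := s
    have hi : i = 0 ∨ i = 1 ∨ i = 2 ∨ i = 3 := by clear * -; revert i; decide
    rcases hi with rfl | rfl | rfl | rfl
    · obtain ⟨j, hj⟩ := mk_zero_eq_zpow e
      refine absurd ?_ (hp (FreeGroup.mk [(0, e)]) ?_ (by rw [hj, map_zpow, phi_a]))
      · intro q hq
        obtain rfl : q = 0 := by
          have : (FreeGroup.mk [((0 : Fin 4), e)]).norm = 1 := rfl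
          omega
        rw [hl]
        rfl
      · intro h
        have := congrArg FreeGroup.norm h
        simp [FreeGroup.norm] at this
    · cases e with
      | true => exact exists_edge_b hk hy hl hp
      | false => exact ⟨.aPlus, .aMinus, ⟨_, .aEdge⟩,
          limitClass_of_isOmega k (isOmega_inv_of_bInv k hl),
          limitClass_of_isOmega k (isOmega_of_bInv k hl)⟩
    · cases e with
      | true => exact exists_edge_c hk hy hl hp
      | false => exact exists_edge_cInv hl
    · cases e with
      | true =>
        refine ⟨.xMinus, .xPlus, ⟨_, .dEdge⟩, limitClass_of_isOmega k (isOmega_XMinus k hl ?_),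
          limitClass_of_isOmega k (isOmega_XPlus k hl ?_)⟩
        · rintro rfl; exact hy (extend_XPlus k)
        · rintro rfl; exact hy (extend_XMinus k)
      | false => exact ⟨.cMinus, .aMinus, ⟨_, .caEdge⟩,
          limitClass_of_isOmega k (isOmega_inv_of_dInv k hl),
          limitClass_of_isOmega k (isOmega_of_dInv k hl)⟩

/-- A periodic orbit converges only if it is constant, and all orbits converge. -/
theorem phi_isRotationless (hk : 1 ≤ k) : IsRotationless (phi k) := by
  refine Set.Subset.antisymm (fun x hx => ?_) fun x hx => ?_
  · exact Function.mk_mem_periodicPts one_pos (Function.IsFixedPt.isPeriodicPt hx 1)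
  · obtain ⟨p, hp, hper⟩ := hx
    by_contra hne
    obtain ⟨-, w, -, -, g, -, hω⟩ := exists_edge hk hne
    have hsub : Tendsto (fun n : ℕ => p * n) atTop atTop :=
      tendsto_id.const_mul_atTop' hp
    have h1 : Tendsto (fun _ : ℕ => x) atTop (𝓝 (g • ofBoundary (w.point k))) :=
      (hω.comp hsub).congr fun n => hper.mul_const n
    have h2 : x = g • ofBoundary (w.point k) := tendsto_unique tendsto_const_nhds h1
    exact hne (by
      show extend (phi k) x = x
      rw [h2]; exact hω.extend_eq)

/-- The points reached from the label `g` of an edge by appending `x` without cancellation flow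
along that edge. -/
theorem isOmega_of_figureEdge (hk : 1 ≤ k) {v w : FigureVertex} {g : F4} (h : FigureEdge v g w)
    (hx : x.letter 0 = none ∨ x.letter 0 = some (1, true) ∨ x.letter 0 = some (3, true))
    (hg : x.letter 0 ≠ (ofGroup g⁻¹).letter 0) :
    IsOmega (phi k)⁻¹ (g • x) (ofBoundary (v.point k)) ∧
      IsOmega (phi k) (g • x) (ofBoundary (w.point k)) := by
  have hx' : x.letter 0 = none ∨ x.letter 0 = some (1, true) ∨ x.letter 0 = some (2, true) ∨
      x.letter 0 = some (3, true) := by tauto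
  have hneg : ∀ i e, x.letter 0 ≠ some (i, e) ∨ (e = true ∧ i ≠ 0 ∧ i ≠ 2) := by
    intro i e
    rcases hx with h | h | h <;> rw [h] <;> revert i e <;> decide
  cases h with
  | loop =>
    rw [mul_smul]
    have h1 : (d⁻¹ • x).letter 0 = some (3, false) := letter_zero_d_inv_smul hg
    have g1 := isOmega_baInf k (phi_hasDrift_dInv k h1) (by omega)
    rw [decide_eq_false (by omega)] at g1
    exact ⟨isOmega_inv_baInf k (phi_inv_hasDrift_dInv k h1) (by omega), g1⟩
  | bUp =>
    exact ⟨isOmega_inv_baInf k (phi_inv_hasDrift_zero k hx' rfl) (by omega),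
      isOmega_baInf k (phi_hasDrift_zero k hx rfl) (by omega)⟩
  | bDown =>
    rw [mul_smul]
    have h1 : (c⁻¹ • x).letter 0 = some (2, false) := letter_zero_c_inv_smul hg
    have g1 := isOmega_baInf k (phi_hasDrift_cInv k h1) (by omega)
    rw [decide_eq_false (by omega)] at g1
    have h2 : HasDrift (phi k)⁻¹ (c⁻¹ • x) (k + 1) := by
      refine hasDrift_of_orbit (s := some (2, false)) (by simp) fun n =>
        ⟨c⁻¹ • extend ((phi k)⁻¹ ^ n) x, ?_, letter_zero_c_inv_smul ?_⟩
      · rw [extend_smul, map_inv, phi_inv_pow_apply_c, mul_inv_rev, mul_smul, ← zpow_neg]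
        congr 2
        ring
      · rw [phi_inv_orbit_zero k hx' rfl n]
        exact hg
    have g2 := isOmega_inv_baInf k h2 (by omega)
    rw [decide_eq_true (by omega)] at g2
    exact ⟨g2, g1⟩
  | dEdge =>
    have h1 : (d • x).letter 0 = some (3, true) :=
      letter_zero_d_smul ((hneg 3 false).resolve_right (by decide))
    have h2 : (d • x).letter 1 = x.letter 0 :=
      letter_singleton_smul (s := (3, true)) ((hneg 3 false).resolve_right (by decide)) 1
    refine ⟨isOmega_XMinus k h1 fun h => ?_, isOmega_XPlus k h1 fun h => ?_⟩
    · rw [h, letter_ofBoundary, ← getElem?_wordPlus k 1 (by simp [wordPlus])] at h2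
      exact (hneg 2 true).resolve_right (by decide) h2.symm
    · rw [h, letter_ofBoundary, ← getElem?_wordMinus k 1 (by simp [wordMinus])] at h2
      refine (hneg 0 true).resolve_right (by decide) (h2.symm.trans ?_)
      simp [wordMinus, List.replicate_succ]
  | aEdge =>
    have h1 : (b⁻¹ • x).letter 0 = some (1, false) := letter_zero_b_inv_smul hg
    exact ⟨isOmega_inv_of_bInv k h1, isOmega_of_bInv k h1⟩
  | caEdge =>
    have h1 : (d⁻¹ • x).letter 0 = some (3, false) := letter_zero_d_inv_smul hg
    exact ⟨isOmega_inv_of_dInv k h1, isOmega_of_dInv k h1⟩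
  | cEdge =>
    have g1 := isOmega_caInf k (phi_hasDrift_zero k hx rfl) (by omega)
    have g2 := isOmega_inv_caInf k (phi_inv_hasDrift_zero k hx' rfl) (by omega)
    rw [decide_eq_true (by omega)] at g1
    rw [decide_eq_false (by omega)] at g2
    exact ⟨g2, g1⟩

end Limits

/-! ### The eight isoglossy classes -/

/-- The letter `s` occurs infinitely often in `X`. -/
def Recurs (X : Boundary (Fin 4)) (s : Fin 4 × Bool) : Prop := ∃ᶠ i in atTop, X.seq i = s

theorem recurs_shift {X : Boundary (Fin 4)} {s : Fin 4 × Bool} (n : ℕ) :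
    (∃ᶠ i in atTop, X.seq (n + i) = s) ↔ Recurs X s := by
  unfold Recurs
  conv_rhs => rw [← map_add_atTop_eq_nat n, frequently_map]
  simp only [add_comm]

theorem IsTranslate.recurs_iff {g : F4} {X Y : Boundary (Fin 4)} (h : IsTranslate g Y X)
    (s : Fin 4 × Bool) : Recurs X s ↔ Recurs Y s := by
  obtain ⟨m, n, -, h⟩ := h
  rw [← recurs_shift n, ← recurs_shift (X := Y) m]
  simp only [h]

theorem recurs_aInf (e : Bool) (s : Fin 4 × Bool) : Recurs (aInf e) s ↔ (0, e) = s :=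
  ⟨fun h => h.exists.choose_spec, fun h => (Eventually.of_forall fun _ => h).frequently⟩

section Separation
variable (k : ℕ)

theorem recurs_XPlus_c : Recurs (XPlus k) (2, true) := by
  refine frequently_atTop.2 fun n => ⟨(wordPlus k n).length, ?_, ?_⟩
  · rw [length_wordPlus]
    have := le_sum_range_of_pos (f := fun i => 1 + i * (k + 1)) (fun i => by omega) n
    omega
  · have := getElem?_wordPlus k (n + 1) (i := (wordPlus k n).length) (by simp [wordPlus_succ])
    rw [wordPlus_succ, List.getElem?_append_right le_rfl, Nat.sub_self] at this
    simpa using this.symm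

theorem recurs_XMinus_cInv : Recurs (XMinus k) (2, false) := by
  refine frequently_atTop.2 fun n =>
    ⟨(wordMinus k n).length + (n + 1) * (k + 1), ?_, ?_⟩
  · rw [length_wordMinus]
    have := le_sum_range_of_pos (f := fun i => (i + 1) * (k + 1) + 1) (fun i => by omega) n
    omega
  · have := getElem?_wordMinus k (n + 1) (i := (wordMinus k n).length + (n + 1) * (k + 1))
      (by simp [wordMinus_succ])
    rw [wordMinus_succ, List.getElem?_append_right (Nat.le_add_right _ _),
      Nat.add_sub_cancel_left, List.getElem?_append_right (by simp)] at this
    simpa using this.symm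

theorem XPlus_seq_mem {i : ℕ} (hi : i ≠ 0) :
    (XPlus k).seq i = (2, true) ∨ (XPlus k).seq i = (0, true) := by
  simp only [XPlus]
  rw [if_neg hi]
  split_ifs <;> simp

theorem XMinus_seq_mem {i : ℕ} (hi : i ≠ 0) :
    (XMinus k).seq i = (2, false) ∨ (XMinus k).seq i = (0, true) := by
  simp only [XMinus]
  rw [if_neg hi]
  split_ifs <;> simp

theorem recurs_XPlus {s : Fin 4 × Bool} (h : Recurs (XPlus k) s) :
    s = (2, true) ∨ s = (0, true) := by
  obtain ⟨i, rfl, hi⟩ := (h.and_eventually (eventually_ne_atTop 0)).exists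
  exact XPlus_seq_mem k hi

theorem recurs_XMinus {s : Fin 4 × Bool} (h : Recurs (XMinus k) s) :
    s = (2, false) ∨ s = (0, true) := by
  obtain ⟨i, rfl, hi⟩ := (h.and_eventually (eventually_ne_atTop 0)).exists
  exact XMinus_seq_mem k hi

theorem zpow_a_eq_one {n : ℤ} (h : a ^ n = 1) : n = 0 := by
  by_contra hn
  have := letter_zero_zpow_smul nonA_one hn
  rw [h, one_smul] at this
  simp at this

/-- The stabilizer of `a^{±∞}` consists of the powers of `a`. -/
theorem exists_eq_zpow_of_smul_aInf {h : F4} {e : Bool}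
    (hh : h • ofBoundary (aInf e) = ofBoundary (aInf e)) : ∃ i : ℤ, h = a ^ i := by
  obtain ⟨m, n, h1, -⟩ := isTranslate_iff_smul.2 hh
  have hz : ∀ N, ∃ j : ℤ, (ofBoundary (aInf e)).take N = a ^ j :=
    fun N => exists_take_eq_zpow fun i _ => ⟨e, rfl⟩
  obtain ⟨i, hi⟩ := hz n
  obtain ⟨j, hj⟩ := hz m
  rw [hi, hj] at h1
  exact ⟨i - j, by rw [zpow_sub, h1, mul_inv_cancel_right]⟩

/-- The points `t a^{±∞}` and `t' a^{±∞}` are separated by the exponents with which `φ` twists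
`t` and `t'`. -/
theorem twist_eq_of_isogloss {φ : MulAut F4} (ha : φ a = a) {t t' g : F4} {l l' : ℤ} {e : Bool}
    (ht : φ t = t * a ^ l) (ht' : φ t' = t' * a ^ l') (hg : φ g = g)
    (h : g • t' • ofBoundary (aInf e) = t • ofBoundary (aInf e)) : l = l' := by
  obtain ⟨i, hi⟩ := exists_eq_zpow_of_smul_aInf (h := t⁻¹ * g * t') (e := e) (by
    rw [mul_smul, mul_smul, h, inv_smul_smul])
  have h1 := congrArg φ hi
  rw [map_mul, map_mul, map_inv, ht, ht', hg, map_zpow, ha, mul_inv_rev] at h1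
  have h2 : a ^ (-l) * (t⁻¹ * g * t') * a ^ l' = a ^ i := by
    rw [← h1, zpow_neg]
    group
  rw [hi, ← zpow_add, ← zpow_add] at h2
  have := zpow_a_eq_one (n := -l + i + l' - i) (by rw [zpow_sub, h2, mul_inv_cancel])
  omega

variable {k}

theorem isoglossyClass_eq_iff {φ : MulAut F4} {X Y : Boundary (Fin 4)} :
    isoglossyClass φ X = isoglossyClass φ Y ↔
      ∃ g, φ g = g ∧ g • ofBoundary Y = ofBoundary X := by
  unfold isoglossyClass
  rw [Quotient.eq]
  simp only [← isTranslate_iff_smul]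
  rfl

/-- The vertices named by an eventually constant word, which is `v.stem a^{±∞}`. -/
def FigureVertex.IsRay (v : FigureVertex) : Prop := v ≠ .xMinus ∧ v ≠ .xPlus

/-- The first factor of the word `t a^{±∞}` naming a vertex. -/
def FigureVertex.stem : FigureVertex → F4
  | bMinus | bPlus => b
  | cMinus | cPlus => c
  | _ => 1

/-- The exponent `l` such that `φ_k(t) = t a^l` for the stem `t` of the vertex. -/
def FigureVertex.twist (k : ℕ) : FigureVertex → ℤ
  | bMinus | bPlus => 1
  | cMinus | cPlus => k + 1
  | _ => 0

/-- The sign of the infinite power of `a` in the word `t a^{±∞}` naming a vertex. -/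
def FigureVertex.sign : FigureVertex → Bool
  | bPlus | cPlus | aPlus => true
  | _ => false

theorem FigureVertex.IsRay.point_eq {v : FigureVertex} (hv : v.IsRay) :
    ofBoundary (v.point k) = v.stem • ofBoundary (aInf v.sign) := by
  cases v with
  | xMinus => exact absurd rfl hv.1
  | xPlus => exact absurd rfl hv.2
  | bMinus => exact (b_smul_aInf _).symm
  | bPlus => exact (b_smul_aInf _).symm
  | cMinus => exact (c_smul_aInf _).symm
  | cPlus => exact (c_smul_aInf _).symm
  | aMinus => exact (one_smul _ _).symm
  | aPlus => exact (one_smul _ _).symm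

theorem phi_stem (v : FigureVertex) : phi k v.stem = v.stem * a ^ v.twist k := by
  cases v <;> simp [FigureVertex.stem, FigureVertex.twist]

theorem FigureVertex.IsRay.recurs_iff {v : FigureVertex} (hv : v.IsRay) (s : Fin 4 × Bool) :
    Recurs (v.point k) s ↔ (0, v.sign) = s := by
  rw [(isTranslate_iff_smul.2 (hv.point_eq (k := k)).symm).recurs_iff, recurs_aInf]

/-- The class of `X_k^+` is singled out by the letter `c`. -/
theorem recurs_point_c_iff {v : FigureVertex} : Recurs (v.point k) (2, true) ↔ v = .xPlus := by
  by_cases hv : v.IsRay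
  · rw [hv.recurs_iff]
    exact ⟨by simp, fun h => absurd h hv.2⟩
  · obtain rfl | rfl : v = .xMinus ∨ v = .xPlus := by
      unfold FigureVertex.IsRay at hv; tauto
    · exact ⟨fun h => by simpa using recurs_XMinus k h, by simp⟩
    · exact ⟨fun _ => rfl, fun _ => recurs_XPlus_c k⟩

/-- The class of `X_k^-` is singled out by the letter `c⁻¹`. -/
theorem recurs_point_cInv_iff {v : FigureVertex} :
    Recurs (v.point k) (2, false) ↔ v = .xMinus := by
  by_cases hv : v.IsRay
  · rw [hv.recurs_iff]
    exact ⟨by simp, fun h => absurd h hv.1⟩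
  · obtain rfl | rfl : v = .xMinus ∨ v = .xPlus := by
      unfold FigureVertex.IsRay at hv; tauto
    · exact ⟨fun _ => rfl, fun _ => recurs_XMinus_cInv k⟩
    · exact ⟨fun h => by simpa using recurs_XPlus k h, by simp⟩

/-- The letters `b^{±1}`, `d^{±1}` recur in none of the eight points. -/
theorem not_recurs_point {v : FigureVertex} {i : Fin 4} {e : Bool} (hi : i ≠ 0) (hi' : i ≠ 2) :
    ¬ Recurs (v.point k) (i, e) := by
  intro h
  by_cases hv : v.IsRay
  · rw [hv.recurs_iff, Prod.mk.injEq] at h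
    exact hi h.1.symm
  · obtain rfl | rfl : v = .xMinus ∨ v = .xPlus := by
      unfold FigureVertex.IsRay at hv; tauto
    · have := recurs_XMinus k h
      simp_all
    · have := recurs_XPlus k h
      simp_all

/-- The eight points of the figure are pairwise not isogloss. -/
theorem point_injective (hk : 1 ≤ k) {v w : FigureVertex}
    (h : isoglossyClass (phi k) (v.point k) = isoglossyClass (phi k) (w.point k)) : v = w := by
  obtain ⟨g, hg, hgw⟩ := isoglossyClass_eq_iff.1 h
  have hr := (isTranslate_iff_smul.2 hgw).recurs_iff
  have h1 : v = .xPlus ↔ w = .xPlus := by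
    rw [← recurs_point_c_iff (k := k), hr, recurs_point_c_iff]
  have h2 : v = .xMinus ↔ w = .xMinus := by
    rw [← recurs_point_cInv_iff (k := k), hr, recurs_point_cInv_iff]
  by_cases hv : v.IsRay
  · have hw : w.IsRay := ⟨fun h => hv.1 (h2.2 h), fun h => hv.2 (h1.2 h)⟩
    have hs : v.sign = w.sign := by
      have := (hr (0, v.sign)).1 (hv.recurs_iff _ |>.2 rfl)
      rw [hw.recurs_iff, Prod.mk.injEq] at this
      exact this.2.symm
    rw [hv.point_eq, hw.point_eq, hs] at hgw
    have ht := twist_eq_of_isogloss (phi_a k) (phi_stem v) (phi_stem w) hg hgw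
    cases v <;> cases w <;>
      simp_all [FigureVertex.IsRay, FigureVertex.sign, FigureVertex.twist] <;> omega
  · obtain rfl | rfl : v = .xMinus ∨ v = .xPlus := by
      unfold FigureVertex.IsRay at hv; tauto
    · exact (h2.1 rfl).symm
    · exact (h1.1 rfl).symm

/-! ### The dynamics graph -/

theorem isOmega_const {ψ : MulAut F4} {x y : Compactification (Fin 4)} (hx : extend ψ x = x)
    (h : IsOmega ψ x y) : x = y :=
  tendsto_unique (tendsto_const_nhds.congr fun n => (Function.iterate_fixed hx n).symm) h

theorem isOmegaLimitPoint_of_isOmega {ψ : MulAut F4} {X : Boundary (Fin 4)} {g : F4}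
    (h : IsOmega ψ (ofGroup g) (ofBoundary X)) : IsOmegaLimitPoint ψ X :=
  ⟨ofGroup g, fun hfix => ofGroup_ne_ofBoundary (isOmega_const hfix h), h⟩

theorem isOmega_label (hk : 1 ≤ k) {v w : FigureVertex} {g : F4} (h : FigureEdge v g w) :
    IsOmega (phi k)⁻¹ (ofGroup g) (ofBoundary (v.point k)) ∧
      IsOmega (phi k) (ofGroup g) (ofBoundary (w.point k)) := by
  have := isOmega_of_figureEdge (x := ofGroup 1) hk h (Or.inl rfl) (by cases h <;> decide)
  simpa using this

/-- Each of the eight points is an end of an edge, so it is the limit of the orbit of a label. -/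
theorem isLimitPoint_point (hk : 1 ≤ k) (v : FigureVertex) :
    IsLimitPoint (phi k) (v.point k) := by
  have hs : ∀ {v g w}, FigureEdge v g w → IsLimitPoint (phi k) (v.point k) :=
    fun h => Or.inr (isOmegaLimitPoint_of_isOmega (isOmega_label hk h).1)
  have ht : ∀ {v g w}, FigureEdge v g w → IsLimitPoint (phi k) (w.point k) :=
    fun h => Or.inl (isOmegaLimitPoint_of_isOmega (isOmega_label hk h).2)
  cases v with
  | bMinus => exact hs .bUp
  | bPlus => exact ht .bUp
  | xMinus => exact hs .dEdge
  | xPlus => exact ht .dEdge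
  | aPlus => exact hs .aEdge
  | aMinus => exact ht .aEdge
  | cMinus => exact hs .cEdge
  | cPlus => exact ht .cEdge

theorem LimitClass.class_eq {ψ : MulAut F4} {x : Compactification (Fin 4)} {v : FigureVertex}
    {X : Boundary (Fin 4)} (h : LimitClass k ψ x v) (hX : IsOmega ψ x (ofBoundary X)) :
    isoglossyClass (phi k) X = isoglossyClass (phi k) (v.point k) := by
  obtain ⟨g, hg, h⟩ := h
  exact isoglossyClass_eq_iff.2 ⟨g, hg, tendsto_unique h hX⟩

theorem exists_class_eq (hk : 1 ≤ k) {X : Boundary (Fin 4)} (hX : IsLimitPoint (phi k) X) :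
    ∃ v : FigureVertex, isoglossyClass (phi k) (v.point k) = isoglossyClass (phi k) X := by
  rcases hX with ⟨x, hx, hω⟩ | ⟨x, hx, hω⟩
  · obtain ⟨-, w, -, -, h⟩ := exists_edge hk hx
    exact ⟨w, (h.class_eq hω).symm⟩
  · have hx' : extend (phi k) x ≠ x := fun h => hx (by
      have := inv_extend_apply (phi k) x
      rwa [h] at this)
    obtain ⟨v, -, -, h, -⟩ := exists_edge hk hx'
    exact ⟨v, (h.class_eq hω).symm⟩

/-- The vertices of the figure are the vertices of the dynamics graph. -/
noncomputable def vertexEquiv (hk : 1 ≤ k) : FigureVertex ≃ DynamicsVertex (phi k) :=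
  Equiv.ofBijective
    (fun v => ⟨isoglossyClass (phi k) (v.point k), v.point k, isLimitPoint_point hk v, rfl⟩)
    ⟨fun _ _ h => point_injective hk (congrArg Subtype.val h), fun ⟨q, X, hX, hq⟩ => by
      obtain ⟨v, hv⟩ := exists_class_eq hk hX
      exact ⟨v, Subtype.ext (hv.trans hq)⟩⟩

theorem vertexEquiv_val (hk : 1 ≤ k) (v : FigureVertex) :
    (vertexEquiv hk v).1 = isoglossyClass (phi k) (v.point k) := rfl

/-- The infinite positive power of a generator. -/
def powInf (i : Fin 4) : Boundary (Fin 4) where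
  seq _ := (i, true)
  reduced _ := by simp

theorem recurs_powInf (i : Fin 4) : Recurs (powInf i) (i, true) :=
  (Eventually.of_forall fun _ => rfl).frequently

/-- Every edge of the figure is realized by a boundary point, obtained by prolonging its label
by `b^∞` or `d^∞`. -/
theorem exists_boundary_of_figureEdge (hk : 1 ≤ k) {v w : FigureVertex} {g : F4}
    (h : FigureEdge v g w) : ∃ X : Boundary (Fin 4),
      (∀ u : FigureVertex, X ≠ u.point k) ∧
      IsOmega (phi k)⁻¹ (ofBoundary X) (ofBoundary (v.point k)) ∧
      IsOmega (phi k) (ofBoundary X) (ofBoundary (w.point k)) := by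
  obtain ⟨i, hi, hg⟩ : ∃ i : Fin 4, (i = 1 ∨ i = 3) ∧
      some (i, true) ≠ (ofGroup g⁻¹).letter 0 := by
    cases h with
    | aEdge => exact ⟨3, by decide, by decide⟩
    | _ => exact ⟨1, by decide, by decide⟩
  obtain ⟨X, hX, hX'⟩ := smul_ofBoundary_exists g (powInf i)
  refine ⟨X, ?_, ?_⟩
  · rintro u rfl
    have := (hX'.recurs_iff (i, true)).2 (recurs_powInf i)
    rcases hi with rfl | rfl <;> exact not_recurs_point (by decide) (by decide) this
  · rw [← hX]
    refine isOmega_of_figureEdge hk h ?_ hg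
    rcases hi with rfl | rfl
    · exact Or.inr (Or.inl rfl)
    · exact Or.inr (Or.inr rfl)

/-- The edges of the dynamics graph are those of the figure. -/
theorem dynamicsGraph_adj_iff (hk : 1 ≤ k) (v w : FigureVertex) :
    (dynamicsGraph (phi k)).Adj (vertexEquiv hk v) (vertexEquiv hk w) ↔
      figureGraph.Adj v w := by
  constructor
  · rintro ⟨X₁, X₂, X, h1, h2, hX, hω1, hω2⟩
    obtain ⟨v', w', hadj, hv, hw⟩ := exists_edge hk hX
    obtain rfl : v = v' := point_injective hk (h1.symm.trans (hv.class_eq hω1))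
    obtain rfl : w = w' := point_injective hk (h2.symm.trans (hw.class_eq hω2))
    exact hadj
  · rintro ⟨g, h⟩
    obtain ⟨X, hX, h1, h2⟩ := exists_boundary_of_figureEdge hk h
    refine ⟨v.point k, w.point k, X, rfl, rfl, fun hfix => hX w ?_, h1, h2⟩
    have := isOmega_const hfix h2
    rwa [ofBoundary.injEq] at this

theorem convergesBothWays_of_isOmega {ψ : MulAut F4} {x y : Compactification (Fin 4)}
    (h1 : IsOmega ψ⁻¹ x y) (h2 : IsOmega ψ x y) : ConvergesBothWays ψ x y := by
  rw [isOmega_iff] at h1 h2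
  have h3 : Tendsto (fun n : ℤ => (extend ψ ^ n) x) atTop (𝓝 y) := by
    rw [← Nat.map_cast_int_atTop, tendsto_map'_iff]
    refine h2.congr fun n => ?_
    simp only [Function.comp_apply, zpow_natCast, map_pow]
  have h4 : Tendsto (fun n : ℤ => (extend ψ ^ (-n)) x) atTop (𝓝 y) := by
    rw [← Nat.map_cast_int_atTop, tendsto_map'_iff]
    refine h1.congr fun n => ?_
    simp only [Function.comp_apply, zpow_neg, zpow_natCast, map_pow, map_inv, inv_pow]
  refine ⟨h3, (h4.comp tendsto_neg_atBot_atTop).congr fun n => ?_⟩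
  simp only [Function.comp_apply, neg_neg]

theorem isParabolicFixedPoint_baInf (hk : 1 ≤ k) :
    IsParabolicFixedPoint (phi k) (baInf false) := by
  obtain ⟨X, hX, h1, h2⟩ := exists_boundary_of_figureEdge hk FigureEdge.loop
  exact ⟨X, (hX .bMinus).symm, convergesBothWays_of_isOmega h1 h2⟩

/-! ### Connected components -/

/-- The connected component of a vertex of the figure. -/
def FigureVertex.component : FigureVertex → Fin 3
  | bMinus | bPlus => 0
  | xMinus | xPlus => 1
  | aPlus | aMinus | cMinus | cPlus => 2

theorem figureGraph_component_eq {v w : FigureVertex}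
    (h : figureGraph.toSimpleGraphInclusive.Reachable v w) : v.component = w.component := by
  obtain ⟨p⟩ := h
  induction p with
  | nil => rfl
  | cons hadj _ ih =>
    rw [← ih]
    obtain ⟨-, ⟨g, h⟩ | ⟨g, h⟩⟩ := hadj <;> cases h <;> rfl

theorem card_figureGraph_components :
    Nat.card figureGraph.toSimpleGraphInclusive.ConnectedComponent = 3 := by
  have hadj : ∀ {v g w}, FigureEdge v g w → v ≠ w →
      figureGraph.toSimpleGraphInclusive.Reachable v w := fun h hne =>
    SimpleGraph.Adj.reachable ⟨hne, Or.inl ⟨_, h⟩⟩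
  have hreach : ∀ v w : FigureVertex, v.component = w.component →
      figureGraph.toSimpleGraphInclusive.Reachable v w := by
    have h1 := hadj .bUp (by simp)
    have h2 := hadj .dEdge (by simp)
    have h3 := hadj .aEdge (by simp)
    have h4 := hadj .caEdge (by simp)
    have h5 := hadj .cEdge (by simp)
    -- every vertex is joined to a chosen one in its component
    have hbase : ∀ v : FigureVertex, figureGraph.toSimpleGraphInclusive.Reachable v
        (match v.component with
          | 0 => FigureVertex.bMinus
          | 1 => FigureVertex.xMinus
          | 2 => FigureVertex.cMinus) := by
      intro v
      cases v with
      | bMinus => exact .refl _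
      | bPlus => exact h1.symm
      | xMinus => exact .refl _
      | xPlus => exact h2.symm
      | aPlus => exact h3.trans h4.symm
      | aMinus => exact h4.symm
      | cMinus => exact .refl _
      | cPlus => exact h5.symm
    intro v w hvw
    have := hbase v
    rw [hvw] at this
    exact this.trans (hbase w).symm
  let f : figureGraph.toSimpleGraphInclusive.ConnectedComponent → Fin 3 :=
    Quot.lift FigureVertex.component fun _ _ h => figureGraph_component_eq h
  have hf : Function.Bijective f := by
    constructor
    · intro x y
      induction x using SimpleGraph.ConnectedComponent.ind
      induction y using SimpleGraph.ConnectedComponent.ind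
      exact fun h => SimpleGraph.ConnectedComponent.sound (hreach _ _ h)
    · intro i
      fin_cases i
      · exact ⟨SimpleGraph.connectedComponentMk _ FigureVertex.bMinus, rfl⟩
      · exact ⟨SimpleGraph.connectedComponentMk _ FigureVertex.xMinus, rfl⟩
      · exact ⟨SimpleGraph.connectedComponentMk _ FigureVertex.cMinus, rfl⟩
  rw [Nat.card_eq_of_bijective f hf, Nat.card_eq_fintype_card, Fintype.card_fin]

theorem card_dynamicsGraph_components (hk : 1 ≤ k) :
    Nat.card (dynamicsGraph (phi k)).toSimpleGraphInclusive.ConnectedComponent = 3 := by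
  have e : figureGraph.toSimpleGraphInclusive ≃g
      (dynamicsGraph (phi k)).toSimpleGraphInclusive :=
    { toEquiv := vertexEquiv hk
      map_rel_iff' := by
        intro v w
        simp only [Digraph.toSimpleGraphInclusive, SimpleGraph.fromRel_adj,
          dynamicsGraph_adj_iff hk, ne_eq, EmbeddingLike.apply_eq_iff_eq] }
  rw [← Nat.card_congr e.connectedComponentEquiv, card_figureGraph_components]

end Separation

/-! ### Conjugacy of powers -/

/-- The exponent sum of the generator `i`. -/
def expSum (i : Fin 4) : F4 →* Multiplicative ℤ :=
  FreeGroup.lift fun j => Multiplicative.ofAdd (if i = j then 1 else 0)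

/-- The matrix of the action of an automorphism on the abelianization `ℤ⁴`. -/
def abMatrix (φ : MulAut F4) : Matrix (Fin 4) (Fin 4) ℤ :=
  Matrix.of fun i j => (expSum i (φ (FreeGroup.of j))).toAdd

/-- The exponent sums of `φ(g)` are obtained from those of `g` by the matrix of `φ`. -/
theorem expSum_apply (φ : MulAut F4) (i : Fin 4) (g : F4) :
    (expSum i (φ g)).toAdd = ∑ l, abMatrix φ i l * (expSum l g).toAdd := by
  have h : (expSum i).comp φ.toMonoidHom =
      ∏ l, (expSum l) ^ (abMatrix φ i l) := by
    refine FreeGroup.ext_hom _ _ fun j => ?_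
    apply Multiplicative.toAdd.injective
    simp [abMatrix, expSum, toAdd_prod]
  have := congrArg Multiplicative.toAdd (DFunLike.congr_fun h g)
  simpa [MonoidHom.finsetProd_apply, toAdd_prod] using this

theorem abMatrix_mul (φ ψ : MulAut F4) : abMatrix (φ * ψ) = abMatrix φ * abMatrix ψ := by
  ext i j
  rw [Matrix.mul_apply]
  exact expSum_apply φ i (ψ (FreeGroup.of j))

theorem abMatrix_one : abMatrix 1 = 1 := by
  ext i j
  simp [abMatrix, expSum, Matrix.one_apply]

theorem abMatrix_phi (k : ℕ) :
    abMatrix (phi k) = !![1, 1, (k : ℤ) + 1, 0; 0, 1, 0, 0; 0, 0, 1, 1; 0, 0, 0, 1] := by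
  ext i j
  have h : ∀ j, phi k (FreeGroup.of j) = ![a, b * a, c * a ^ (k + 1), d * c] j := by
    intro j
    show phiHom k (FreeGroup.of j) = _
    simp [phiHom]
  rw [abMatrix, Matrix.of_apply, h]
  fin_cases i <;> fin_cases j <;> simp [expSum, a, b, c, d]

/-- The action of `φ_k^p` on the abelianization. -/
theorem abMatrix_phi_pow (k p : ℕ) : ∃ t : ℤ, abMatrix (phi k ^ p) =
    !![1, (p : ℤ), ((k : ℤ) + 1) * p, t; 0, 1, 0, 0; 0, 0, 1, (p : ℤ); 0, 0, 0, 1] := by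
  induction p with
  | zero =>
    refine ⟨0, ?_⟩
    rw [pow_zero, abMatrix_one]
    ext i j
    fin_cases i <;> fin_cases j <;> simp
  | succ p ih =>
    obtain ⟨t, ht⟩ := ih
    refine ⟨t + ((k : ℤ) + 1) * p, ?_⟩
    rw [pow_succ, abMatrix_mul, ht, abMatrix_phi]
    ext i j
    fin_cases i <;> fin_cases j <;> simp [Matrix.mul_apply, Fin.sum_univ_four] <;> ring

/-- Two conjugate powers have conjugate matrices. If `A` conjugates the matrix of `φ_k^p` to that of
`φ_{k'}^{p'}`, the entries of `A` below the diagonal in the first column and left of the diagonal in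
the last row vanish, hence `A 0 0` and `A 3 3` are `±1`. -/
theorem conj_entries {k k' p p' : ℕ} (hp : 1 ≤ p) (hp' : 1 ≤ p')
    (h : IsConj (phi k ^ p) (phi k' ^ p')) :
    (p' : ℤ) ∣ p ∧ (k + 1) * p ^ 2 = (k' + 1) * p' ^ 2 := by
  obtain ⟨α, hα⟩ := isConj_iff.1 h
  have h1 : abMatrix α * abMatrix (phi k ^ p) = abMatrix (phi k' ^ p') * abMatrix α := by
    rw [← abMatrix_mul, ← abMatrix_mul, ← hα, inv_mul_cancel_right]
  have h2 : abMatrix α * abMatrix α⁻¹ = 1 := by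
    rw [← abMatrix_mul, mul_inv_cancel, abMatrix_one]
  have h3 : abMatrix α⁻¹ * abMatrix α = 1 := by
    rw [← abMatrix_mul, inv_mul_cancel, abMatrix_one]
  obtain ⟨t, ht⟩ := abMatrix_phi_pow k p
  obtain ⟨t', ht'⟩ := abMatrix_phi_pow k' p'
  rw [ht, ht'] at h1
  generalize abMatrix α = A at h1 h2 h3
  generalize abMatrix α⁻¹ = B at h2 h3
  have e : ∀ i j, _ := fun i j => congrFun (congrFun h1 i) j
  have f2 : ∀ i j, _ := fun i j => congrFun (congrFun h2 i) j
  have f3 : ∀ i j, _ := fun i j => congrFun (congrFun h3 i) j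
  simp only [Matrix.mul_apply, Fin.sum_univ_four] at e f2 f3
  have e00 := e 0 0
  have e01 := e 0 1
  have e02 := e 0 2
  have e11 := e 1 1
  have e13 := e 1 3
  have e21 := e 2 1
  have e23 := e 2 3
  have e31 := e 3 1
  have e33 := e 3 3
  simp at e00 e01 e02 e11 e13 e21 e23 e31 e33
  have hP : (0 : ℤ) < p := by exact_mod_cast hp
  have hP' : (0 : ℤ) < p' := by exact_mod_cast hp'
  have hp0 : p ≠ 0 := by omega
  -- the entries of `A` which have to vanish
  have a10 : A 1 0 = 0 := e11.resolve_right hp0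
  have a30 : A 3 0 = 0 := e31.resolve_right hp0
  have hm : (0 : ℤ) < k + 1 := by positivity
  have hm' : (0 : ℤ) < k' + 1 := by positivity
  have a20 : A 2 0 = 0 := by
    have h0 : ((k' : ℤ) + 1) * p' * A 2 0 = 0 := by
      rw [a10, a30] at e00; linear_combination -e00
    exact (mul_eq_zero.1 h0).resolve_left (mul_pos hm' hP').ne'
  have a31 : A 3 1 = 0 := by
    have h0 : (p' : ℤ) * A 3 1 = 0 := by
      rw [a20] at e21; linear_combination -e21
    exact (mul_eq_zero.1 h0).resolve_left hP'.ne'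
  have a32 : A 3 2 = 0 := by
    rw [a30] at e33
    exact (mul_eq_zero.1 (by linear_combination e33 : A 3 2 * (p : ℤ) = 0)).resolve_right hP.ne'
  have u0 : A 0 0 = 1 ∨ A 0 0 = -1 := by
    have h0 := f3 0 0
    rw [a10, a20, a30] at h0
    simp only [mul_zero, add_zero, Matrix.one_apply_eq] at h0
    exact Int.isUnit_iff.1 (IsUnit.of_mul_eq_one_right _ h0)
  have u3 : A 3 3 = 1 ∨ A 3 3 = -1 := by
    have h0 := f2 3 3
    rw [a30, a31, a32] at h0
    simp only [zero_mul, zero_add, Matrix.one_apply_eq] at h0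
    exact Int.isUnit_iff.1 (IsUnit.of_mul_eq_one _ h0)
  -- the relations between `p`, `p'` and `k`, `k'`
  have hdvd : A 0 0 * (p : ℤ) = p' * (A 1 1 + (k' + 1) * A 2 1) := by
    rw [a31] at e01; linear_combination e01
  have hsq : A 0 0 * ((k + 1) * (p : ℤ) ^ 2) = (k' + 1) * p' ^ 2 * A 3 3 := by
    have a12 : A 1 2 = 0 := by
      rw [a10] at e13
      exact (mul_eq_zero.1 (by linear_combination e13 : A 1 2 * (p : ℤ) = 0)).resolve_right hP.ne'
    rw [a12, a32] at e02
    rw [a20] at e23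
    linear_combination (p : ℤ) * e02 + ((k' : ℤ) + 1) * p' * e23
  constructor
  · rcases u0 with h0 | h0 <;> rw [h0] at hdvd
    · exact ⟨A 1 1 + (k' + 1) * A 2 1, by linear_combination hdvd⟩
    · exact ⟨-(A 1 1 + (k' + 1) * A 2 1), by linear_combination -hdvd⟩
  · have h1 : 0 < ((k : ℤ) + 1) * p ^ 2 := by positivity
    have h2 : 0 < ((k' : ℤ) + 1) * p' ^ 2 := by positivity
    zify
    rcases u0 with h0 | h0 <;> rcases u3 with h3 | h3 <;> rw [h0, h3] at hsq <;> linarith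

/-- By symmetry, `p` and `p'` divide each other, and then `(k + 1) p²` determines `k`. -/
theorem isConj_phi_pow_iff {k k' p p' : ℕ} (hp : 1 ≤ p) (hp' : 1 ≤ p') :
    IsConj (phi k ^ p) (phi k' ^ p') ↔ k = k' ∧ p = p' := by
  constructor
  · intro h
    obtain ⟨h1, h2⟩ := conj_entries hp hp' h
    obtain ⟨h3, -⟩ := conj_entries hp' hp h.symm
    obtain rfl : p = p' := Nat.dvd_antisymm (Int.natCast_dvd_natCast.1 h3)
      (Int.natCast_dvd_natCast.1 h1)
    have := Nat.eq_of_mul_eq_mul_right (by positivity) h2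
    exact ⟨by omega, rfl⟩
  · rintro ⟨rfl, rfl⟩
    exact IsConj.refl _

end FreeGroupDynamics

theorem mainTheorem2 :
    (∀ k : ℕ, 1 ≤ k →
      -- parabolic orbits
      HasParabolicOrbit (phi k) ∧
      IsParabolicFixedPoint (phi k) (baInf false) ∧
      ConvergesBothWays (phi k) (.ofGroup (b * d⁻¹)) (.ofBoundary (baInf false)) ∧
      -- the dynamics graph: vertices, edges, labels, number of components
      IsRotationless (phi k) ∧
      (∃ e : FigureVertex ≃ DynamicsVertex (phi k),
        (∀ v, (e v).1 = isoglossyClass (phi k) (v.point k)) ∧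
        ∀ v w, (dynamicsGraph (phi k)).Adj (e v) (e w) ↔ figureGraph.Adj v w) ∧
      (∀ v g w, FigureEdge v g w →
        IsOmega (phi k)⁻¹ (.ofGroup g) (.ofBoundary (v.point k)) ∧
        IsOmega (phi k) (.ofGroup g) (.ofBoundary (w.point k))) ∧
      Nat.card (dynamicsGraph (phi k)).toSimpleGraphInclusive.ConnectedComponent = 3) ∧
    -- conjugacy of powers in the automorphism group
    (∀ k k' p p' : ℕ, 1 ≤ k → 1 ≤ k' → 1 ≤ p → 1 ≤ p' →
      (IsConj (phi k ^ p) (phi k' ^ p') ↔ k = k' ∧ p = p')) := by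
  refine ⟨fun k hk => ⟨⟨_, isParabolicFixedPoint_baInf hk⟩, isParabolicFixedPoint_baInf hk,
      convergesBothWays_of_isOmega (isOmega_label hk .loop).1 (isOmega_label hk .loop).2,
      phi_isRotationless hk, ⟨vertexEquiv hk, vertexEquiv_val hk, dynamicsGraph_adj_iff hk⟩,
      fun _ _ _ h => isOmega_label hk h, card_dynamicsGraph_components hk⟩,
    fun _ _ _ _ _ _ hp hp' => isConj_phi_pow_iff hp hp'⟩
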